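/- Let $\mathfrak h$ be a finite-dimensional complex vector space and let $G\subseteq GL(\mathfrak h)$ be a finite group generated by reflections and acting irreducibly on $\mathfrak h$. Let $\mathcal S\subseteq G$ be the set of reflections, $t\in\mathbb C$, and let $c:\mathcal S\to\mathbb C$ be conjugation invariant. For $s\in\mathcal S$ let $\alpha_s\in\mathfrak h^*$, $\alpha_s^\vee\in\mathfrak h$ be eigenvectors for the nontrivial eigenvalues of $s$, with $\alpha_s(\alpha_s^\vee)=2$. The rational Cherednik algebra $\mathsf H=\mathsf H_{t,c}(G,\mathfrak h)$ is the unital associative $\mathbb C$-algebra generated by $\mathfrak h$, $\mathfrak h^*$ and $G$ with relations $[y,y']=0=[x,x']$, $gy=g(y)g$, $gx=g(x)g$ and $[y,x]=t\,x(y)-\sum_{s}c(s)\alpha_s(y)x(\alpha_s^\vee)s$ (for $y,y'\in\mathfrak h$, $x,x'\in\mathfrak h^*$, $g\in G$). It is $\mathbb Z$-graded with $\mathfrak h^*$, $\mathfrak h$, $G$ in degrees $1,-1,0$. For an irreducible finite-dimensional representation $\tau$ of $G$ let $M(\tau)=\mathsf H\otimes_{\mathbb C[\mathfrak h^*]\rtimes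 \mathbb C G}\tau$ be the standard module, where $\mathfrak h$ acts by $0$ on $\tau$, graded with $\tau$ in degree $0$. Let $L(\tau)$ be the quotient of $M(\tau)$ by the sum of all its proper graded submodules; it is a simple $\mathsf H$-module. Let $\mathcal C$ be the Clifford algebra of $\mathfrak h\oplus\mathfrak h^*$ with relation $vv'+v'v=-2(v,v')$, where $(\cdot,\cdot)$ is the symmetric bilinear form that extends the pairing of $\mathfrak h^*$ and $\mathfrak h$ and vanishes on $\mathfrak h\times\mathfrak h$ and $\mathfrak h^*\times\mathfrak h^*$. It acts on $S^*=\bigwedge\mathfrak h^*$ by $x\mapsto 2(x\wedge\cdot)$, $y\mapsto-\partial_y$, where $\partial_y$ is the odd derivation with $\partial_y x=x(y)$. Put $S^{*,+}=\bigwedge^{\rm even}\mathfrak h^*$ and $S^{*,-}=\bigwedge^{\rm odd}\mathfrak h^*$. For a graded $\mathsf H$-module $X$ let $D_X$ be the action of $\mathcal D=\sum_j x_j\otimes y_j+\sum_j y_j\otimes x_j\in\mathsf H\otimes\mathcal C$ on $X\otimes S^*$, where $(y_j)$, $(x_j)$ are dual bases of $\mathfrak h$, $\mathfrak h^*$, and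 let $D_X^\pm:X\otimes S^{*,\pm}\to X\otimes S^{*,\mp}$ be its restrictions. The Dirac cohomology $H_D^\pm(X)=\ker D_X^\pm/(\ker D_X^\pm\cap\operatorname{im}D_X^\mp)$ is a graded $G$-module, for the diagonal action of $G$ and the total grading of $X\otimes S^*$ (with $\mathfrak h^*\subset S^*$ in degree $1$). The Dirac index is the virtual graded $G$-module $I_D(X)=H_D^+(X)-H_D^-(X)$. The graded character of a (virtual) graded $G$-module $E=\bigoplus_nE_n$ is $\mathrm{ch}(E,g,\mathbf q)=\sum_n\mathrm{tr}(g,E_n)\mathbf q^n$. **Theorem A.** (1) For every irreducible representation $\tau$ of $G$, the module $L(\tau)$ is finite-dimensional in each degree and lives in degrees $\ge0$, the spaces $H_D^\pm(L(\tau))$ are finite-dimensional, and for every $g\in G$ $$\mathrm{ch}(L(\tau),g,\mathbf q)=\frac{\mathrm{ch}(I_D(L(\tau)),g,\mathbf q)}{\det_{\mathfrak h^*}(1-g\mathbf q)},$$ where $\mathrm{ch}(I_D(L(\tau)),g,\mathbf q)$ is a polynomial in $\mathbf q$. (2) Let $\mathrm{Irr}(G)$ be a finite set of representatives of the isomorphism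 classes of irreducible representations of $G$. For $\tau,\sigma\in\mathrm{Irr}(G)$ let $d_{\tau,\sigma}(\mathbf q)$ be the graded multiplicity of $\sigma$ in $I_D(L(\tau))$, and let $n_{\tau,\sigma}(\mathbf q)$ be the series whose coefficient of $\mathbf q^k$ is the multiplicity in $M(\tau)$, as a graded module, of $L(\sigma)$ shifted so that $\sigma$ is in degree $k$ (the largest number of subquotients of this type in a finite filtration of $M(\tau)$ by graded submodules). Then $d_{\tau,\sigma}(\mathbf q)\in\mathbb Z[\mathbf q]$; the multiplicities are finite and vanish for $k<0$, so that $n_{\tau,\sigma}(\mathbf q)\in\mathbb Z[[\mathbf q]]$, and $n_{\tau,\sigma}(\mathbf q)$ is a polynomial if $t\ne0$; and the matrices $[d_{\tau,\sigma}(\mathbf q)]$ and $[n_{\tau,\sigma}(\mathbf q)]$ are inverse to each other. -/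

import Mathlib

open scoped TensorProduct Polynomial PowerSeries

universe u v w

noncomputable section

namespace Cherednik

/-- A (complex) reflection: `g - 1` has rank one. -/
def IsReflection {V : Type u} [AddCommGroup V] [Module ℂ V] (g : V ≃ₗ[ℂ] V) : Prop :=
  Module.finrank ℂ (LinearMap.range (g.toLinearMap - LinearMap.id)) = 1

/-- The tautological representation on `V` of a subgroup `G` of `GL(V)`. -/
def stdRep {V : Type u} [AddCommGroup V] [Module ℂ V] (G : Subgroup (V ≃ₗ[ℂ] V)) :
    Representation ℂ G V where
  toFun g := (g : V ≃ₗ[ℂ] V).toLinearMap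
  map_one' := rfl
  map_mul' _ _ := rfl

/-- The data from which a rational Cherednik algebra is built: a finite group `G ⊆ GL(V)` generated
by reflections and acting irreducibly on `V`, a complex number `t`, a conjugation invariant function
`c` on the set of reflections of `G`, and, for every reflection `s`, eigenvectors `α s ∈ V^*` and
`αv s ∈ V` for the nontrivial eigenvalues of `s`, normalised by `α s (αv s) = 2`. -/
structure Datum (V : Type u) [AddCommGroup V] [Module ℂ V] [FiniteDimensional ℂ V] where
  G : Subgroup (V ≃ₗ[ℂ] V)
  finite : Finite G
  generated : Subgroup.closure {g | g ∈ G ∧ IsReflection g} = G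
  irreducible : (stdRep G).IsIrreducible
  t : ℂ
  c : {s : G // IsReflection (s : V ≃ₗ[ℂ] V)} → ℂ
  c_conj : ∀ s s', IsConj s.1 s'.1 → c s = c s'
  α : {s : G // IsReflection (s : V ≃ₗ[ℂ] V)} → Module.Dual ℂ V
  αv : {s : G // IsReflection (s : V ≃ₗ[ℂ] V)} → V
  α_eigen : ∀ s, ∃ l : ℂ, l ≠ 1 ∧ (stdRep G).dual s.1 (α s) = l • α s
  αv_eigen : ∀ s, ∃ l : ℂ, l ≠ 1 ∧ stdRep G s.1 (αv s) = l • αv s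
  pairing : ∀ s, α s (αv s) = 2

/-! ### The Clifford algebra and the spin module -/

/-- The quadratic form `(x, y) ↦ -2 x(y)` on `V^* ⊕ V`, that is `v ↦ -(v, v)`. -/
def cliffForm (V : Type u) [AddCommGroup V] [Module ℂ V] :
    QuadraticForm ℂ (Module.Dual ℂ V × V) :=
  (-2 : ℂ) • QuadraticForm.dualProd ℂ V

/-- The Clifford algebra of `V ⊕ V^*`, with the relation `v v' + v' v = -2 (v, v')`. -/
abbrev Cliff (V : Type u) [AddCommGroup V] [Module ℂ V] : Type u :=
  CliffordAlgebra (cliffForm V)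

/-- The spin module `S^* = ⋀ V^*`. -/
abbrev Spin (V : Type u) [AddCommGroup V] [Module ℂ V] : Type u :=
  ExteriorAlgebra ℂ (Module.Dual ℂ V)

/-- The odd derivation `∂_y` of `⋀ V^*` with `∂_y x = x(y)`. -/
def partialY {V : Type u} [AddCommGroup V] [Module ℂ V] (y : V) : Spin V →ₗ[ℂ] Spin V :=
  CliffordAlgebra.contractLeft (Q := (0 : QuadraticForm ℂ (Module.Dual ℂ V)))
    (Module.Dual.eval ℂ V y)

theorem partialY_mul {V : Type u} [AddCommGroup V] [Module ℂ V] (y : V) (x : Module.Dual ℂ V) (ω : Spin V) :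
    partialY y (ExteriorAlgebra.ι ℂ x * ω) = x y • ω - ExteriorAlgebra.ι ℂ x * partialY y ω :=
  CliffordAlgebra.contractLeft_ι_mul _ x ω

theorem partialY_add {V : Type u} [AddCommGroup V] [Module ℂ V] (y y' : V) (ω : Spin V) :
    partialY (y + y') ω = partialY y ω + partialY y' ω := by
  simp [partialY]

theorem partialY_smul {V : Type u} [AddCommGroup V] [Module ℂ V] (r : ℂ) (y : V) (ω : Spin V) :
    partialY (r • y) ω = r • partialY y ω := by
  simp [partialY]

theorem partialY_partialY {V : Type u} [AddCommGroup V] [Module ℂ V] (y : V) (ω : Spin V) : partialY y (partialY y ω) = 0 :=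
  CliffordAlgebra.contractLeft_contractLeft _ ω

/-- The linear map `V^* ⊕ V → End(⋀ V^*)`, `x ↦ 2 (x ∧ ·)` and `y ↦ -∂_y`. -/
def spinLin (V : Type u) [AddCommGroup V] [Module ℂ V] :
    Module.Dual ℂ V × V →ₗ[ℂ] Module.End ℂ (Spin V) where
  toFun p := (2 : ℂ) • LinearMap.mulLeft ℂ (ExteriorAlgebra.ι ℂ p.1) - partialY p.2
  map_add' p q := by
    ext ω
    simp [partialY, add_mul, smul_add]
    abel
  map_smul' a p := by
    ext ω
    simp [partialY, smul_sub, smul_comm a (2 : ℂ)]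

/-- The Clifford action on `S^* = ⋀ V^*`: `x` acts by `2 (x ∧ ·)` and `y` by `-∂_y`. -/
def spinHom (V : Type u) [AddCommGroup V] [Module ℂ V] : Cliff V →ₐ[ℂ] Module.End ℂ (Spin V) :=
  CliffordAlgebra.lift (cliffForm V) ⟨spinLin V, fun p => by
    refine LinearMap.ext fun ω => ?_
    have h1 : ExteriorAlgebra.ι ℂ p.1 * (ExteriorAlgebra.ι ℂ p.1 * ω) = 0 := by
      rw [← mul_assoc, ExteriorAlgebra.ι_sq_zero, zero_mul]
    simp only [spinLin, cliffForm, LinearMap.coe_mk, AddHom.coe_mk, Module.End.mul_apply,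
      LinearMap.sub_apply, LinearMap.smul_apply, LinearMap.mulLeft_apply,
      mul_sub, mul_smul_comm, h1, partialY_mul, partialY_partialY, smul_zero, sub_zero, zero_sub,
      smul_apply, QuadraticForm.dualProd_apply, Module.algebraMap_end_apply, smul_eq_mul]
    module⟩

/-- The part `⋀^even V^*` (`ε = 0`) or `⋀^odd V^*` (`ε = 1`) of the spin module. -/
def spinPart (V : Type u) [AddCommGroup V] [Module ℂ V] (ε : ZMod 2) : Submodule ℂ (Spin V) :=
  ⨆ (l : ℕ) (_ : (l : ZMod 2) = ε), ⋀[ℂ]^l (Module.Dual ℂ V)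

theorem sum_dual_basis {V : Type u} [AddCommGroup V] [Module ℂ V] {Z : Type w} [AddCommGroup Z] [Module ℂ Z] {ι ι' : Type} [Fintype ι]
    [Fintype ι'] (b : Module.Basis ι ℂ V) (b' : Module.Basis ι' ℂ V)
    (B : Module.Dual ℂ V →ₗ[ℂ] V →ₗ[ℂ] Z) :
    ∑ i, B (b'.coord i) (b' i) = ∑ j, B (b.coord j) (b j) := by
  have h1 : ∀ i, B (b'.coord i) (b' i) = ∑ j, b.coord j (b' i) • B (b'.coord i) (b j) := by
    intro i
    conv_lhs => rw [← b.sum_repr (b' i)]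
    simp only [map_sum, map_smul, Module.Basis.coord_apply]
  have h2 : ∀ j, b.coord j = ∑ i, b.coord j (b' i) • b'.coord i := by
    intro j
    refine b'.ext fun i => ?_
    classical
    simp [Finsupp.single_apply]
  simp_rw [h1]
  rw [Finset.sum_comm]
  refine Finset.sum_congr rfl fun j _ => ?_
  conv_rhs => rw [h2 j]
  simp

section

variable {V : Type u} [AddCommGroup V] [Module ℂ V] [FiniteDimensional ℂ V] (D : Datum V)

instance : Finite D.G := D.finite

/-- The set of reflections of `G`. -/
abbrev Refl : Type u := {s : D.G // IsReflection (s : V ≃ₗ[ℂ] V)}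

instance : Fintype (Refl D) := Fintype.ofFinite _

/-- The action of `G` on `V^*`. -/
abbrev dualRep : Representation ℂ D.G (Module.Dual ℂ V) := (stdRep D.G).dual

/-! ### The rational Cherednik algebra -/

/-- Generators: vectors `y ∈ V`, covectors `x ∈ V^*`, group elements. -/
inductive Gen : Type u
  | y (v : V)
  | x (f : Module.Dual ℂ V)
  | g (a : D.G)

/-- The degree of a generator: `1` on `V^*`, `-1` on `V`, `0` on `G`. -/
def Gen.deg {D : Datum V} : Gen D → ℤ
  | .y _ => -1
  | .x _ => 1
  | .g _ => 0

/-- A generator in the free algebra. -/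
abbrev fr (a : Gen D) : FreeAlgebra ℂ (Gen D) := FreeAlgebra.ι ℂ a

/-- The defining relations. The first six say that the generators in `V`, in `V^*` and in `G`
come from the tensor algebra of `V ⊕ V^*` and from the group algebra of `G`. -/
inductive Rel : FreeAlgebra ℂ (Gen D) → FreeAlgebra ℂ (Gen D) → Prop
  | y_add (v v' : V) : Rel (fr D (.y (v + v'))) (fr D (.y v) + fr D (.y v'))
  | y_smul (a : ℂ) (v : V) : Rel (fr D (.y (a • v))) (a • fr D (.y v))
  | x_add (f f' : Module.Dual ℂ V) : Rel (fr D (.x (f + f'))) (fr D (.x f) + fr D (.x f'))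
  | x_smul (a : ℂ) (f : Module.Dual ℂ V) : Rel (fr D (.x (a • f))) (a • fr D (.x f))
  | g_one : Rel (fr D (.g 1)) 1
  | g_mul (a b : D.G) : Rel (fr D (.g (a * b))) (fr D (.g a) * fr D (.g b))
  | y_comm (v v' : V) : Rel (fr D (.y v) * fr D (.y v')) (fr D (.y v') * fr D (.y v))
  | x_comm (f f' : Module.Dual ℂ V) :
      Rel (fr D (.x f) * fr D (.x f')) (fr D (.x f') * fr D (.x f))
  | g_y (a : D.G) (v : V) :
      Rel (fr D (.g a) * fr D (.y v)) (fr D (.y (stdRep D.G a v)) * fr D (.g a))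
  | g_x (a : D.G) (f : Module.Dual ℂ V) :
      Rel (fr D (.g a) * fr D (.x f)) (fr D (.x (dualRep D a f)) * fr D (.g a))
  | y_x (v : V) (f : Module.Dual ℂ V) :
      Rel (fr D (.y v) * fr D (.x f) - fr D (.x f) * fr D (.y v))
        ((D.t * f v) • (1 : FreeAlgebra ℂ (Gen D)) -
          ∑ s : Refl D, (D.c s * D.α s v * f (D.αv s)) • fr D (.g s.1))

/-- The rational Cherednik algebra `H_{t,c}(G, V)`. -/
def RCA : Type u := RingQuot (Rel D)

instance : Ring (RCA D) := inferInstanceAs (Ring (RingQuot (Rel D)))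

instance : Algebra ℂ (RCA D) := inferInstanceAs (Algebra ℂ (RingQuot (Rel D)))

/-- The image of a generator in the rational Cherednik algebra. -/
def gen (a : Gen D) : RCA D := RingQuot.mkAlgHom ℂ (Rel D) (fr D a)

theorem gen_g_one : gen D (.g 1) = 1 := by
  have h := RingQuot.mkAlgHom_rel ℂ (Rel.g_one (D := D))
  rw [map_one] at h
  exact h

theorem gen_g_mul (a b : D.G) : gen D (.g (a * b)) = gen D (.g a) * gen D (.g b) := by
  have h := RingQuot.mkAlgHom_rel ℂ (Rel.g_mul (D := D) a b)
  rw [map_mul] at h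
  exact h

theorem gen_g_y (a : D.G) (v : V) :
    gen D (.g a) * gen D (.y v) = gen D (.y (stdRep D.G a v)) * gen D (.g a) := by
  have h := RingQuot.mkAlgHom_rel ℂ (Rel.g_y (D := D) a v)
  rw [map_mul, map_mul] at h
  exact h

theorem gen_g_x (a : D.G) (f : Module.Dual ℂ V) :
    gen D (.g a) * gen D (.x f) = gen D (.x (dualRep D a f)) * gen D (.g a) := by
  have h := RingQuot.mkAlgHom_rel ℂ (Rel.g_x (D := D) a f)
  rw [map_mul, map_mul] at h
  exact h

/-- The linear map `V → H`. -/
def yHom : V →ₗ[ℂ] RCA D where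
  toFun v := gen D (.y v)
  map_add' v v' := by
    have h := RingQuot.mkAlgHom_rel ℂ (Rel.y_add (D := D) v v')
    rw [map_add] at h
    exact h
  map_smul' a v := by
    have h := RingQuot.mkAlgHom_rel ℂ (Rel.y_smul (D := D) a v)
    rw [map_smul] at h
    exact h

/-- The linear map `V^* → H`. -/
def xHom : Module.Dual ℂ V →ₗ[ℂ] RCA D where
  toFun v := gen D (.x v)
  map_add' v v' := by
    have h := RingQuot.mkAlgHom_rel ℂ (Rel.x_add (D := D) v v')
    rw [map_add] at h
    exact h
  map_smul' a v := by
    have h := RingQuot.mkAlgHom_rel ℂ (Rel.x_smul (D := D) a v)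
    rw [map_smul] at h
    exact h

/-- The homomorphism from `G` to the multiplicative monoid of `H`. -/
def gHom : D.G →* RCA D where
  toFun a := gen D (.g a)
  map_one' := gen_g_one D
  map_mul' := gen_g_mul D

/-- The degree `n` part of `H`: the span of the words of total degree `n` in the generators. -/
def degPart (n : ℤ) : Submodule ℂ (RCA D) :=
  Submodule.span ℂ
    {z | ∃ l : List (Gen D), (l.map Gen.deg).sum = n ∧ z = (l.map (gen D)).prod}

/-! ### Graded representations of `G` -/

/-- A family of `G`-stable subspaces `E_n` of a representation, indexed by degrees `n ∈ ℤ`. -/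
structure RepGrading {G : Type u} [Group G] {E : Type v} [AddCommGroup E] [Module ℂ E]
    (ρ : Representation ℂ G E) where
  part : ℤ → Submodule ℂ E
  stable : ∀ n g, part n ≤ (part n).comap (ρ g)

/-- The representation of `G` on the degree `n` part. -/
abbrev RepGrading.rep {G : Type u} [Group G] {E : Type v} [AddCommGroup E] [Module ℂ E]
    {ρ : Representation ℂ G E} (𝓔 : RepGrading ρ) (n : ℤ) : Representation ℂ G (𝓔.part n) :=
  ρ.subrepresentation (𝓔.part n) (𝓔.stable n)

/-- The multiplicity of an irreducible representation `σ` of `G` in the degree `n` part: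
the dimension of `Hom_G(σ, E_n)`. -/
def RepGrading.mult {G : Type u} [Group G] {E : Type v} [AddCommGroup E] [Module ℂ E]
    {ρ : Representation ℂ G E} (𝓔 : RepGrading ρ)
    {W : Type w} [AddCommGroup W] [Module ℂ W] (σ : Representation ℂ G W) (n : ℤ) : ℕ :=
  Module.finrank ℂ (Representation.IntertwiningMap σ (𝓔.rep n))

/-! ### The Dirac element and the action of `G` on the spin module -/

/-- The Dirac element `∑_j x_j ⊗ y_j + ∑_j y_j ⊗ x_j` of `H ⊗ C`, where `(y_j)` is a basis of `V` and
`(x_j)` is the dual basis of `V^*` (it does not depend on the basis). -/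
def dirac : RCA D ⊗[ℂ] Cliff V :=
  ∑ j, xHom D ((Module.finBasis ℂ V).coord j) ⊗ₜ[ℂ]
      CliffordAlgebra.ι (cliffForm V) (0, Module.finBasis ℂ V j) +
    ∑ j, yHom D (Module.finBasis ℂ V j) ⊗ₜ[ℂ]
      CliffordAlgebra.ι (cliffForm V) ((Module.finBasis ℂ V).coord j, 0)

/-- The action of `G` on the spin module `⋀ V^*`. -/
def spinRep : Representation ℂ D.G (Spin V) where
  toFun a := (ExteriorAlgebra.map (dualRep D a)).toLinearMap
  map_one' := by
    rw [map_one, Module.End.one_eq_id, ExteriorAlgebra.map_id]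
    rfl
  map_mul' a b := by
    rw [map_mul, Module.End.mul_eq_comp, ← ExteriorAlgebra.map_comp_map]
    rfl

theorem exteriorPower_stable (a : D.G) (l : ℕ) :
    ⋀[ℂ]^l (Module.Dual ℂ V) ≤ (⋀[ℂ]^l (Module.Dual ℂ V)).comap (spinRep D a) := by
  rw [← Submodule.map_le_iff_le_comap]
  change Submodule.map (ExteriorAlgebra.map (dualRep D a)).toLinearMap
    (LinearMap.range (ExteriorAlgebra.ι ℂ) ^ l) ≤ LinearMap.range (ExteriorAlgebra.ι ℂ) ^ l
  rw [Submodule.map_pow]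
  refine pow_le_pow_left' ?_ l
  rintro _ ⟨_, ⟨f, rfl⟩, rfl⟩
  exact ⟨dualRep D a f, (ExteriorAlgebra.map_apply_ι _ _).symm⟩

theorem spinPart_stable (a : D.G) (ε : ZMod 2) :
    spinPart V ε ≤ (spinPart V ε).comap (spinRep D a) := by
  refine iSup₂_le fun l hl => (exteriorPower_stable D a l).trans ?_
  exact Submodule.comap_mono (le_iSup₂_of_le l hl le_rfl)

theorem spinRep_partialY (a : D.G) (y : V) (ω : Spin V) :
    spinRep D a (partialY y ω) = partialY (stdRep D.G a y) (spinRep D a ω) := by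
  induction ω using CliffordAlgebra.left_induction with
  | algebraMap r =>
    have h1 : ∀ z : V, partialY z (algebraMap ℂ (Spin V) r) = 0 := fun z => by
      unfold partialY
      exact CliffordAlgebra.contractLeft_algebraMap _ _ r
    have h2 : spinRep D a (algebraMap ℂ (Spin V) r) = algebraMap ℂ (Spin V) r :=
      AlgHom.commutes (ExteriorAlgebra.map (dualRep D a)) r
    erw [h1, h2, h1, map_zero]
  | add p q hp hq => simp only [map_add, hp, hq]
  | ι_mul p x hp =>
    have hm : ∀ (x : Module.Dual ℂ V) (ω : Spin V), spinRep D a (ExteriorAlgebra.ι ℂ x * ω) =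
        ExteriorAlgebra.ι ℂ (dualRep D a x) * spinRep D a ω := by
      intro x ω
      change ExteriorAlgebra.map (dualRep D a) _ = _ * ExteriorAlgebra.map (dualRep D a) ω
      rw [map_mul, ExteriorAlgebra.map_apply_ι]
    change spinRep D a (partialY y (ExteriorAlgebra.ι ℂ x * p)) =
      partialY (stdRep D.G a y) (spinRep D a (ExteriorAlgebra.ι ℂ x * p))
    have hx : (dualRep D a x) (stdRep D.G a y) = x y := by
      change x (stdRep D.G a⁻¹ (stdRep D.G a y)) = x y
      rw [Representation.inv_self_apply]
    rw [partialY_mul, map_sub, map_smul, hm, hm, hp, partialY_mul, hx]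

/-! ### The Dirac operator, Dirac cohomology and its `G`-action -/

section Module

variable (X : Type v) [AddCommGroup X] [Module ℂ X] [Module (RCA D) X] [IsScalarTower ℂ (RCA D) X]

/-- The restriction to `G` of an `H`-module. -/
def gRep : Representation ℂ D.G X :=
  ((Algebra.lsmul ℂ ℂ X : RCA D →ₐ[ℂ] Module.End ℂ X) : RCA D →* Module.End ℂ X).comp (gHom D)

/-- The diagonal action of `G` on `X ⊗ S^*`. -/
abbrev totRep : Representation ℂ D.G (X ⊗[ℂ] Spin V) := (gRep D X).tprod (spinRep D)

/-- The action of `H ⊗ C` on `X ⊗ S^*`. -/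
def diracAction : RCA D ⊗[ℂ] Cliff V →ₐ[ℂ] Module.End ℂ (X ⊗[ℂ] Spin V) :=
  (Module.endTensorEndAlgHom (R := ℂ) (S := ℂ) (A := ℂ) (M := X) (N := Spin V)).comp
    (Algebra.TensorProduct.map (Algebra.lsmul ℂ ℂ X) (spinHom V))

/-- The Dirac operator `D_X` on `X ⊗ S^*`. -/
def diracOp : Module.End ℂ (X ⊗[ℂ] Spin V) := diracAction D X (dirac D)

/-- `X ⊗ S^{*,+}` for `ε = 0` and `X ⊗ S^{*,-}` for `ε = 1`. -/
def evenOddPart (ε : ZMod 2) : Submodule ℂ (X ⊗[ℂ] Spin V) :=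
  Submodule.map₂ (TensorProduct.mk ℂ X (Spin V)) ⊤ (spinPart V ε)

/-- `ker D_X^±`, where `D_X^±` is the restriction of `D_X` to `X ⊗ S^{*,±}`. -/
def kerPart (ε : ZMod 2) : Submodule ℂ (X ⊗[ℂ] Spin V) :=
  evenOddPart (V := V) X ε ⊓ LinearMap.ker (diracOp D X)

/-- `im D_X^∓`, the image of `X ⊗ S^{*,∓}`. -/
def imPart (ε : ZMod 2) : Submodule ℂ (X ⊗[ℂ] Spin V) :=
  (evenOddPart (V := V) X (ε + 1)).map (diracOp D X)

theorem diracOp_eq : diracOp D X =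
    ∑ j, TensorProduct.map (Algebra.lsmul ℂ ℂ X (xHom D ((Module.finBasis ℂ V).coord j)))
        (-partialY (Module.finBasis ℂ V j)) +
      ∑ j, TensorProduct.map (Algebra.lsmul ℂ ℂ X (yHom D (Module.finBasis ℂ V j)))
        ((2 : ℂ) • LinearMap.mulLeft ℂ (ExteriorAlgebra.ι ℂ ((Module.finBasis ℂ V).coord j))) := by
  have h1 : ∀ (h : RCA D) (p : Module.Dual ℂ V × V),
      diracAction D X (h ⊗ₜ[ℂ] CliffordAlgebra.ι (cliffForm V) p) =
        TensorProduct.map (Algebra.lsmul ℂ ℂ X h) (spinLin V p) := by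
    intro h p
    have h2 : spinHom V (CliffordAlgebra.ι (cliffForm V) p) = spinLin V p :=
      CliffordAlgebra.lift_ι_apply _ _ _
    rw [← h2]
    rfl
  have h3 : ∀ y : V, spinLin V (0, y) = -partialY y := by
    intro y
    ext
    simp [spinLin]
  have h4 : ∀ x : Module.Dual ℂ V,
      spinLin V (x, 0) = (2 : ℂ) • LinearMap.mulLeft ℂ (ExteriorAlgebra.ι ℂ x) := by
    intro x
    ext
    simp [spinLin, partialY]
  rw [diracOp, dirac, map_add, map_sum, map_sum]
  simp only [h1, h3, h4]

theorem gRep_x (a : D.G) (f : Module.Dual ℂ V) (m : X) :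
    gRep D X a (xHom D f • m) = xHom D (dualRep D a f) • gRep D X a m := by
  change gen D (.g a) • gen D (.x f) • m = gen D (.x (dualRep D a f)) • gen D (.g a) • m
  rw [← mul_smul, ← mul_smul, gen_g_x]

theorem gRep_y (a : D.G) (y : V) (m : X) :
    gRep D X a (yHom D y • m) = yHom D (stdRep D.G a y) • gRep D X a m := by
  change gen D (.g a) • gen D (.y y) • m = gen D (.y (stdRep D.G a y)) • gen D (.g a) • m
  rw [← mul_smul, ← mul_smul, gen_g_y]

theorem spinRep_mul (a : D.G) (x : Module.Dual ℂ V) (ω : Spin V) :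
    spinRep D a (ExteriorAlgebra.ι ℂ x * ω) =
      ExteriorAlgebra.ι ℂ (dualRep D a x) * spinRep D a ω := by
  change ExteriorAlgebra.map (dualRep D a) _ = _ * ExteriorAlgebra.map (dualRep D a) ω
  rw [map_mul, ExteriorAlgebra.map_apply_ι]

/-- The Dirac operator is `G`-equivariant. -/
theorem dirac_comm (a : D.G) (z : X ⊗[ℂ] Spin V) :
    totRep D X a (diracOp D X z) = diracOp D X (totRep D X a z) := by
  induction z using TensorProduct.induction_on with
  | zero => simp only [map_zero]
  | add z z' hz hz' => simp only [map_add, hz, hz']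
  | tmul m ω =>
    let b := Module.finBasis ℂ V
    let b' := b.map (a : V ≃ₗ[ℂ] V)
    have hb : ∀ j, b' j = stdRep D.G a (b j) := fun j => rfl
    have hc : ∀ j, b'.coord j = dualRep D a (b.coord j) := fun j => rfl
    let B1 : Module.Dual ℂ V →ₗ[ℂ] V →ₗ[ℂ] X ⊗[ℂ] Spin V := LinearMap.mk₂ ℂ
      (fun f y => (xHom D f • gRep D X a m) ⊗ₜ[ℂ] (-partialY y (spinRep D a ω)))
      (fun f f' y => by rw [map_add, add_smul, TensorProduct.add_tmul])
      (fun r f y => by rw [map_smul, smul_assoc, TensorProduct.smul_tmul'])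
      (fun f y y' => by rw [partialY_add, neg_add, TensorProduct.tmul_add])
      (fun r f y => by rw [partialY_smul, ← smul_neg, TensorProduct.tmul_smul])
    let B2 : Module.Dual ℂ V →ₗ[ℂ] V →ₗ[ℂ] X ⊗[ℂ] Spin V := LinearMap.mk₂ ℂ
      (fun f y => (yHom D y • gRep D X a m) ⊗ₜ[ℂ]
        ((2 : ℂ) • (ExteriorAlgebra.ι ℂ f * spinRep D a ω)))
      (fun f f' y => by rw [map_add, add_mul, smul_add, TensorProduct.tmul_add])
      (fun r f y => by
        rw [map_smul, smul_mul_assoc, smul_comm (2 : ℂ) r, TensorProduct.tmul_smul])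
      (fun f y y' => by rw [map_add, add_smul, TensorProduct.add_tmul])
      (fun r f y => by rw [map_smul, smul_assoc, TensorProduct.smul_tmul'])
    have h1 := sum_dual_basis b b' B1
    have h2 := sum_dual_basis b b' B2
    have hL : totRep D X a (diracOp D X (m ⊗ₜ[ℂ] ω)) =
        ∑ j, B1 (b'.coord j) (b' j) + ∑ j, B2 (b'.coord j) (b' j) := by
      simp only [diracOp_eq, LinearMap.add_apply, LinearMap.sum_apply, TensorProduct.map_tmul,
        map_add, map_sum, Representation.tprod_apply, Algebra.lsmul_coe, gRep_x, gRep_y,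
        LinearMap.neg_apply, map_neg, LinearMap.smul_apply, map_smul, LinearMap.mulLeft_apply,
        spinRep_mul, spinRep_partialY, hb, hc, B1, B2, LinearMap.mk₂_apply]
      rfl
    have hR : diracOp D X (totRep D X a (m ⊗ₜ[ℂ] ω)) =
        ∑ j, B1 (b.coord j) (b j) + ∑ j, B2 (b.coord j) (b j) := by
      simp only [diracOp_eq, LinearMap.add_apply, LinearMap.sum_apply, TensorProduct.map_tmul,
        Representation.tprod_apply, Algebra.lsmul_coe,
        LinearMap.neg_apply, LinearMap.smul_apply, LinearMap.mulLeft_apply,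
        B1, B2, LinearMap.mk₂_apply]
      rfl
    rw [hL, hR, h1, h2]

theorem map₂_stable (a : D.G) (A : Submodule ℂ X) (B : Submodule ℂ (Spin V))
    (hA : A ≤ A.comap (gRep D X a)) (hB : B ≤ B.comap (spinRep D a)) :
    Submodule.map₂ (TensorProduct.mk ℂ X (Spin V)) A B ≤
      (Submodule.map₂ (TensorProduct.mk ℂ X (Spin V)) A B).comap (totRep D X a) :=
  Submodule.map₂_le.2 fun _ hm _ hn => Submodule.apply_mem_map₂ _ (hA hm) (hB hn)

theorem evenOddPart_stable (a : D.G) (ε : ZMod 2) :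
    evenOddPart (V := V) X ε ≤ (evenOddPart (V := V) X ε).comap (totRep D X a) :=
  map₂_stable D X a _ _ (fun _ _ => trivial) (spinPart_stable D a ε)

theorem kerPart_stable (ε : ZMod 2) (a : D.G) :
    kerPart D X ε ≤ (kerPart D X ε).comap (totRep D X a) := by
  rintro z ⟨h1, h2⟩
  refine ⟨evenOddPart_stable D X a ε h1, ?_⟩
  have h3 : diracOp D X z = 0 := h2
  change diracOp D X (totRep D X a z) = 0
  rw [← dirac_comm, h3, map_zero]

theorem imPart_stable (ε : ZMod 2) (a : D.G) :
    imPart D X ε ≤ (imPart D X ε).comap (totRep D X a) := by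
  rintro _ ⟨z, h1, rfl⟩
  exact ⟨totRep D X a z, evenOddPart_stable D X a _ h1, (dirac_comm D X a z).symm⟩

/-- The Dirac cohomology `H_D^±(X) = ker D_X^± / (ker D_X^± ∩ im D_X^∓)`, with `H_D^+` for `ε = 0`
and `H_D^-` for `ε = 1`. -/
abbrev DiracCoh (ε : ZMod 2) : Type (max u v) :=
  ↥(kerPart D X ε) ⧸ (imPart D X ε).submoduleOf (kerPart D X ε)

/-- The action of `G` on `H_D^±(X)`. -/
def diracCohRep (ε : ZMod 2) : Representation ℂ D.G (DiracCoh D X ε) :=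
  ((totRep D X).subrepresentation (kerPart D X ε) (kerPart_stable D X ε)).quotient
    ((imPart D X ε).submoduleOf (kerPart D X ε)) fun a _ hz => imPart_stable D X ε a hz

variable {X}

/-- The degree `n` part of `X ⊗ S^*` for the total grading, where `V^*` has degree `1` in
`S^* = ⋀ V^*`. -/
def totPart (𝓧 : RepGrading (gRep D X)) (n : ℤ) : Submodule ℂ (X ⊗[ℂ] Spin V) :=
  ⨆ l : ℕ, Submodule.map₂ (TensorProduct.mk ℂ X (Spin V)) (𝓧.part (n - l))
    (⋀[ℂ]^l (Module.Dual ℂ V))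

theorem totPart_stable (𝓧 : RepGrading (gRep D X)) (n : ℤ) (a : D.G) :
    totPart D 𝓧 n ≤ (totPart D 𝓧 n).comap (totRep D X a) :=
  iSup_le fun l => (map₂_stable D X a _ _ (𝓧.stable _ a) (exteriorPower_stable D a l)).trans
    (Submodule.comap_mono (le_iSup_of_le l le_rfl))

/-- The grading of `H_D^±(X)`: its degree `n` part is the image of the degree `n` part of
`ker D_X^±`. -/
def diracCohGrading (𝓧 : RepGrading (gRep D X)) (ε : ZMod 2) :
    RepGrading (diracCohRep D X ε) where
  part n := ((totPart D 𝓧 n).submoduleOf (kerPart D X ε)).map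
    ((imPart D X ε).submoduleOf (kerPart D X ε)).mkQ
  stable n a := by
    rintro _ ⟨z, hz, rfl⟩
    exact ⟨(totRep D X).subrepresentation (kerPart D X ε) (kerPart_stable D X ε) a z,
      totPart_stable D 𝓧 n a hz, rfl⟩

/-- The coefficient in degree `n` of the graded character at `g` of `X`. -/
def charCoeff (𝓧 : RepGrading (gRep D X)) (g : D.G) (n : ℤ) : ℂ :=
  (𝓧.rep n).character g

/-- The coefficient in degree `n` of the graded character at `g` of the virtual graded
`G`-module `I_D(X) = H_D^+(X) - H_D^-(X)`. -/
def indexCharCoeff (𝓧 : RepGrading (gRep D X)) (g : D.G) (n : ℤ) : ℂ :=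
  ((diracCohGrading D 𝓧 0).rep n).character g - ((diracCohGrading D 𝓧 1).rep n).character g

/-- The multiplicity in degree `n` of an irreducible representation `σ` of `G` in the virtual graded
`G`-module `I_D(X) = H_D^+(X) - H_D^-(X)`. -/
def indexMult (𝓧 : RepGrading (gRep D X)) {W : Type w} [AddCommGroup W] [Module ℂ W]
    (σ : Representation ℂ D.G W) (n : ℤ) : ℤ :=
  ((diracCohGrading D 𝓧 0).mult σ n : ℤ) - (diracCohGrading D 𝓧 1).mult σ n

end Module

/-- The polynomial `det_{V^*}(1 - g q)` in the indeterminate `q`. -/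
def detDual (g : D.G) : ℂ[X] :=
  LinearMap.det (1 - (Polynomial.X : ℂ[X]) • (dualRep D g).baseChange ℂ[X])

/-! ### Standard modules, their simple quotients, and graded multiplicities -/

section Standard

variable {W : Type w} [AddCommGroup W] [Module ℂ W] (τ : Representation ℂ D.G W)

/-- The relations that cut out the tensor product of `H` with `τ` over the subalgebra generated by
`V` and `G`, where `V` acts by `0` on `τ`. -/
def vermaRel : Submodule (RCA D) (RCA D ⊗[ℂ] W) :=
  Submodule.span (RCA D)
    ({z | ∃ (a : D.G) (v : W), z = gen D (.g a) ⊗ₜ[ℂ] v - 1 ⊗ₜ[ℂ] τ a v} ∪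
      {z | ∃ (y : V) (v : W), z = gen D (.y y) ⊗ₜ[ℂ] v})

/-- The standard module `M(τ)`. -/
abbrev Verma : Type (max u w) := (RCA D ⊗[ℂ] W) ⧸ vermaRel D τ

/-- The degree `n` part of `M(τ)`, where `τ` is in degree `0`. -/
def vermaPart (n : ℤ) : Submodule ℂ (Verma D τ) :=
  Submodule.span ℂ
    {m | ∃ h ∈ degPart D n, ∃ v : W, m = Submodule.Quotient.mk (h ⊗ₜ[ℂ] v)}

/-- A submodule of `M(τ)` is graded if it is spanned by its homogeneous elements. -/
def IsGraded (N : Submodule (RCA D) (Verma D τ)) : Prop :=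
  N.restrictScalars ℂ ≤ ⨆ n : ℤ, N.restrictScalars ℂ ⊓ vermaPart D τ n

/-- The sum of all proper graded submodules of `M(τ)`. -/
def maxSub : Submodule (RCA D) (Verma D τ) := sSup {N | IsGraded D τ N ∧ N ≠ ⊤}

/-- The module `L(τ)`, the simple graded quotient of `M(τ)`. -/
abbrev Simple : Type (max u w) := Verma D τ ⧸ maxSub D τ

theorem degPart_stable (a : D.G) (n : ℤ) (h : RCA D) (hh : h ∈ degPart D n) :
    gen D (.g a) * h ∈ degPart D n := by
  induction hh using Submodule.span_induction with
  | zero => rw [mul_zero]; exact Submodule.zero_mem _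
  | add x y _ _ hx hy => rw [mul_add]; exact Submodule.add_mem _ hx hy
  | smul r x _ hx => rw [mul_smul_comm]; exact Submodule.smul_mem _ r hx
  | mem x hx =>
    obtain ⟨l, hl, rfl⟩ := hx
    exact Submodule.subset_span ⟨.g a :: l, by simpa [Gen.deg] using hl, by simp⟩

theorem vermaPart_stable (n : ℤ) (a : D.G) :
    vermaPart D τ n ≤ (vermaPart D τ n).comap (gRep D (Verma D τ) a) := by
  refine Submodule.span_le.2 ?_
  rintro _ ⟨h, hh, v, rfl⟩
  exact Submodule.subset_span ⟨gen D (.g a) * h, degPart_stable D a n h hh, v, rfl⟩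

/-- The grading of `L(τ)` inherited from `M(τ)`. -/
def simpleGrading : RepGrading (gRep D (Simple D τ)) where
  part n := (vermaPart D τ n).map ((maxSub D τ).mkQ.restrictScalars ℂ)
  stable n a := by
    rintro _ ⟨m, hm, rfl⟩
    exact ⟨gRep D (Verma D τ) a m, vermaPart_stable D τ n a hm, rfl⟩

variable {W' : Type v} [AddCommGroup W'] [Module ℂ W'] (σ : Representation ℂ D.G W')

/-- For graded submodules `N ≤ N'` of `M(τ)`: the subquotient `N' / N` is isomorphic, as a graded
module, to `L(σ)` with its grading shifted so that `σ` is in degree `k`. -/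
def IsShiftedSimple (k : ℤ) (N N' : Submodule (RCA D) (Verma D τ)) : Prop :=
  ∃ e : (↥N' ⧸ N.submoduleOf N') ≃ₗ[RCA D] Simple D σ,
    ∀ (n : ℤ) (m : N'), (m : Verma D τ) ∈ vermaPart D τ (n + k) →
      e (Submodule.Quotient.mk m) ∈ (simpleGrading D σ).part n

/-- The multiplicity of `L(σ)`, with `σ` in degree `k`, in `M(τ)`: the largest number of
subquotients of this type in a finite filtration of `M(τ)` by graded submodules. -/
def compMult (k : ℤ) : ℕ∞ :=
  ⨆ (p : ℕ) (F : Fin (p + 1) → Submodule (RCA D) (Verma D τ))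
    (_ : Monotone F ∧ F 0 = ⊥ ∧ F (Fin.last p) = ⊤ ∧ ∀ i, IsGraded D τ (F i)),
    {i : Fin p | IsShiftedSimple D τ σ k (F i.castSucc) (F i.succ)}.encard

end Standard

end

end Cherednik

end

/-! Write the Dirac operator as $D=2d-\partial$ with $d=\sum_j y_j\otimes(x_j\wedge\cdot)$ (de Rham
part) and $\partial=\sum_j x_j\otimes\partial_{y_j}$ (Koszul part). Both square to zero, so
$D^2=-2(d\partial+\partial d)$, and the anticommutator is
$\mathrm{eu}\otimes1+t\,(1\otimes\deg)-\Omega$ (`koszulOp_deRhamOp_add`). Here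
$\Omega=\sum_s\frac{2c(s)}{l_s-1}\,s$, with $l_s$ the nontrivial eigenvalue of $s$ on $V^*$, is
central in $\mathbb C[G]$ and acts diagonally, and $\mathrm{eu}=\sum_jx_jy_j+\Omega$ satisfies
$[\mathrm{eu},x]=tx$. On $L(\tau)$ the Euler operator acts in degree $m$ by $tm+r$, where $r$ is the
scalar by which $\Omega$ acts on $\tau$. Hence $D^2=2(\Omega-(tn+r))$ in total degree $n$.

Index formula. A central element of $\mathbb C[G]$ acts semisimply, so $D^2$ is semisimple on the
finite-dimensional pieces of $X\otimes S^*$, and the Euler-Poincaré principle (`euler_poincare`)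
gives $I_D(X)=X\otimes S^{*,+}-X\otimes S^{*,-}$ degree by degree. Since
$\det_{V^*}(1-gq)=\sum_l(-1)^lq^l\,\mathrm{tr}(g,\bigwedge^lV^*)$, this is the character formula
multiplied by the determinant (`EulerGraded.indexCharCoeff_eq`, `EulerGraded.character_formula`).

Finiteness. A kernel vector of total degree $n$ is an $\Omega$-eigenvector for $tn+r$, and $\Omega$
has finitely many eigenvalues in all representations together. If $t\ne0$ this bounds $n$. If $t=0$,
invariant polynomials act on $M(\tau)$ by $\mathsf H$-endomorphisms, so those of positive degree
kill $L(\tau)$; as $\mathbb C[V]$ is integral over the invariants, $L(\tau)$ vanishes in large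
degrees.

Inverse matrices. Dunkl operators turn $\mathbb C[V]\otimes\tau$ into a model of $M(\tau)$
(`modelEquiv`). The $G$-character of this model does not involve $t$ and $c$, so the index formula
for $t=1$, $c=0$, where $D^2=-2n$ in total degree $n$, yields the Koszul identity
$\mathrm{ch}\,M(\tau)\cdot\det_{V^*}(1-gq)=\chi_\tau$. Let $P$ and $S$ be the matrices of graded
$G$-multiplicities in the $M(\tau)$ and the $L(\tau)$, and let $E$ be that of the virtual modules
$\tau\otimes(S^{*,+}-S^{*,-})$. Then $PE=1$ by Koszul and $d=SE$ by the index formula. $S$ is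
invertible because its constant term is the identity, and $n=PS^{-1}$ satisfies $nd=PE=1$.

It remains to see that the coefficients of $PS^{-1}$ are the composition multiplicities
(`compMult_eq`). The functional `compCoeff` is monotone on graded submodules and grows by exactly
one across a subquotient of the counted type, which bounds every filtration; filtrations refined up
to a given degree attain the bound. For $t\ne0$, comparing Euler eigenvalues leaves at most one
possible shift, whence polynomiality. -/

noncomputable section

namespace Cherednik

/-! ### Traces on invariant subspaces and the Euler-Poincaré principle. -/

section Trace

variable {A B C : Type*} [AddCommGroup A] [Module ℂ A] [AddCommGroup B] [Module ℂ B]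
  [AddCommGroup C] [Module ℂ C]

/-- The trace is additive on short exact sequences. -/
theorem trace_of_exact [FiniteDimensional ℂ A] (f : Module.End ℂ A) (k : Module.End ℂ B)
    (h : Module.End ℂ C) (i : B →ₗ[ℂ] A) (T : A →ₗ[ℂ] C) (hi : Function.Injective i)
    (hT : Function.Surjective T) (hex : ∀ a, T a = 0 ↔ ∃ b, i b = a)
    (hfi : ∀ b, f (i b) = i (k b)) (hfT : ∀ a, T (f a) = h (T a)) :
    LinearMap.trace ℂ A f = LinearMap.trace ℂ B k + LinearMap.trace ℂ C h := by
  have : FiniteDimensional ℂ B := FiniteDimensional.of_injective i hi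
  have : FiniteDimensional ℂ C := Module.Finite.of_surjective T hT
  obtain ⟨s, hs⟩ := T.exists_rightInverse_of_surjective (LinearMap.range_eq_top.2 hT)
  have hs' : ∀ c, T (s c) = c := fun c => LinearMap.congr_fun hs c
  -- The projection onto `B` along the splitting `s`, so that $i\pi=1-sT$. It gives
  -- $f=i(k\pi)+(fs)T$, and cyclicity of the trace turns the two summands into $\mathrm{tr}\,k$ and
  -- $\mathrm{tr}\,h$.
  let π : A →ₗ[ℂ] B := (LinearEquiv.ofInjective i hi).symm.toLinearMap ∘ₗ
    LinearMap.codRestrict (LinearMap.range i) (LinearMap.id - s ∘ₗ T) (fun a => by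
      obtain ⟨b, hb⟩ := (hex (a - s (T a))).1 (by rw [map_sub, hs', sub_self])
      exact ⟨b, by simpa using hb⟩)
  have hπ : ∀ a, i (π a) = a - s (T a) := by
    intro a
    have := LinearEquiv.apply_symm_apply (LinearEquiv.ofInjective i hi)
      (LinearMap.codRestrict (LinearMap.range i) (LinearMap.id - s ∘ₗ T) (fun a => by
      obtain ⟨b, hb⟩ := (hex (a - s (T a))).1 (by rw [map_sub, hs', sub_self])
      exact ⟨b, by simpa using hb⟩) a)
    have h2 := congrArg Subtype.val this
    simp [π]
  have hTi : ∀ b, T (i b) = 0 := fun b => (hex _).2 ⟨b, rfl⟩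
  have hπi : π ∘ₗ i = LinearMap.id := by
    ext b
    apply hi
    simp [hπ, hTi]
  have h1 : f = i ∘ₗ (k ∘ₗ π) + (f ∘ₗ s) ∘ₗ T := by
    ext a
    simp only [LinearMap.add_apply, LinearMap.comp_apply, ← hfi, hπ, map_sub]
    abel
  have h2 : T ∘ₗ (f ∘ₗ s) = h := by
    ext c
    simp [hfT, hs']
  rw [h1, map_add, LinearMap.trace_comp_comm', LinearMap.comp_assoc, hπi, LinearMap.comp_id,
    LinearMap.trace_comp_comm', h2]

/-- The trace of `f` on a stable subspace `U` (and zero if `U` is not stable). -/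
def tr (f : Module.End ℂ A) (U : Submodule ℂ A) : ℂ :=
  open Classical in
  if h : U ≤ U.comap f then LinearMap.trace ℂ U (f.restrict h) else 0

theorem tr_eq {f : Module.End ℂ A} {U : Submodule ℂ A} (h : U ≤ U.comap f) :
    tr f U = LinearMap.trace ℂ U (f.restrict h) := dif_pos h

theorem tr_bot (f : Module.End ℂ A) : tr f ⊥ = 0 := by
  rw [tr_eq (by simp)]
  have : (f.restrict (p := ⊥) (q := ⊥) (by simp)) = 0 := Subsingleton.elim _ _
  rw [this, map_zero]

/-- Rank-nullity for traces: additivity on $0\to U\cap\ker T\to U\to T(U)\to0$. -/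
theorem tr_map_add {f : Module.End ℂ A} {f' : Module.End ℂ B} {U : Submodule ℂ A}
    [FiniteDimensional ℂ U] (h : U ≤ U.comap f) (T : A →ₗ[ℂ] B) (hT : ∀ z, T (f z) = f' (T z)) :
    tr f U = tr f (U ⊓ LinearMap.ker T) + tr f' (U.map T) := by
  have h1 : U ⊓ LinearMap.ker T ≤ (U ⊓ LinearMap.ker T).comap f := by
    rintro z ⟨hz, hz'⟩
    refine ⟨h hz, ?_⟩
    have : T z = 0 := hz'
    simp [hT, this]
  have h2 : U.map T ≤ (U.map T).comap f' := by
    rintro _ ⟨z, hz, rfl⟩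
    exact ⟨f z, h hz, hT z⟩
  rw [tr_eq h, tr_eq h1, tr_eq h2]
  refine trace_of_exact _ _ _ (Submodule.inclusion inf_le_left)
    (LinearMap.restrict T (p := U) (q := U.map T) fun z hz => ⟨z, hz, rfl⟩)
    (Submodule.inclusion_injective _) ?_ ?_ ?_ ?_
  · rintro ⟨_, z, hz, rfl⟩
    exact ⟨⟨z, hz⟩, rfl⟩
  · rintro ⟨z, hz⟩
    constructor
    · intro h0
      exact ⟨⟨z, hz, congrArg Subtype.val h0⟩, rfl⟩
    · rintro ⟨⟨b, hb, hb'⟩, hbz⟩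
      obtain rfl : b = z := congrArg Subtype.val hbz
      exact Subtype.ext hb'
  · rintro ⟨b, hb⟩; rfl
  · rintro ⟨b, hb⟩; exact Subtype.ext (hT b)

theorem tr_map_injOn {f : Module.End ℂ A} {f' : Module.End ℂ B} {U : Submodule ℂ A}
    [FiniteDimensional ℂ U] (h : U ≤ U.comap f) (T : A →ₗ[ℂ] B) (hT : ∀ z, T (f z) = f' (T z))
    (hinj : ∀ z ∈ U, T z = 0 → z = 0) :
    tr f U = tr f' (U.map T) := by
  rw [tr_map_add h T hT]
  have : U ⊓ LinearMap.ker T = ⊥ := by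
    rw [eq_bot_iff]
    rintro z ⟨hz, hz'⟩
    exact hinj z hz hz'
  rw [this, tr_bot, zero_add]

theorem le_comap_map {f T : Module.End ℂ A} {U : Submodule ℂ A} (h : U ≤ U.comap f)
    (hT : ∀ z, T (f z) = f (T z)) : U.map T ≤ (U.map T).comap f := by
  rintro _ ⟨z, hz, rfl⟩
  exact ⟨f z, h hz, hT z⟩

/-- The Euler-Poincaré principle for an odd operator whose square is semisimple. -/
theorem euler_poincare {f T : Module.End ℂ A} {E₀ E₁ : Submodule ℂ A} [FiniteDimensional ℂ E₀]
    [FiniteDimensional ℂ E₁] (h₀ : E₀ ≤ E₀.comap f) (h₁ : E₁ ≤ E₁.comap f)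
    (hT : ∀ z, T (f z) = f (T z)) (hT₀ : E₀.map T ≤ E₁) (hT₁ : E₁.map T ≤ E₀)
    (hs₀ : ∀ z ∈ E₀, T (T (T (T z))) = 0 → T (T z) = 0)
    (hs₁ : ∀ z ∈ E₁, T (T (T (T z))) = 0 → T (T z) = 0) :
    tr f E₀ - tr f E₁ = (tr f (E₀ ⊓ LinearMap.ker T) - tr f (E₀ ⊓ LinearMap.ker T ⊓ E₁.map T)) -
      (tr f (E₁ ⊓ LinearMap.ker T) - tr f (E₁ ⊓ LinearMap.ker T ⊓ E₀.map T)) := by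
  have a₀ := tr_map_add h₀ T hT
  have a₁ := tr_map_add h₁ T hT
  have b₀ := tr_map_add (le_comap_map h₀ hT) T hT
  have b₁ := tr_map_add (le_comap_map h₁ hT) T hT
  have i₀ : E₀ ⊓ LinearMap.ker T ⊓ E₁.map T = E₁.map T ⊓ LinearMap.ker T := by
    rw [inf_comm, ← inf_assoc, inf_eq_left.2 hT₁]
  have i₁ : E₁ ⊓ LinearMap.ker T ⊓ E₀.map T = E₀.map T ⊓ LinearMap.ker T := by
    rw [inf_comm, ← inf_assoc, inf_eq_left.2 hT₀]
  have j₀ : ∀ z ∈ (E₀.map T).map T, T z = 0 → z = 0 := by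
    rintro _ ⟨_, ⟨z, hz, rfl⟩, rfl⟩ h0
    exact hs₀ z hz (by rw [h0, map_zero])
  have j₁ : ∀ z ∈ (E₁.map T).map T, T z = 0 → z = 0 := by
    rintro _ ⟨_, ⟨z, hz, rfl⟩, rfl⟩ h0
    exact hs₁ z hz (by rw [h0, map_zero])
  have k₀ : ((E₀.map T).map T).map T ≤ (E₁.map T).map T :=
    Submodule.map_mono (Submodule.map_mono hT₀)
  have k₁ : ((E₁.map T).map T).map T ≤ (E₀.map T).map T :=
    Submodule.map_mono (Submodule.map_mono hT₁)
  have r : ∀ U : Submodule ℂ A, FiniteDimensional ℂ U → (∀ z ∈ U, T z = 0 → z = 0) →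
      Module.finrank ℂ (U.map T) = Module.finrank ℂ U := by
    intro U _ hU
    refine (LinearEquiv.finrank_eq (LinearEquiv.ofBijective
      (LinearMap.restrict T (p := U) (q := U.map T) fun z hz => ⟨z, hz, rfl⟩) ⟨?_, ?_⟩)).symm
    · rw [← LinearMap.ker_eq_bot, LinearMap.ker_eq_bot']
      rintro ⟨z, hz⟩ h0
      exact Subtype.ext (hU z hz (congrArg Subtype.val h0))
    · rintro ⟨_, z, hz, rfl⟩
      exact ⟨⟨z, hz⟩, rfl⟩
  -- By semisimplicity $T$ is injective on $T^2E_0$ and on $T^2E_1$. Hence $\dim T^2E_1=\dim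
  -- T^3E_1\le\dim T^2E_0=\dim T^3E_0$, which makes the inclusion `k₀` an equality. So $T$
  -- identifies $T^2E_0$ with $T^2E_1$ equivariantly and their traces cancel.
  have e : ((E₀.map T).map T).map T = (E₁.map T).map T := by
    refine Submodule.eq_of_le_of_finrank_le k₀ ?_
    rw [r _ inferInstance j₀, ← r _ inferInstance j₁]
    exact Submodule.finrank_mono k₁
  have c₀ := tr_map_injOn (le_comap_map (le_comap_map h₀ hT) hT) T hT j₀
  rw [e] at c₀
  rw [i₀, i₁, a₀, a₁, b₀, b₁, c₀]
  ring

end Trace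

/-! ### Characters, multiplicities and central elements of the group algebra. -/

section Rep

variable {G : Type u} [Group G]

theorem subrep_character {E : Type*} [AddCommGroup E] [Module ℂ E] (ρ : Representation ℂ G E)
    (U : Submodule ℂ E) (hU : ∀ g, U ≤ U.comap (ρ g)) (g : G) :
    (ρ.subrepresentation U hU).character g = tr (ρ g) U := by
  rw [tr_eq (hU g)]
  rfl

theorem isIrreducible_of {E : Type*} [AddCommGroup E] [Module ℂ E] [Nontrivial E]
    (ρ : Representation ℂ G E)
    (h : ∀ U : Submodule ℂ E, (∀ g, U ≤ U.comap (ρ g)) → U = ⊥ ∨ U = ⊤) : ρ.IsIrreducible := by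
  have : Nontrivial (Subrepresentation ρ) := by
    refine ⟨⊥, ⊤, fun h0 => ?_⟩
    have h1 : (⊥ : Submodule ℂ E) = ⊤ := congrArg Subrepresentation.toSubmodule h0
    exact bot_ne_top h1
  refine { eq_bot_or_eq_top := fun S => ?_ }
  rcases h S.toSubmodule (fun g v hv => S.apply_mem_toSubmodule g hv) with h1 | h1
  · left; exact Subrepresentation.toSubmodule_injective h1
  · right; exact Subrepresentation.toSubmodule_injective h1

theorem IsIrreducible.eq_bot_or_eq_top {E : Type*} [AddCommGroup E] [Module ℂ E]
    {ρ : Representation ℂ G E} (h : ρ.IsIrreducible) (U : Submodule ℂ E)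
    (hU : ∀ g, U ≤ U.comap (ρ g)) : U = ⊥ ∨ U = ⊤ := by
  rcases h.eq_bot_or_eq_top ⟨U, fun g v hv => hU g hv⟩ with h1 | h1
  · left; exact congrArg Subrepresentation.toSubmodule h1
  · right; exact congrArg Subrepresentation.toSubmodule h1

theorem IsIrreducible.nontrivial {E : Type*} [AddCommGroup E] [Module ℂ E]
    {ρ : Representation ℂ G E} (h : ρ.IsIrreducible) : Nontrivial E := by
  by_contra hn
  rw [not_nontrivial_iff_subsingleton] at hn
  have := h.toNontrivial
  obtain ⟨a, b, hab⟩ := this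
  exact hab (Subrepresentation.toSubmodule_injective (Subsingleton.elim _ _))

variable {ι : Type v} {W : ι → Type w} [∀ i, AddCommGroup (W i)] [∀ i, Module ℂ (W i)]
  (τ : ∀ i, Representation ℂ G (W i))

/-- Every irreducible representation of `G` is isomorphic to a member of the family `τ`. -/
def IsExhaustive : Prop :=
  ∀ (n : ℕ) (π : Representation ℂ G (Fin n → ℂ)), π.IsIrreducible →
      ∃ i, Nonempty (π.Equiv (τ i))

variable {τ}

theorem IsExhaustive.exists_sub (hall : IsExhaustive τ) {E : Type*} [AddCommGroup E] [Module ℂ E]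
    (ρ : Representation ℂ G E) (U : Submodule ℂ E) [FiniteDimensional ℂ U] (hU0 : U ≠ ⊥)
    (hU : ∀ g, U ≤ U.comap (ρ g)) :
    ∃ i, ∃ u : W i →ₗ[ℂ] E, Function.Injective u ∧ (∀ g x, u (τ i g x) = ρ g (u x)) ∧
      LinearMap.range u ≤ U := by
  induction hn : Module.finrank ℂ U using Nat.strong_induction_on generalizing U with
  | _ n ih =>
  by_cases hmin : ∃ U' : Submodule ℂ E, U' < U ∧ U' ≠ ⊥ ∧ ∀ g, U' ≤ U'.comap (ρ g)
  · obtain ⟨U', hlt, h0, hst⟩ := hmin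
    have : FiniteDimensional ℂ U' := Submodule.finiteDimensional_of_le hlt.le
    obtain ⟨i, u, h1, h2, h3⟩ := ih _ (hn ▸ Submodule.finrank_lt_finrank_of_lt hlt) U' h0 hst rfl
    exact ⟨i, u, h1, h2, h3.trans hlt.le⟩
  · push Not at hmin
    -- Now `U` is a minimal nonzero stable subspace, hence irreducible. Exhaustiveness is only
    -- tested on the spaces $\mathbb C^n$, so the action is moved to coordinates.
    let e : U ≃ₗ[ℂ] (Fin (Module.finrank ℂ U) → ℂ) := (Module.finBasis ℂ U).equivFun
    let κ := ρ.subrepresentation U hU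
    let π : Representation ℂ G (Fin (Module.finrank ℂ U) → ℂ) :=
      { toFun := fun g => e.conj (κ g)
        map_one' := by rw [map_one]; exact LinearEquiv.conj_id e
        map_mul' := fun a b => by rw [map_mul]; exact LinearEquiv.conj_comp e _ _ }
    have hπ : ∀ g x, e.symm (π g x) = κ g (e.symm x) := fun g x => by
      simp [π, LinearEquiv.conj_apply]
    have : Nontrivial U := Submodule.nontrivial_iff_ne_bot.2 hU0
    have : Nontrivial (Fin (Module.finrank ℂ U) → ℂ) := e.symm.toEquiv.nontrivial
    have hirr : π.IsIrreducible := by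
      refine isIrreducible_of π fun Q hQ => ?_
      let Q' : Submodule ℂ E := Q.map (U.subtype ∘ₗ e.symm.toLinearMap)
      have hQ'U : Q' ≤ U := by
        rintro _ ⟨x, hx, rfl⟩
        exact (e.symm x).2
      by_cases h : Q' = ⊥
      · left
        rw [eq_bot_iff]
        intro x hx
        have h1 : ((e.symm x : U) : E) ∈ Q' := ⟨x, hx, rfl⟩
        rw [h, Submodule.mem_bot] at h1
        have h2 : e.symm x = 0 := Subtype.ext h1
        simpa using h2
      · right
        have hst : ∀ g, Q' ≤ Q'.comap (ρ g) := by
          rintro g _ ⟨x, hx, rfl⟩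
          refine ⟨π g x, hQ g hx, ?_⟩
          change ((e.symm (π g x) : U) : E) = _
          rw [hπ]
          rfl
        have : Q' = U := by
          by_contra hne
          obtain ⟨g, hg⟩ := hmin Q' (lt_of_le_of_ne hQ'U hne) h
          exact hg (hst g)
        rw [eq_top_iff]
        intro x _
        have h1 : ((e.symm x : U) : E) ∈ Q' := by rw [this]; exact (e.symm x).2
        obtain ⟨y, hy, hxy⟩ := h1
        have h2 : e.symm y = e.symm x := Subtype.ext hxy
        rw [← e.symm.injective h2]
        exact hy
    obtain ⟨i, ⟨φ⟩⟩ := hall _ π hirr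
    have hφ : ∀ g x, φ.symm (τ i g x) = π g (φ.symm x) := fun g x =>
      LinearMap.congr_fun (φ.symm.toIntertwiningMap.isIntertwining' g) x
    refine ⟨i, U.subtype ∘ₗ e.symm.toLinearMap ∘ₗ φ.symm.toLinearMap, ?_, ?_, ?_⟩
    · refine Subtype.val_injective.comp (e.symm.injective.comp ?_)
      exact φ.symm.toLinearEquiv.injective
    · intro g x
      change ((e.symm (φ.symm (τ i g x)) : U) : E) = ρ g ((e.symm (φ.symm x) : U) : E)
      rw [hφ, hπ]
      rfl
    · rintro _ ⟨x, rfl⟩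
      exact (e.symm _).2

variable [Finite G]

/-- The multiplicity of `σ` in a representation with character `χ`. -/
def pairing {X : Type*} [AddCommGroup X] [Module ℂ X] (σ : Representation ℂ G X) :
    (G → ℂ) →ₗ[ℂ] ℂ where
  toFun χ := open Classical in
    letI := Fintype.ofFinite G
    (Nat.card G : ℂ)⁻¹ * ∑ g : G, χ g * σ.character g⁻¹
  map_add' a b := by simp only [Pi.add_apply, add_mul, Finset.sum_add_distrib, mul_add]
  map_smul' r a := by
    simp only [Pi.smul_apply, smul_eq_mul, RingHom.id_apply, Finset.mul_sum]
    exact Finset.sum_congr rfl fun g _ => by ring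

theorem pairing_character {X E : Type*} [AddCommGroup X] [Module ℂ X] [FiniteDimensional ℂ X]
    [AddCommGroup E] [Module ℂ E] [FiniteDimensional ℂ E] (σ : Representation ℂ G X)
    (ρ : Representation ℂ G E) :
    pairing σ ρ.character = (Module.finrank ℂ (Representation.IntertwiningMap σ ρ) : ℂ) := by
  let _ := Fintype.ofFinite G
  have : (Nat.card G : ℂ) ≠ 0 := by exact_mod_cast Nat.card_pos.ne'
  let _ := invertibleOfNonzero this
  rw [← Representation.card_inv_mul_sum_char_mul_char_eq_finrank]
  rfl

theorem RepGrading.mult_eq_pairing {X E : Type*} [AddCommGroup X] [Module ℂ X]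
    [FiniteDimensional ℂ X] [AddCommGroup E] [Module ℂ E] {ρ : Representation ℂ G E}
    (σ : Representation ℂ G X) (𝓔 : RepGrading ρ) (n : ℤ) [FiniteDimensional ℂ (𝓔.part n)] :
    (𝓔.mult σ n : ℂ) = pairing σ (fun g => tr (ρ g) (𝓔.part n)) := by
  rw [RepGrading.mult, ← pairing_character]
  congr 1
  ext g
  exact subrep_character ρ _ _ g

theorem pairing_irreducible [DecidableEq ι] [∀ i, FiniteDimensional ℂ (W i)]
    (hirr : ∀ i, (τ i).IsIrreducible)
    (hdistinct : ∀ i j, Nonempty ((τ i).Equiv (τ j)) → i = j) (i j : ι) :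
    pairing (τ i) (τ j).character = if i = j then 1 else 0 := by
  let _ := Fintype.ofFinite G
  have : (Nat.card G : ℂ) ≠ 0 := by exact_mod_cast Nat.card_pos.ne'
  let _ := invertibleOfNonzero this
  have := hirr i
  have := hirr j
  have h := Representation.char_orthonormal (τ j) (τ i)
  classical
  have h' : pairing (τ i) (τ j).character = if Nonempty ((τ i).Equiv (τ j)) then 1 else 0 := by
    rw [← h]
    rfl
  rw [h']
  by_cases hij : i = j
  · subst hij
    rw [if_pos ⟨Representation.Equiv.refl (τ i)⟩, if_pos rfl]
  · rw [if_neg (fun h => hij (hdistinct i j h)), if_neg hij]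

/-- No complement has to be chosen: an irreducible subrepresentation is split off, the character is
additive on the quotient sequence, and the quotient has smaller dimension. -/
theorem character_eq_sum [Fintype ι] [∀ i, FiniteDimensional ℂ (W i)]
    (hirr : ∀ i, (τ i).IsIrreducible)
    (hdistinct : ∀ i j, Nonempty ((τ i).Equiv (τ j)) → i = j) (hall : IsExhaustive τ)
    {E : Type*} [AddCommGroup E] [Module ℂ E] [FiniteDimensional ℂ E] (ρ : Representation ℂ G E) :
    ρ.character = ∑ i, pairing (τ i) ρ.character • (τ i).character := by
  classical
  induction hn : Module.finrank ℂ E using Nat.strong_induction_on generalizing E with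
  | _ n ih =>
  rcases subsingleton_or_nontrivial E with hE | hE
  · have : ρ.character = 0 := by
      ext g
      rw [Representation.character, Subsingleton.elim (ρ g) 0, map_zero]
      rfl
    simp [this]
  · obtain ⟨i, u, h1, h2, -⟩ := hall.exists_sub ρ ⊤ top_ne_bot (fun g => by simp)
    have hst : ∀ g, LinearMap.range u ≤ (LinearMap.range u).comap (ρ g) := by
      rintro g _ ⟨x, rfl⟩
      exact ⟨τ i g x, h2 g x⟩
    have key : ρ.character = (τ i).character + (ρ.quotient (LinearMap.range u) hst).character := by
      ext g
      refine trace_of_exact _ _ _ u (LinearMap.range u).mkQ h1 (Submodule.mkQ_surjective _) ?_ ?_ ?_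
      · intro a
        rw [Submodule.mkQ_apply, Submodule.Quotient.mk_eq_zero]
        rfl
      · intro b; exact (h2 g b).symm
      · intro a; rfl
    have := IsIrreducible.nontrivial (hirr i)
    have hlt : Module.finrank ℂ (E ⧸ LinearMap.range u) < n := by
      have h3 := Submodule.finrank_quotient_add_finrank (LinearMap.range u)
      have h4 : 0 < Module.finrank ℂ (W i) := Module.finrank_pos
      rw [LinearMap.finrank_range_of_inj h1] at h3
      omega
    have h5 := ih _ hlt (ρ.quotient (LinearMap.range u) hst) rfl
    rw [key]
    simp only [map_add, add_smul, Finset.sum_add_distrib]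
    rw [← h5]
    congr 1
    simp [pairing_irreducible hirr hdistinct]

/-- The action of a class function on a representation. -/
def classOp {E : Type*} [AddCommGroup E] [Module ℂ E] (ρ : Representation ℂ G E) (e : G → ℂ) :
    Module.End ℂ E :=
  letI := Fintype.ofFinite G
  ∑ g, e g • ρ g

/-- The element of the group algebra defined by a function on the group. -/
def classElt (e : G → ℂ) : MonoidAlgebra ℂ G :=
  letI := Fintype.ofFinite G
  ∑ g, e g • MonoidAlgebra.of ℂ G g

theorem asAlgebraHom_classElt {E : Type*} [AddCommGroup E] [Module ℂ E]
    (ρ : Representation ℂ G E) (e : G → ℂ) : ρ.asAlgebraHom (classElt e) = classOp ρ e := by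
  simp [classElt, classOp, map_sum]

theorem classElt_comm {e : G → ℂ} (he : ∀ g h, e (h * g * h⁻¹) = e g) (a : MonoidAlgebra ℂ G) :
    classElt e * a = a * classElt e := by
  let _ := Fintype.ofFinite G
  induction a using MonoidAlgebra.induction_linear with
  | zero => simp
  | add x y hx hy => rw [mul_add, add_mul, hx, hy]
  | single h r =>
    have hr : MonoidAlgebra.single h r = r • MonoidAlgebra.of ℂ G h := by simp
    rw [hr, mul_smul_comm, smul_mul_assoc]
    congr 1
    simp only [classElt, Finset.sum_mul, Finset.mul_sum, smul_mul_assoc, mul_smul_comm, ← map_mul]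
    rw [← (MulAut.conj h).toEquiv.sum_comp]
    refine Finset.sum_congr rfl fun g _ => ?_
    simp [he]

theorem classOp_comm {E : Type*} [AddCommGroup E] [Module ℂ E] (ρ : Representation ℂ G E)
    {e : G → ℂ} (he : ∀ g h, e (h * g * h⁻¹) = e g) (g : G) (z : E) :
    classOp ρ e (ρ g z) = ρ g (classOp ρ e z) := by
  have h := congrArg (ρ.asAlgebraHom) (classElt_comm he (MonoidAlgebra.of ℂ G g))
  rw [map_mul, map_mul, asAlgebraHom_classElt, Representation.asAlgebraHom_of] at h
  exact LinearMap.congr_fun h z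

/-- A central element of the group algebra acts semisimply. -/
theorem classOp_sub_sq {E : Type*} [AddCommGroup E] [Module ℂ E] (ρ : Representation ℂ G E)
    {e : G → ℂ} (he : ∀ g h, e (h * g * h⁻¹) = e g) (μ : ℂ) (z : E)
    (hz : (classOp ρ e - algebraMap ℂ _ μ) ((classOp ρ e - algebraMap ℂ _ μ) z) = 0) :
    (classOp ρ e - algebraMap ℂ _ μ) z = 0 := by
  have hne : NeZero (Nat.card G : ℂ) := ⟨by exact_mod_cast Nat.card_pos.ne'⟩
  set a : MonoidAlgebra ℂ G := classElt e - algebraMap ℂ _ μ with ha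
  have hρ : ρ.asAlgebraHom a = classOp ρ e - algebraMap ℂ _ μ := by
    rw [ha, map_sub, asAlgebraHom_classElt, AlgHom.commutes]
  have hcomm : ∀ b, a * b = b * a := by
    intro b
    rw [ha, sub_mul, mul_sub, classElt_comm he, Algebra.commutes]
  -- By Maschke the ideal generated by `a` is generated by an idempotent $p=ba$. Since $a$ is
  -- central, $a=ap=pa=ba^2$, so $a^2z=0$ forces $az=0$.
  obtain ⟨p, hp, hpa⟩ := IsSemisimpleRing.ideal_eq_span_idempotent (Ideal.span {a})
  obtain ⟨b, hb⟩ := Ideal.mem_span_singleton'.1 (hpa ▸ Ideal.mem_span_singleton_self p)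
  obtain ⟨c, hc⟩ := Ideal.mem_span_singleton'.1 (hpa ▸ Ideal.mem_span_singleton_self a)
  have h1 : a = b * (a * a) := by
    have h2 : a * p = a := by rw [← hc, mul_assoc, hp.eq]
    calc a = a * p := h2.symm
      _ = p * a := hcomm p
      _ = b * (a * a) := by rw [← hb, mul_assoc]
  have h3 := congrArg (fun x => ρ.asAlgebraHom x z) h1
  simp only [map_mul, hρ] at h3
  rw [h3]
  simp only [Module.End.mul_apply, hz, map_zero]

/-- The eigenvalues of a central element of the group algebra on representations lie in a fixed
finite set. -/
theorem exists_finite_classOp_eigenvalues (e : G → ℂ) :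
    ∃ S : Set ℂ, S.Finite ∧ ∀ {E : Type w} [AddCommGroup E] [Module ℂ E]
      (ρ : Representation ℂ G E) (μ : ℂ) (z : E), classOp ρ e z = μ • z → z ≠ 0 → μ ∈ S := by
  -- One monic polynomial annihilates the element in the finite-dimensional algebra $\mathbb C[G]$,
  -- hence in every representation, of any dimension; its roots form `S`.
  have hint : IsIntegral ℂ (classElt e) := by
    have : Module.Finite ℂ (MonoidAlgebra ℂ G) := inferInstance
    exact Algebra.IsIntegral.isIntegral _
  obtain ⟨p, hp, hp0⟩ := hint
  refine ⟨{μ | p.IsRoot μ}, Polynomial.finite_setOfPred_isRoot hp.ne_zero, ?_⟩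
  intro E _ _ ρ μ z hz hz0
  have h1 : Polynomial.aeval (classOp ρ e) p = 0 := by
    rw [← asAlgebraHom_classElt, Polynomial.aeval_algHom_apply, Polynomial.aeval_def, hp0, map_zero]
  have h2 := Module.End.aeval_apply_of_hasEigenvector (f := classOp ρ e) (p := p) (μ := μ) (x := z)
    ⟨Module.End.mem_eigenspace_iff.2 hz, hz0⟩
  rw [h1, LinearMap.zero_apply] at h2
  exact (smul_eq_zero.1 h2.symm).resolve_right hz0

end Rep

/-! ### Explicit formulas for reflections and their conjugates. -/

section Reflections

variable {V : Type u} [AddCommGroup V] [Module ℂ V] [FiniteDimensional ℂ V] (D : Datum V)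

/-- `l - 1`, where `l` is the nontrivial eigenvalue of the reflection `s` on `V^*`. -/
def nu (s : Refl D) : ℂ := LinearMap.trace ℂ _ (dualRep D s.1 - 1)

/-- `l⁻¹ - 1`, where `l⁻¹` is the nontrivial eigenvalue of the reflection `s` on `V`. -/
def mu (s : Refl D) : ℂ := LinearMap.trace ℂ _ (stdRep D.G s.1 - 1)

/-- The eigenvalue $l$ of $\alpha_s$ on $V^*$ determines everything: invariance of the pairing gives
$\alpha_s(sy)=l^{-1}\alpha_s(y)$, and $s-1$ has rank one with image spanned by $\alpha_s^\vee$. The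
factors $1/2$ come from $\alpha_s(\alpha_s^\vee)=2$. -/
theorem reflection_aux (s : Refl D) : ∃ l : ℂ, l ≠ 0 ∧ l ≠ 1 ∧
    (∀ y, stdRep D.G s.1 y = y + ((l⁻¹ - 1) / 2 * D.α s y) • D.αv s) ∧
    ∀ f, dualRep D s.1 f = f + ((l - 1) / 2 * f (D.αv s)) • D.α s := by
  obtain ⟨l, hl1, hl⟩ := D.α_eigen s
  obtain ⟨l', hl'1, hl'⟩ := D.αv_eigen s
  have hpair := D.pairing s
  have hα : ∀ y, D.α s y = l * D.α s (stdRep D.G s.1 y) := by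
    intro y
    have h := LinearMap.congr_fun hl (stdRep D.G s.1 y)
    change D.α s (stdRep D.G s.1⁻¹ (stdRep D.G s.1 y)) = _ at h
    rw [Representation.inv_self_apply] at h
    exact h
  have hl0 : l ≠ 0 := by
    rintro rfl
    have := hα (D.αv s)
    rw [hpair, zero_mul] at this
    norm_num at this
  have hα' : ∀ y, D.α s (stdRep D.G s.1 y) = l⁻¹ * D.α s y := by
    intro y
    rw [hα y, ← mul_assoc, inv_mul_cancel₀ hl0, one_mul]
  have hαv0 : D.αv s ≠ 0 := by
    intro h
    rw [h, map_zero] at hpair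
    norm_num at hpair
  set R := LinearMap.range ((s.1 : V ≃ₗ[ℂ] V).toLinearMap - LinearMap.id) with hR
  have hrank : Module.finrank ℂ R = 1 := s.2
  have hmem : D.αv s ∈ R := by
    refine ⟨(l' - 1)⁻¹ • D.αv s, ?_⟩
    change stdRep D.G s.1 ((l' - 1)⁻¹ • D.αv s) - (l' - 1)⁻¹ • D.αv s = _
    have h : l' - 1 ≠ 0 := sub_ne_zero.2 hl'1
    rw [map_smul, hl', ← smul_sub]
    have h2 : l' • D.αv s - D.αv s = (l' - 1) • D.αv s := by module
    rw [h2, smul_smul, inv_mul_cancel₀ h, one_smul]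
  have hspan := finrank_eq_one_iff_of_nonzero' (⟨D.αv s, hmem⟩ : R)
    (fun h => hαv0 (congrArg Subtype.val h)) |>.1 hrank
  have hy : ∀ y, stdRep D.G s.1 y = y + ((l⁻¹ - 1) / 2 * D.α s y) • D.αv s := by
    intro y
    obtain ⟨a, ha⟩ := hspan ⟨stdRep D.G s.1 y - y, ⟨y, rfl⟩⟩
    have ha' : a • D.αv s = stdRep D.G s.1 y - y := congrArg Subtype.val ha
    have h2 := congrArg (D.α s) ha'
    rw [map_smul, map_sub, hα', hpair, smul_eq_mul] at h2
    have h3 : a = (l⁻¹ - 1) / 2 * D.α s y := by linear_combination h2 / 2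
    rw [← h3, ha']
    abel
  refine ⟨l, hl0, hl1, hy, fun f => ?_⟩
  have hinv : ∀ y, stdRep D.G s.1⁻¹ y = y + ((l - 1) / 2 * D.α s y) • D.αv s := by
    intro y
    have h1 : stdRep D.G s.1 (y + ((l - 1) / 2 * D.α s y) • D.αv s) = y := by
      rw [hy, map_add, map_smul, hpair, add_assoc, ← add_smul, smul_eq_mul]
      convert add_zero y
      rw [smul_eq_zero]
      left
      field_simp
      ring
    rw [← h1, Representation.inv_self_apply, h1]
  ext y
  change f (stdRep D.G s.1⁻¹ y) = _
  rw [hinv]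
  simp only [map_add, map_smul, LinearMap.add_apply, LinearMap.smul_apply, smul_eq_mul]
  ring

theorem reflection_eigen (s : Refl D) : ∃ l : ℂ, l ≠ 0 ∧ l ≠ 1 ∧ nu D s = l - 1 ∧ mu D s = l⁻¹ - 1 := by
  obtain ⟨l, h0, h1, hy, hf⟩ := reflection_aux D s
  refine ⟨l, h0, h1, ?_, ?_⟩
  · have : dualRep D s.1 - 1 =
        LinearMap.smulRight (((l - 1) / 2) • Module.Dual.eval ℂ V (D.αv s)) (D.α s) := by
      refine LinearMap.ext fun f => ?_
      rw [LinearMap.sub_apply, hf]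
      simp
    rw [nu, this, LinearMap.trace_smulRight]
    simp [D.pairing]
  · have : stdRep D.G s.1 - 1 =
        LinearMap.smulRight (((l⁻¹ - 1) / 2) • D.α s) (D.αv s) := by
      refine LinearMap.ext fun f => ?_
      rw [LinearMap.sub_apply, hy]
      simp
    rw [mu, this, LinearMap.trace_smulRight]
    simp [D.pairing]

theorem refl_y (s : Refl D) (y : V) :
    stdRep D.G s.1 y = y + (mu D s / 2 * D.α s y) • D.αv s := by
  obtain ⟨l, h0, h1, hy, hf⟩ := reflection_aux D s
  have : stdRep D.G s.1 - 1 = LinearMap.smulRight (((l⁻¹ - 1) / 2) • D.α s) (D.αv s) := by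
    refine LinearMap.ext fun f => ?_
    rw [LinearMap.sub_apply, hy]
    simp
  have h2 : mu D s = l⁻¹ - 1 := by
    rw [mu, this, LinearMap.trace_smulRight]
    simp [D.pairing]
  rw [hy, h2]

theorem refl_x (s : Refl D) (f : Module.Dual ℂ V) :
    dualRep D s.1 f = f + (nu D s / 2 * f (D.αv s)) • D.α s := by
  obtain ⟨l, h0, h1, hy, hf⟩ := reflection_aux D s
  have : dualRep D s.1 - 1 =
      LinearMap.smulRight (((l - 1) / 2) • Module.Dual.eval ℂ V (D.αv s)) (D.α s) := by
    refine LinearMap.ext fun f => ?_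
    rw [LinearMap.sub_apply, hf]
    simp
  have h2 : nu D s = l - 1 := by
    rw [nu, this, LinearMap.trace_smulRight]
    simp [D.pairing]
  rw [hf, h2]

theorem nu_ne_zero (s : Refl D) : nu D s ≠ 0 := by
  obtain ⟨l, h0, h1, h2, h3⟩ := reflection_eigen D s
  rw [h2]
  exact sub_ne_zero.2 h1

theorem mu_ne_zero (s : Refl D) : mu D s ≠ 0 := by
  obtain ⟨l, h0, h1, h2, h3⟩ := reflection_eigen D s
  rw [h3, sub_ne_zero]
  simpa using h1

/-- The conjugate of a reflection. -/
def conjRefl (g : D.G) (s : Refl D) : Refl D := ⟨g * s.1 * g⁻¹, by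
  have h : Module.finrank ℂ (LinearMap.range
    ((s.1 : V ≃ₗ[ℂ] V).toLinearMap - LinearMap.id)) = 1 := s.2
  refine Eq.trans ?_ h
  have : ((g * s.1 * g⁻¹ : D.G) : V ≃ₗ[ℂ] V).toLinearMap - LinearMap.id =
      (g : V ≃ₗ[ℂ] V).toLinearMap ∘ₗ ((s.1 : V ≃ₗ[ℂ] V).toLinearMap - LinearMap.id) ∘ₗ
        (g : V ≃ₗ[ℂ] V).symm.toLinearMap := by
    refine LinearMap.ext fun y => ?_
    change (g : V ≃ₗ[ℂ] V) ((s.1 : V ≃ₗ[ℂ] V) ((g : V ≃ₗ[ℂ] V).symm y)) - y =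
      (g : V ≃ₗ[ℂ] V) ((s.1 : V ≃ₗ[ℂ] V) ((g : V ≃ₗ[ℂ] V).symm y) - (g : V ≃ₗ[ℂ] V).symm y)
    rw [map_sub, LinearEquiv.apply_symm_apply]
  rw [this, LinearMap.range_comp, LinearEquiv.finrank_map_eq, LinearMap.range_comp_of_range_eq_top]
  exact LinearEquiv.range _⟩

/-- Conjugation as a permutation of the set of reflections. -/
def conjReflEquiv (g : D.G) : Equiv.Perm (Refl D) where
  toFun := conjRefl D g
  invFun := conjRefl D g⁻¹
  left_inv s := Subtype.ext (by simp [conjRefl]; group)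
  right_inv s := Subtype.ext (by simp [conjRefl]; group)

theorem c_conjRefl (g : D.G) (s : Refl D) : D.c (conjRefl D g s) = D.c s :=
  D.c_conj _ _ (isConj_iff.2 ⟨g⁻¹, by simp [conjRefl]; group⟩)

theorem nu_conjRefl (g : D.G) (s : Refl D) : nu D (conjRefl D g s) = nu D s := by
  simp only [nu, map_sub, conjRefl]
  congr 1
  exact Representation.char_conj (dualRep D) s.1 g

theorem mu_conjRefl (g : D.G) (s : Refl D) : mu D (conjRefl D g s) = mu D s := by
  simp only [mu, map_sub, conjRefl]
  congr 1
  exact Representation.char_conj (stdRep D.G) s.1 g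

/-- The tensor $\alpha_s\otimes\alpha_s^\vee$ depends only on $s$. The eigenvectors chosen for
conjugate reflections need not be related, but by this formula their tensor products are. -/
theorem alpha_alphav (s : Refl D) (y : V) (f : Module.Dual ℂ V) :
    D.α s y * f (D.αv s) = 2 / mu D s * f (stdRep D.G s.1 y - y) := by
  rw [refl_y, add_sub_cancel_left, map_smul, smul_eq_mul]
  field_simp [mu_ne_zero D s]

theorem alpha_alphav_conjRefl (g : D.G) (s : Refl D) (y : V) (f : Module.Dual ℂ V) :
    D.α (conjRefl D g s) (stdRep D.G g y) * dualRep D g f (D.αv (conjRefl D g s)) =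
      D.α s y * f (D.αv s) := by
  rw [alpha_alphav, alpha_alphav, mu_conjRefl]
  congr 1
  change f (stdRep D.G g⁻¹ (stdRep D.G (g * s.1 * g⁻¹) (stdRep D.G g y) - stdRep D.G g y)) = _
  rw [map_sub, ← Module.End.mul_apply, ← Module.End.mul_apply, ← map_mul, ← map_mul,
    Representation.inv_self_apply]
  congr 4
  group

/-- The coefficient of a reflection in the Euler element. -/
def eulerCoeff (s : Refl D) : ℂ := 2 * D.c s / nu D s

open Classical in
/-- The coefficients of the Euler element as a function on `G`. -/
def eulerFun (g : D.G) : ℂ :=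
  if h : IsReflection (g : V ≃ₗ[ℂ] V) then eulerCoeff D ⟨g, h⟩ else 0

theorem eulerFun_conj (g h : D.G) : eulerFun D (h * g * h⁻¹) = eulerFun D g := by
  by_cases hg : IsReflection (g : V ≃ₗ[ℂ] V)
  · have h1 := (conjRefl D h ⟨g, hg⟩).2
    have h4 : IsReflection ((h * g * h⁻¹ : D.G) : V ≃ₗ[ℂ] V) := h1
    rw [eulerFun, eulerFun, dif_pos hg, dif_pos h4]
    have h2 := c_conjRefl D h ⟨g, hg⟩
    have h3 := nu_conjRefl D h ⟨g, hg⟩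
    unfold eulerCoeff
    rw [← h2, ← h3]
    rfl
  · have h1 : ¬ IsReflection ((h * g * h⁻¹ : D.G) : V ≃ₗ[ℂ] V) := by
      intro h1
      refine hg ?_
      have h2 := (conjRefl D h⁻¹ ⟨_, h1⟩).2
      have h3 : (conjRefl D h⁻¹ ⟨_, h1⟩).1 = g := by simp [conjRefl]; group
      rwa [h3] at h2
    rw [eulerFun, eulerFun, dif_neg hg, dif_neg h1]

theorem sum_refl_eq {Z : Type*} [AddCommMonoid Z] [Module ℂ Z] (F : D.G → Z) :
    ∑ s : Refl D, eulerCoeff D s • F s.1 =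
      letI := Fintype.ofFinite D.G
      ∑ g, eulerFun D g • F g := by
  classical
  let _ := Fintype.ofFinite D.G
  have h1 : ∀ s : Refl D, eulerCoeff D s • F s.1 = eulerFun D s.1 • F s.1 := by
    intro s
    rw [eulerFun, dif_pos s.2]
  simp only [h1]
  rw [← Finset.sum_subtype (Finset.univ.filter fun g : D.G => IsReflection (g : V ≃ₗ[ℂ] V))
    (fun g => by simp) (fun g => eulerFun D g • F g), Finset.sum_filter]
  refine Finset.sum_congr rfl fun g _ => ?_
  split_ifs with hg
  · rfl
  · rw [eulerFun, dif_neg hg, zero_smul]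

end Reflections

/-! ### The polynomial representation and divided differences. -/

section Poly

variable {V : Type u} [AddCommGroup V] [Module ℂ V] [FiniteDimensional ℂ V]

/-- The polynomial functions on `V`, in the coordinates of a fixed basis. -/
abbrev Poly (V : Type u) [AddCommGroup V] [Module ℂ V] [FiniteDimensional ℂ V] : Type :=
  MvPolynomial (Fin (Module.finrank ℂ V)) ℂ

/-- A linear form as a polynomial. -/
def lin : Module.Dual ℂ V →ₗ[ℂ] Poly V where
  toFun f := ∑ j, f (Module.finBasis ℂ V j) • MvPolynomial.X j
  map_add' f f' := by simp [add_smul, Finset.sum_add_distrib]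
  map_smul' r f := by simp [Finset.smul_sum, mul_smul]

theorem lin_coord (j : Fin (Module.finrank ℂ V)) :
    lin ((Module.finBasis ℂ V).coord j) = MvPolynomial.X j := by
  simp [lin, Finsupp.single_apply]

theorem eval_lin (f : Module.Dual ℂ V) (y : V) :
    MvPolynomial.eval (fun j => (Module.finBasis ℂ V).coord j y) (lin f) = f y := by
  have h : f y = ∑ j, (Module.finBasis ℂ V).repr y j * f (Module.finBasis ℂ V j) := by
    conv_lhs => rw [← (Module.finBasis ℂ V).sum_repr y]
    rw [map_sum]
    simp_rw [map_smul, smul_eq_mul]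
  simp [lin, h, mul_comm]

theorem lin_ne_zero {f : Module.Dual ℂ V} (hf : f ≠ 0) : lin f ≠ 0 := by
  intro h
  refine hf (LinearMap.ext fun y => ?_)
  rw [← eval_lin f y, h, map_zero, LinearMap.zero_apply]

theorem lin_mem (f : Module.Dual ℂ V) : (lin f).IsHomogeneous 1 := by
  refine MvPolynomial.IsHomogeneous.sum _ _ _ fun j _ => ?_
  rw [MvPolynomial.smul_eq_C_mul]
  exact (MvPolynomial.isHomogeneous_X ℂ j).C_mul _

@[elab_as_elim]
theorem poly_induction {motive : Poly V → Prop} (p : Poly V) (one : motive 1)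
    (smul : ∀ (r : ℂ) p, motive p → motive (r • p))
    (add : ∀ p q, motive p → motive q → motive (p + q))
    (lin_mul : ∀ (f : Module.Dual ℂ V) p, motive p → motive (lin f * p)) : motive p := by
  induction p using MvPolynomial.induction_on with
  | C a =>
    have : (MvPolynomial.C a : Poly V) = a • 1 := by
      rw [MvPolynomial.smul_eq_C_mul, mul_one]
    rw [this]
    exact smul _ _ one
  | add p q hp hq => exact add p q hp hq
  | mul_X p j hp =>
    rw [mul_comm, ← lin_coord]
    exact lin_mul _ _ hp

/-- The homogeneous polynomials of positive degree are spanned by products with linear forms. -/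
theorem homogeneous_induction {n : ℕ} {Q : Submodule ℂ (Poly V)}
    (h : ∀ (f : Module.Dual ℂ V) (p : Poly V), p.IsHomogeneous n → lin f * p ∈ Q)
    {p : Poly V} (hp : p.IsHomogeneous (n + 1)) : p ∈ Q := by
  rw [p.as_sum]
  refine Submodule.sum_mem _ fun m hm => ?_
  have hdeg : m.degree = n + 1 := by
    have := hp (MvPolynomial.mem_support_iff.1 hm)
    rwa [Finsupp.degree_eq_weight_one]
  obtain ⟨j, hj⟩ : ∃ j, m j ≠ 0 := by
    by_contra h0
    push Not at h0
    have : m = 0 := Finsupp.ext h0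
    rw [this] at hdeg
    simp at hdeg
  have hle : Finsupp.single j 1 ≤ m := by
    rw [Finsupp.single_le_iff]
    omega
  have hm' : m = Finsupp.single j 1 + (m - Finsupp.single j 1) := (add_tsub_cancel_of_le hle).symm
  have h2 : MvPolynomial.monomial m (p.coeff m) = lin ((Module.finBasis ℂ V).coord j) *
      MvPolynomial.monomial (m - Finsupp.single j 1) (p.coeff m) := by
    rw [lin_coord, MvPolynomial.X, MvPolynomial.monomial_mul, one_mul, ← hm']
  rw [h2]
  refine h _ _ (MvPolynomial.isHomogeneous_monomial _ ?_)
  have := congrArg Finsupp.degree hm'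
  rw [map_add, hdeg, Finsupp.degree_single] at this
  omega

variable (D : Datum V)

/-- The action of `G` on polynomials. -/
def polyAct (a : D.G) : Poly V →ₐ[ℂ] Poly V :=
  MvPolynomial.aeval fun j => lin (dualRep D a ((Module.finBasis ℂ V).coord j))

theorem polyAct_lin (a : D.G) (f : Module.Dual ℂ V) :
    polyAct D a (lin f) = lin (dualRep D a f) := by
  have h1 : polyAct D a (lin f) =
      lin (dualRep D a (∑ j, f (Module.finBasis ℂ V j) • (Module.finBasis ℂ V).coord j)) := by
    rw [map_sum, map_sum]
    simp_rw [map_smul]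
    change polyAct D a (∑ j, f (Module.finBasis ℂ V j) • MvPolynomial.X j) = _
    rw [map_sum]
    simp_rw [map_smul, polyAct, MvPolynomial.aeval_X]
  rw [h1]
  congr 2
  exact (Module.finBasis ℂ V).ext fun i => by simp

/-- The representation of `G` on polynomials. -/
def polyRep : Representation ℂ D.G (Poly V) where
  toFun a := (polyAct D a).toLinearMap
  map_one' := by
    have : polyAct D 1 = AlgHom.id ℂ _ := by
      refine MvPolynomial.algHom_ext fun j => ?_
      rw [← lin_coord, polyAct_lin, map_one]
      rfl
    rw [this]
    rfl
  map_mul' a b := by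
    have : polyAct D (a * b) = (polyAct D a).comp (polyAct D b) := by
      refine MvPolynomial.algHom_ext fun j => ?_
      rw [AlgHom.comp_apply, ← lin_coord, polyAct_lin, polyAct_lin, polyAct_lin, map_mul]
      rfl
    rw [this]
    rfl

theorem polyRep_one_poly (a : D.G) : polyRep D a 1 = 1 := map_one (polyAct D a)

theorem polyRep_mul_poly (a : D.G) (p q : Poly V) :
    polyRep D a (p * q) = polyRep D a p * polyRep D a q := map_mul (polyAct D a) p q

theorem polyRep_lin (a : D.G) (f : Module.Dual ℂ V) :
    polyRep D a (lin f) = lin (dualRep D a f) := polyAct_lin D a f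

theorem polyRep_homogeneous (a : D.G) {n : ℕ} {p : Poly V} (hp : p.IsHomogeneous n) :
    (polyRep D a p).IsHomogeneous n := by
  have := MvPolynomial.IsHomogeneous.aeval hp
    (fun j => lin (dualRep D a ((Module.finBasis ℂ V).coord j))) (fun j => lin_mem _)
  rwa [one_mul] at this

/-- The derivative of a polynomial in the direction `y`. -/
def dirDeriv (y : V) : Derivation ℂ (Poly V) (Poly V) :=
  MvPolynomial.mkDerivation ℂ fun j => MvPolynomial.C ((Module.finBasis ℂ V).coord j y)

theorem dirDeriv_lin (y : V) (f : Module.Dual ℂ V) :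
    dirDeriv y (lin f) = algebraMap ℂ (Poly V) (f y) := by
  rw [← eval_lin f y]
  simp only [lin, LinearMap.coe_mk, AddHom.coe_mk, map_sum]
  refine Finset.sum_congr rfl fun j _ => ?_
  rw [Derivation.map_smul, dirDeriv, MvPolynomial.mkDerivation_X, MvPolynomial.smul_eq_C_mul,
    MvPolynomial.smul_eq_C_mul, map_mul, map_mul, MvPolynomial.eval_C, MvPolynomial.eval_X]
  rfl

theorem dirDeriv_lin_mul (y : V) (f : Module.Dual ℂ V) (p : Poly V) :
    dirDeriv y (lin f * p) = lin f * dirDeriv y p + f y • p := by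
  rw [Derivation.leibniz, dirDeriv_lin, smul_eq_mul, smul_eq_mul, mul_comm p, ← Algebra.smul_def]

theorem dirDeriv_add (y y' : V) : dirDeriv (y + y') = dirDeriv y + dirDeriv y' :=
  MvPolynomial.derivation_ext fun j => by simp [dirDeriv]

theorem dirDeriv_smul (r : ℂ) (y : V) : dirDeriv (r • y) = r • dirDeriv y :=
  MvPolynomial.derivation_ext fun j => by simp [dirDeriv, MvPolynomial.smul_eq_C_mul]

theorem alpha_ne_zero (s : Refl D) : D.α s ≠ 0 := by
  intro h
  have := D.pairing s
  rw [h] at this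
  norm_num at this

/-- On linear forms $s-1$ has values in $\mathbb C\alpha_s$, and $s(fp)-fp=(sf-f)\,sp+f(sp-p)$
propagates divisibility to products. -/
theorem lin_alpha_dvd (s : Refl D) (p : Poly V) : lin (D.α s) ∣ polyRep D s.1 p - p := by
  induction p using poly_induction with
  | one => rw [polyRep_one_poly, sub_self]; exact dvd_zero _
  | smul r p hp =>
    rw [map_smul, ← smul_sub]
    exact hp.trans (dvd_smul_of_dvd r dvd_rfl)
  | add p q hp hq =>
    rw [map_add, add_sub_add_comm]
    exact dvd_add hp hq
  | lin_mul f p hp =>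
    have : polyRep D s.1 (lin f * p) - lin f * p = lin (D.α s) *
        ((nu D s / 2 * f (D.αv s)) • polyRep D s.1 p) + (polyRep D s.1 p - p) * lin f := by
      rw [polyRep_mul_poly, polyRep_lin, refl_x, map_add, map_smul]
      simp only [mul_smul_comm, add_mul, smul_mul_assoc]
      ring
    rw [this]
    exact dvd_add (dvd_mul_right _ _) (hp.mul_right _)

theorem exists_divided (s : Refl D) (p : Poly V) :
    ∃ q, lin (D.α s) * q = (2 / nu D s) • (polyRep D s.1 p - p) := by
  obtain ⟨q, hq⟩ := lin_alpha_dvd D s p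
  exact ⟨(2 / nu D s) • q, by rw [mul_smul_comm, hq]⟩

/-- The divided difference operator of a reflection. -/
def divided (s : Refl D) : Poly V →ₗ[ℂ] Poly V where
  toFun p := (exists_divided D s p).choose
  map_add' p q := by
    refine mul_left_cancel₀ (lin_ne_zero (alpha_ne_zero D s)) ?_
    rw [mul_add, (exists_divided D s p).choose_spec, (exists_divided D s q).choose_spec,
      (exists_divided D s (p + q)).choose_spec, map_add, ← smul_add]
    congr 1
    abel
  map_smul' r p := by
    refine mul_left_cancel₀ (lin_ne_zero (alpha_ne_zero D s)) ?_
    rw [RingHom.id_apply, mul_smul_comm, (exists_divided D s p).choose_spec,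
      (exists_divided D s (r • p)).choose_spec, map_smul, ← smul_sub, smul_comm]

theorem lin_mul_divided (s : Refl D) (p : Poly V) :
    lin (D.α s) * divided D s p = (2 / nu D s) • (polyRep D s.1 p - p) :=
  (exists_divided D s p).choose_spec

theorem divided_one (s : Refl D) : divided D s 1 = 0 := by
  refine mul_left_cancel₀ (lin_ne_zero (alpha_ne_zero D s)) ?_
  rw [lin_mul_divided, polyRep_one_poly, sub_self, smul_zero, mul_zero]

/-- The twisted Leibniz rule. The factor $2/\nu_s$ in the divided difference is chosen so that a
linear form $f$ goes to $f(\alpha_s^\vee)$, the coefficient in the defining relation of $\mathsf H$.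
-/
theorem divided_lin_mul (s : Refl D) (f : Module.Dual ℂ V) (p : Poly V) :
    divided D s (lin f * p) = lin f * divided D s p + f (D.αv s) • polyRep D s.1 p := by
  refine mul_left_cancel₀ (lin_ne_zero (alpha_ne_zero D s)) ?_
  rw [lin_mul_divided, mul_add, mul_left_comm, lin_mul_divided, polyRep_mul_poly, polyRep_lin,
    refl_x, map_add, map_smul]
  simp only [mul_smul_comm, add_mul, smul_mul_assoc, mul_sub, smul_sub, smul_add, smul_smul]
  have h := nu_ne_zero D s
  have h2 : 2 / nu D s * (nu D s / 2 * f (D.αv s)) = f (D.αv s) := by field_simp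
  rw [h2]
  abel

theorem divided_invariant_mul (s : Refl D) {f : Poly V} (hf : polyRep D s.1 f = f) (p : Poly V) :
    divided D s (f * p) = f * divided D s p := by
  refine mul_left_cancel₀ (lin_ne_zero (alpha_ne_zero D s)) ?_
  rw [lin_mul_divided, mul_left_comm, lin_mul_divided, polyRep_mul_poly, hf, ← mul_sub,
    mul_smul_comm]

/-! ### Dunkl operators -/

variable {W : Type w} [AddCommGroup W] [Module ℂ W] (τ : Representation ℂ D.G W)

/-- The Dunkl operators on `W`-valued polynomials. -/
def dunkl (y : V) : Module.End ℂ (Poly V ⊗[ℂ] W) :=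
  D.t • TensorProduct.map (dirDeriv y).toLinearMap LinearMap.id -
    ∑ s : Refl D, (D.c s * D.α s y) • TensorProduct.map (divided D s) (τ s.1)

/-- Multiplication by a polynomial. -/
def polyMul (W : Type w) [AddCommGroup W] [Module ℂ W] (p : Poly V) :
    Module.End ℂ (Poly V ⊗[ℂ] W) :=
  TensorProduct.map (LinearMap.mulLeft ℂ p) LinearMap.id

theorem polyMul_mul (p q : Poly V) : polyMul W (p * q) = polyMul W p * polyMul W q := by
  unfold polyMul
  rw [LinearMap.mulLeft_mul, ← TensorProduct.map_mul]
  rfl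

theorem polyMul_add (p q : Poly V) : polyMul W (p + q) = polyMul W p + polyMul W q := by
  refine TensorProduct.ext' fun a b => ?_
  simp [polyMul, add_mul, TensorProduct.add_tmul]

theorem polyMul_smul (r : ℂ) (p : Poly V) : polyMul W (r • p) = r • polyMul W p := by
  refine TensorProduct.ext' fun a b => ?_
  simp [polyMul, TensorProduct.smul_tmul']

theorem polyMul_tmul (p q : Poly V) (x : W) : polyMul W p (q ⊗ₜ x) = (p * q) ⊗ₜ x := rfl

/-- The representation of `G` on `W`-valued polynomials. -/
abbrev valRep : Representation ℂ D.G (Poly V ⊗[ℂ] W) := (polyRep D).tprod τ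

theorem valRep_lin (a : D.G) (f : Module.Dual ℂ V) (m : Poly V ⊗[ℂ] W) :
    valRep D τ a (polyMul W (lin f) m) = polyMul W (lin (dualRep D a f)) (valRep D τ a m) := by
  induction m with
  | zero => simp
  | add p q hp hq => rw [map_add, map_add, hp, hq, map_add, map_add]
  | tmul p x => simp [polyMul, polyRep_mul_poly, polyRep_lin]

/-- The commutator of `y` and `x` in representations of `H`. -/
def commOp {E : Type*} [AddCommGroup E] [Module ℂ E] (ρ : Representation ℂ D.G E) (y : V)
    (f : Module.Dual ℂ V) : Module.End ℂ E :=
  (D.t * f y) • 1 - ∑ s : Refl D, (D.c s * D.α s y * f (D.αv s)) • ρ s.1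

theorem commOp_apply {E : Type*} [AddCommGroup E] [Module ℂ E] (ρ : Representation ℂ D.G E) (y : V)
    (f : Module.Dual ℂ V) (m : E) : commOp D ρ y f m =
      (D.t * f y) • m - ∑ s : Refl D, (D.c s * D.α s y * f (D.αv s)) • ρ s.1 m := by
  simp [commOp]

theorem dualRep_stdRep (a : D.G) (f : Module.Dual ℂ V) (y : V) :
    dualRep D a f (stdRep D.G a y) = f y := by
  change f (stdRep D.G a⁻¹ (stdRep D.G a y)) = f y
  rw [Representation.inv_self_apply]

theorem rep_commOp {E : Type*} [AddCommGroup E] [Module ℂ E] (ρ : Representation ℂ D.G E) (a : D.G)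
    (y : V) (f : Module.Dual ℂ V) (m : E) :
    ρ a (commOp D ρ y f m) = commOp D ρ (stdRep D.G a y) (dualRep D a f) (ρ a m) := by
  rw [commOp_apply, commOp_apply, dualRep_stdRep, map_sub, map_smul, map_sum,
    ← Equiv.sum_comp (conjReflEquiv D a) fun s => (D.c s * D.α s (stdRep D.G a y) *
      dualRep D a f (D.αv s)) • ρ s.1 (ρ a m)]
  congr 1
  refine Finset.sum_congr rfl fun s _ => ?_
  have h1 : (conjReflEquiv D a s).1 = a * s.1 * a⁻¹ := rfl
  have h2 : ρ (a * s.1 * a⁻¹) (ρ a m) = ρ a (ρ s.1 m) := by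
    rw [← Module.End.mul_apply, ← Module.End.mul_apply, ← map_mul, ← map_mul, inv_mul_cancel_right]
  have h3 := alpha_alphav_conjRefl D a s y f
  have h4 := c_conjRefl D a s
  rw [h1, h2, map_smul]
  congr 1
  change _ = D.c (conjRefl D a s) * D.α (conjRefl D a s) _ * _
  rw [mul_assoc, mul_assoc, h4]
  congr 1
  exact h3.symm

/-- The part of the commutator of a commutator operator with an equivariant family `T` that is
not manifestly zero is symmetric. -/
theorem commOp_equivariant {E : Type*} [AddCommGroup E] [Module ℂ E] (ρ : Representation ℂ D.G E)
    (T : V →ₗ[ℂ] Module.End ℂ E) (hT : ∀ a y m, ρ a (T y m) = T (stdRep D.G a y) (ρ a m))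
    (y y' : V) (f : Module.Dual ℂ V) (m : E) :
    commOp D ρ y f (T y' m) - T y' (commOp D ρ y f m) =
      - ∑ s : Refl D, (D.c s * D.α s y * f (D.αv s) * (mu D s / 2 * D.α s y')) •
        T (D.αv s) (ρ s.1 m) := by
  rw [commOp_apply, commOp_apply, map_sub, map_smul, map_sum, sub_sub_sub_cancel_left, ← neg_sub,
    ← Finset.sum_sub_distrib]
  congr 1
  refine Finset.sum_congr rfl fun s _ => ?_
  rw [hT, refl_y, map_add, LinearMap.add_apply, map_smul, map_smul, LinearMap.smul_apply, smul_add,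
    smul_smul, add_sub_cancel_left]

/-- By the Jacobi identity, $[[T_y,T_{y'}],X_f]$ is the difference of the commutators of $[T_y,X_f]$
with $T_{y'}$ and of $[T_{y'},X_f]$ with $T_y$. `commOp_equivariant` shows these to be equal, being
symmetric in $y$ and $y'$. So commutativity on $m$ passes to $X_fm$. -/
theorem comm_of_equivariant {E : Type*} [AddCommGroup E] [Module ℂ E] (ρ : Representation ℂ D.G E)
    (T : V →ₗ[ℂ] Module.End ℂ E) (hT : ∀ a y m, ρ a (T y m) = T (stdRep D.G a y) (ρ a m))
    (X : Module.Dual ℂ V →ₗ[ℂ] Module.End ℂ E)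
    (hTX : ∀ y f m, T y (X f m) = X f (T y m) + commOp D ρ y f m)
    (y y' : V) (f : Module.Dual ℂ V) (m : E) (hm : T y (T y' m) = T y' (T y m)) :
    T y (T y' (X f m)) = T y' (T y (X f m)) := by
  have h1 := commOp_equivariant D ρ T hT y y' f m
  have h2 := commOp_equivariant D ρ T hT y' y f m
  have h3 : ∀ s : Refl D, D.c s * D.α s y' * f (D.αv s) * (mu D s / 2 * D.α s y) =
    D.c s * D.α s y * f (D.αv s) * (mu D s / 2 * D.α s y') := fun s => by ring
  simp only [h3] at h2
  rw [← h2, sub_eq_sub_iff_add_eq_add] at h1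
  rw [hTX y', hTX y, map_add, map_add, hTX, hTX, hm, add_assoc, add_assoc, h1]

theorem dunkl_tmul (y : V) (p : Poly V) (x : W) : dunkl D τ y (p ⊗ₜ[ℂ] x) =
    D.t • (dirDeriv y p ⊗ₜ[ℂ] x) -
      ∑ s : Refl D, (D.c s * D.α s y) • (divided D s p ⊗ₜ[ℂ] τ s.1 x) := by
  simp only [dunkl, LinearMap.sub_apply, LinearMap.smul_apply, LinearMap.sum_apply,
    TensorProduct.map_tmul, LinearMap.id_apply, Derivation.coeFn_coe]

/-- The Leibniz rules for the derivative and for the divided differences contribute the scalar part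
and the reflection part of the relation for $[y,x]$. -/
theorem dunkl_lin (y : V) (f : Module.Dual ℂ V) (m : Poly V ⊗[ℂ] W) :
    dunkl D τ y (polyMul W (lin f) m) =
      polyMul W (lin f) (dunkl D τ y m) + commOp D (valRep D τ) y f m := by
  induction m with
  | zero => simp only [map_zero, add_zero]
  | add p q hp hq =>
    rw [map_add, map_add, hp, hq, map_add, map_add, map_add]
    abel
  | tmul p x =>
    have h : ∀ s : Refl D, (D.c s * D.α s y) • (divided D s (lin f * p) ⊗ₜ[ℂ] τ s.1 x) =
        (D.c s * D.α s y) • (lin f * divided D s p) ⊗ₜ[ℂ] τ s.1 x +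
          (D.c s * D.α s y * f (D.αv s)) • valRep D τ s.1 (p ⊗ₜ[ℂ] x) := fun s => by
      rw [divided_lin_mul, TensorProduct.add_tmul, smul_add, ← TensorProduct.smul_tmul', smul_smul]
      rfl
    rw [polyMul_tmul, dunkl_tmul, dunkl_tmul, commOp_apply, map_sub, map_smul, map_sum,
      Finset.sum_congr rfl fun s _ => h s, Finset.sum_add_distrib, dirDeriv_lin_mul,
      TensorProduct.add_tmul, smul_add, ← TensorProduct.smul_tmul', smul_smul, polyMul_tmul]
    simp only [map_smul, polyMul_tmul]
    abel

theorem dunkl_one (y : V) (x : W) : dunkl D τ y (1 ⊗ₜ x) = 0 := by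
  simp [dunkl, divided_one]

theorem dunkl_add (y y' : V) : dunkl D τ (y + y') = dunkl D τ y + dunkl D τ y' := by
  refine TensorProduct.ext' fun p x => ?_
  have h : ∀ s : Refl D, (D.c s * D.α s (y + y')) • (divided D s p ⊗ₜ[ℂ] τ s.1 x) =
      (D.c s * D.α s y) • (divided D s p ⊗ₜ[ℂ] τ s.1 x) +
        (D.c s * D.α s y') • (divided D s p ⊗ₜ[ℂ] τ s.1 x) := fun s => by
    rw [map_add, mul_add, add_smul]
  rw [LinearMap.add_apply, dunkl_tmul, dunkl_tmul, dunkl_tmul, dirDeriv_add, Derivation.add_apply,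
    TensorProduct.add_tmul, smul_add, Finset.sum_congr rfl fun s _ => h s, Finset.sum_add_distrib]
  abel

theorem dunkl_smul (r : ℂ) (y : V) : dunkl D τ (r • y) = r • dunkl D τ y := by
  refine TensorProduct.ext' fun p x => ?_
  have h : ∀ s : Refl D, (D.c s * D.α s (r • y)) • (divided D s p ⊗ₜ[ℂ] τ s.1 x) =
      r • (D.c s * D.α s y) • (divided D s p ⊗ₜ[ℂ] τ s.1 x) := fun s => by
    rw [map_smul, smul_smul, smul_eq_mul, mul_left_comm]
  rw [LinearMap.smul_apply, dunkl_tmul, dunkl_tmul, dirDeriv_smul, Derivation.smul_apply,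
    ← TensorProduct.smul_tmul', smul_comm, Finset.sum_congr rfl fun s _ => h s, ← Finset.smul_sum,
    smul_sub]

/-- Multiplications by linear forms generate $\mathbb C[V]\otimes W$ from the constants. An identity
of operators therefore only needs to hold on constants and to survive multiplication by a linear
form. -/
theorem eq_zero_of_lin {Z : Type*} [AddCommGroup Z] [Module ℂ Z]
    (L : Poly V ⊗[ℂ] W →ₗ[ℂ] Z) (h1 : ∀ x, L (1 ⊗ₜ x) = 0)
    (h2 : ∀ f m, L m = 0 → L (polyMul W (lin f) m) = 0) (m : Poly V ⊗[ℂ] W) : L m = 0 := by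
  induction m with
  | zero => exact map_zero _
  | add p q hp hq => rw [map_add, hp, hq, add_zero]
  | tmul p x =>
    induction p using poly_induction with
    | one => exact h1 x
    | smul r p hp => rw [← TensorProduct.smul_tmul', map_smul, hp, smul_zero]
    | add p q hp hq => rw [TensorProduct.add_tmul, map_add, hp, hq, add_zero]
    | lin_mul f p hp => exact h2 f _ hp

theorem valRep_dunkl (a : D.G) (y : V) (m : Poly V ⊗[ℂ] W) :
    valRep D τ a (dunkl D τ y m) = dunkl D τ (stdRep D.G a y) (valRep D τ a m) := by
  rw [← sub_eq_zero]
  refine eq_zero_of_lin (valRep D τ a ∘ₗ dunkl D τ y -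
    dunkl D τ (stdRep D.G a y) ∘ₗ valRep D τ a) ?_ ?_ m
  · intro x
    simp only [LinearMap.sub_apply, LinearMap.comp_apply, dunkl_one, map_zero,
      Representation.tprod_apply, TensorProduct.map_tmul, polyRep_one_poly, sub_self]
  · intro f m hm
    simp only [LinearMap.sub_apply, LinearMap.comp_apply, sub_eq_zero] at hm ⊢
    rw [dunkl_lin, map_add, valRep_lin, valRep_lin, dunkl_lin, hm, rep_commOp]

/-- The Dunkl operators as a linear function of `y`. -/
def dunklLin : V →ₗ[ℂ] Module.End ℂ (Poly V ⊗[ℂ] W) where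
  toFun := dunkl D τ
  map_add' := dunkl_add D τ
  map_smul' := dunkl_smul D τ

/-- Multiplication by linear forms as a linear map. -/
def polyMulLin (V : Type u) [AddCommGroup V] [Module ℂ V] [FiniteDimensional ℂ V]
    (W : Type w) [AddCommGroup W] [Module ℂ W] :
    Module.Dual ℂ V →ₗ[ℂ] Module.End ℂ (Poly V ⊗[ℂ] W) where
  toFun f := polyMul W (lin f)
  map_add' f f' := by rw [map_add, polyMul_add]
  map_smul' r f := by rw [map_smul, polyMul_smul]; rfl

theorem dunkl_comm (y y' : V) (m : Poly V ⊗[ℂ] W) :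
    dunkl D τ y (dunkl D τ y' m) = dunkl D τ y' (dunkl D τ y m) := by
  rw [← sub_eq_zero]
  refine eq_zero_of_lin (dunkl D τ y ∘ₗ dunkl D τ y' - dunkl D τ y' ∘ₗ dunkl D τ y) ?_ ?_ m
  · intro x
    simp only [LinearMap.sub_apply, LinearMap.comp_apply, dunkl_one, map_zero, sub_self]
  · intro f m hm
    rw [LinearMap.sub_apply, LinearMap.comp_apply, LinearMap.comp_apply, sub_eq_zero] at hm ⊢
    exact comm_of_equivariant D (valRep D τ) (dunklLin D τ) (valRep_dunkl D τ) (polyMulLin V W)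
      (dunkl_lin D τ) y y' f m hm

/-- The images of the generators of `H` in the endomorphisms of `W`-valued polynomials. -/
def genOp : Gen D → Module.End ℂ (Poly V ⊗[ℂ] W)
  | .y v => dunkl D τ v
  | .x f => polyMul W (lin f)
  | .g a => valRep D τ a

/-- The action of `H` on `W`-valued polynomials by Dunkl operators. -/
def dunklHom : RCA D →ₐ[ℂ] Module.End ℂ (Poly V ⊗[ℂ] W) :=
  RingQuot.liftAlgHom ℂ ⟨FreeAlgebra.lift ℂ (genOp D τ), by
    intro a b hab
    induction hab with
    | y_add v v' => simp [genOp, dunkl_add]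
    | y_smul r v => simp [genOp, dunkl_smul]
    | x_add f f' => simp [genOp, polyMul_add]
    | x_smul r f => simp [genOp, polyMul_smul]
    | g_one => simp only [FreeAlgebra.lift_ι_apply, genOp, map_one]
    | g_mul a b => simp only [FreeAlgebra.lift_ι_apply, genOp, map_mul]
    | y_comm v v' =>
      simp only [FreeAlgebra.lift_ι_apply, genOp, map_mul]
      exact LinearMap.ext fun m => dunkl_comm D τ v v' m
    | x_comm f f' =>
      simp only [FreeAlgebra.lift_ι_apply, genOp, map_mul]
      rw [← polyMul_mul, ← polyMul_mul, mul_comm]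
    | g_y a v =>
      simp only [FreeAlgebra.lift_ι_apply, genOp, map_mul]
      exact LinearMap.ext fun m => valRep_dunkl D τ a v m
    | g_x a f =>
      simp only [FreeAlgebra.lift_ι_apply, genOp, map_mul]
      exact LinearMap.ext fun m => valRep_lin D τ a f m
    | y_x v f =>
      simp only [FreeAlgebra.lift_ι_apply, genOp, map_mul, map_sub, map_smul, map_sum, map_one]
      refine LinearMap.ext fun m => ?_
      rw [LinearMap.sub_apply, Module.End.mul_apply, Module.End.mul_apply, dunkl_lin,
        add_sub_cancel_left]
      rfl⟩

theorem dunklHom_gen (a : Gen D) : dunklHom D τ (gen D a) = genOp D τ a := by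
  exact (RingQuot.liftAlgHom_mkAlgHom_apply _ _ _ _).trans (FreeAlgebra.lift_ι_apply _ _)

end Poly

/-! ### Vector spaces graded by the integers, with their projections. -/

section Grading

/-- A direct sum decomposition of a vector space indexed by `ℤ`, with its projections. -/
structure Grading {X : Type*} [AddCommGroup X] [Module ℂ X] (part : ℤ → Submodule ℂ X) where
  proj : ℤ → X →ₗ[ℂ] X
  proj_mem : ∀ n m, proj n m ∈ part n
  proj_self : ∀ n, ∀ m ∈ part n, proj n m = m
  proj_ne : ∀ n k, ∀ m ∈ part k, k ≠ n → proj n m = 0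
  iSup_eq_top : ⨆ n, part n = ⊤

namespace Grading

variable {X Y : Type*} [AddCommGroup X] [Module ℂ X] [AddCommGroup Y] [Module ℂ Y]
  {part : ℤ → Submodule ℂ X} {partY : ℤ → Submodule ℂ Y}

theorem induction (𝓖 : Grading part) {motive : X → Prop} (mem : ∀ n, ∀ m ∈ part n, motive m)
    (zero : motive 0) (add : ∀ a b, motive a → motive b → motive (a + b)) (m : X) : motive m :=
  Submodule.iSup_induction part (motive := motive)
    (show m ∈ ⨆ n, part n by rw [𝓖.iSup_eq_top]; trivial) mem zero add

theorem exists_sum (𝓖 : Grading part) (m : X) :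
    ∃ s : Finset ℤ, m = ∑ n ∈ s, 𝓖.proj n m ∧ ∀ n ∉ s, 𝓖.proj n m = 0 := by
  classical
  -- Asking for the formula on all larger finite sets lets two supports be merged; comparing with
  -- one extra index then gives the vanishing outside `s`.
  suffices h : ∃ s : Finset ℤ, ∀ s', s ⊆ s' → m = ∑ n ∈ s', 𝓖.proj n m by
    obtain ⟨s, hs⟩ := h
    refine ⟨s, hs s subset_rfl, fun n hn => ?_⟩
    have h1 := hs (insert n s) (Finset.subset_insert n s)
    rw [Finset.sum_insert hn, ← hs s subset_rfl] at h1
    simpa using h1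
  refine 𝓖.induction (motive := fun m => ∃ s : Finset ℤ, ∀ s', s ⊆ s' → m = ∑ n ∈ s', 𝓖.proj n m)
    ?_ ?_ ?_ m
  · intro n m hm
    refine ⟨{n}, fun s' hs' => ?_⟩
    rw [Finset.sum_eq_single n, 𝓖.proj_self n m hm]
    · intro k _ hk
      exact 𝓖.proj_ne k n m hm hk.symm
    · intro h
      exact absurd (hs' (Finset.mem_singleton_self n)) h
  · exact ⟨∅, fun s' _ => by simp⟩
  · rintro a b ⟨s, hs⟩ ⟨t, ht⟩
    refine ⟨s ∪ t, fun s' hs' => ?_⟩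
    simp only [map_add, Finset.sum_add_distrib]
    rw [← hs s' (Finset.union_subset_left hs'), ← ht s' (Finset.union_subset_right hs')]

theorem eq_zero (𝓖 : Grading part) {m : X} (h : ∀ n, 𝓖.proj n m = 0) : m = 0 := by
  obtain ⟨s, hs, -⟩ := 𝓖.exists_sum m
  rw [hs]
  exact Finset.sum_eq_zero fun n _ => h n

theorem mem_of_proj_mem (𝓖 : Grading part) {Q : Submodule ℂ X} {m : X}
    (h : ∀ n, 𝓖.proj n m ∈ Q) : m ∈ Q := by
  obtain ⟨s, hs, -⟩ := 𝓖.exists_sum m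
  rw [hs]
  exact Submodule.sum_mem _ fun n _ => h n

theorem map_proj (𝓖 : Grading part) (𝓗 : Grading partY) (T : X →ₗ[ℂ] Y) (k : ℤ)
    (hT : ∀ n, ∀ m ∈ part n, T m ∈ partY (n + k)) (n : ℤ) (m : X) :
    T (𝓖.proj n m) = 𝓗.proj (n + k) (T m) := by
  refine 𝓖.induction (motive := fun m => T (𝓖.proj n m) = 𝓗.proj (n + k) (T m)) ?_ ?_ ?_ m
  · intro j m hm
    by_cases hj : j = n
    · subst hj
      rw [𝓖.proj_self _ _ hm, 𝓗.proj_self _ _ (hT _ _ hm)]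
    · rw [𝓖.proj_ne _ _ _ hm hj, 𝓗.proj_ne _ _ _ (hT _ _ hm) (by omega), map_zero]
  · simp
  · intro a b ha hb
    simp only [map_add, ha, hb]

/-- Transport of a grading along a linear isomorphism. -/
def transport (𝓖 : Grading part) (e : X ≃ₗ[ℂ] Y) (h : ∀ n, partY n = (part n).map e.toLinearMap) :
    Grading partY where
  proj n := e.toLinearMap ∘ₗ 𝓖.proj n ∘ₗ e.symm.toLinearMap
  proj_mem n m := by rw [h]; exact ⟨_, 𝓖.proj_mem n _, rfl⟩
  proj_self n m hm := by
    rw [h] at hm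
    obtain ⟨x, hx, rfl⟩ := hm
    simp [𝓖.proj_self n x hx]
  proj_ne n k m hm hk := by
    rw [h] at hm
    obtain ⟨x, hx, rfl⟩ := hm
    simp [𝓖.proj_ne n k x hx hk]
  iSup_eq_top := by
    simp_rw [h]
    rw [← Submodule.map_iSup, 𝓖.iSup_eq_top, Submodule.map_top, LinearMap.range_eq_top]
    exact e.surjective

/-- The grading of a quotient by a subspace stable under the projections. -/
def quotient (𝓖 : Grading part) (T : X →ₗ[ℂ] Y) (hT : Function.Surjective T)
    (hker : ∀ n m, T m = 0 → T (𝓖.proj n m) = 0) (h : ∀ n, partY n = (part n).map T) :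
    Grading partY where
  proj n := ((LinearMap.ker T).liftQ (T ∘ₗ 𝓖.proj n) fun m hm => hker n m hm) ∘ₗ
    (T.quotKerEquivOfSurjective hT).symm.toLinearMap
  proj_mem n m := by
    obtain ⟨m, rfl⟩ := hT m
    rw [h]
    refine ⟨𝓖.proj n m, 𝓖.proj_mem n m, ?_⟩
    have : (T.quotKerEquivOfSurjective hT).symm (T m) = Submodule.Quotient.mk m := by
      rw [LinearEquiv.symm_apply_eq]; rfl
    rw [LinearMap.comp_apply, LinearEquiv.coe_coe, this]
    rfl
  proj_self n m hm := by
    rw [h] at hm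
    obtain ⟨m, hm, rfl⟩ := hm
    have : (T.quotKerEquivOfSurjective hT).symm (T m) = Submodule.Quotient.mk m := by
      rw [LinearEquiv.symm_apply_eq]; rfl
    rw [LinearMap.comp_apply, LinearEquiv.coe_coe, this]
    change T (𝓖.proj n m) = T m
    rw [𝓖.proj_self n m hm]
  proj_ne n k m hm hk := by
    rw [h] at hm
    obtain ⟨m, hm, rfl⟩ := hm
    have : (T.quotKerEquivOfSurjective hT).symm (T m) = Submodule.Quotient.mk m := by
      rw [LinearEquiv.symm_apply_eq]; rfl
    rw [LinearMap.comp_apply, LinearEquiv.coe_coe, this]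
    change T (𝓖.proj n m) = 0
    rw [𝓖.proj_ne n k m hm hk, map_zero]
  iSup_eq_top := by
    simp_rw [h]
    rw [← Submodule.map_iSup, 𝓖.iSup_eq_top, Submodule.map_top, LinearMap.range_eq_top]
    exact hT

end Grading

end Grading

/-! ### The polynomial model of the standard module. -/

section Model

variable {V : Type u} [AddCommGroup V] [Module ℂ V] [FiniteDimensional ℂ V] (D : Datum V)

/-- The projection from the free algebra. -/
def freeHom : FreeAlgebra ℂ (Gen D) →ₐ[ℂ] RCA D := RingQuot.mkAlgHom ℂ (Rel D)

theorem freeHom_surjective : Function.Surjective (freeHom D) := RingQuot.mkAlgHom_surjective ℂ _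

theorem smul_mem_of_gen {X : Type*} [AddCommGroup X] [Module ℂ X] [Module (RCA D) X]
    [IsScalarTower ℂ (RCA D) X] (Q : Submodule ℂ X) (hQ : ∀ a, ∀ m ∈ Q, gen D a • m ∈ Q)
    (h : RCA D) : ∀ m ∈ Q, h • m ∈ Q := by
  obtain ⟨p, rfl⟩ := freeHom_surjective D h
  induction p using FreeAlgebra.induction with
  | grade0 r =>
    intro m hm
    rw [AlgHom.commutes, algebraMap_smul]
    exact Q.smul_mem r hm
  | grade1 a => exact hQ a
  | mul p q hp hq =>
    intro m hm
    rw [map_mul, mul_smul]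
    exact hp _ (hq m hm)
  | add p q hp hq =>
    intro m hm
    rw [map_add, add_smul]
    exact Q.add_mem (hp _ hm) (hq m hm)

variable {W : Type w} [AddCommGroup W] [Module ℂ W] (τ : Representation ℂ D.G W)

/-- The lowest weight vectors of the standard module. -/
def vermaOne : W →ₗ[ℂ] Verma D τ where
  toFun v := Submodule.Quotient.mk (1 ⊗ₜ v)
  map_add' v v' := by rw [TensorProduct.tmul_add]; rfl
  map_smul' r v := by rw [TensorProduct.tmul_smul]; rfl

theorem mk_tmul (h : RCA D) (v : W) :
    (Submodule.Quotient.mk (h ⊗ₜ v) : Verma D τ) = h • vermaOne D τ v := by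
  change _ = Submodule.Quotient.mk (h • (1 ⊗ₜ v))
  rw [TensorProduct.smul_tmul', smul_eq_mul, mul_one]

theorem gen_g_vermaOne (a : D.G) (v : W) :
    gen D (.g a) • vermaOne D τ v = vermaOne D τ (τ a v) := by
  rw [← mk_tmul]
  exact (Submodule.Quotient.eq _).2 (Submodule.subset_span (Or.inl ⟨a, v, rfl⟩))

theorem gen_y_vermaOne (y : V) (v : W) : gen D (.y y) • vermaOne D τ v = 0 := by
  rw [← mk_tmul]
  exact (Submodule.Quotient.mk_eq_zero _).2 (Submodule.subset_span (Or.inr ⟨y, v, rfl⟩))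

theorem verma_induction {Q : Submodule (RCA D) (Verma D τ)} (h : ∀ v, vermaOne D τ v ∈ Q) :
    Q = ⊤ := by
  rw [eq_top_iff]
  rintro m -
  obtain ⟨m, rfl⟩ := Submodule.Quotient.mk_surjective _ m
  induction m with
  | zero => exact Q.zero_mem
  | add a b ha hb => exact Q.add_mem ha hb
  | tmul a v => rw [mk_tmul]; exact Q.smul_mem a (h v)

section Lift

variable {X : Type*} [AddCommGroup X] [Module ℂ X] [Module (RCA D) X] [IsScalarTower ℂ (RCA D) X]

/-- The universal property of the standard module. -/
def vermaLift (u : W →ₗ[ℂ] X) (hg : ∀ a v, gen D (.g a) • u v = u (τ a v))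
    (hy : ∀ y v, gen D (.y y) • u v = 0) : Verma D τ →ₗ[RCA D] X :=
  have : SMulCommClass ℂ (RCA D) X := IsScalarTower.to_smulCommClass
  have : SMulCommClass (RCA D) ℂ X := SMulCommClass.symm _ _ _
  (vermaRel D τ).liftQ (TensorProduct.AlgebraTensorModule.lift
    (LinearMap.toSpanSingleton (RCA D) (W →ₗ[ℂ] X) u)) (by
    refine Submodule.span_le.2 ?_
    rintro _ (⟨a, v, rfl⟩ | ⟨y, v, rfl⟩)
    · simp [hg]
    · simp [hy])

theorem vermaLift_one (u : W →ₗ[ℂ] X) (hg : ∀ a v, gen D (.g a) • u v = u (τ a v))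
    (hy : ∀ y v, gen D (.y y) • u v = 0) (v : W) :
    vermaLift D τ u hg hy (vermaOne D τ v) = u v := by
  change (1 : RCA D) • u v = u v
  rw [one_smul]

end Lift

theorem gen_y_x (y : V) (f : Module.Dual ℂ V) :
    gen D (.y y) * gen D (.x f) - gen D (.x f) * gen D (.y y) =
      (D.t * f y) • 1 - ∑ s : Refl D, (D.c s * D.α s y * f (D.αv s)) • gen D (.g s.1) := by
  have h := RingQuot.mkAlgHom_rel ℂ (Rel.y_x (D := D) y f)
  rw [map_sub, map_mul, map_mul, map_sub, map_smul, map_one, map_sum] at h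
  simp_rw [map_smul] at h
  exact h

theorem gen_y_x_smul {X : Type*} [AddCommGroup X] [Module ℂ X] [Module (RCA D) X]
    [IsScalarTower ℂ (RCA D) X] (y : V) (f : Module.Dual ℂ V) (m : X) :
    gen D (.y y) • gen D (.x f) • m =
      gen D (.x f) • gen D (.y y) • m + commOp D (gRep D X) y f m := by
  have h := congrArg (fun a : RCA D => a • m) (gen_y_x D y f)
  simp only [sub_smul, mul_smul, Finset.sum_smul, smul_assoc, one_smul] at h
  rw [sub_eq_iff_eq_add'] at h
  rw [h, commOp_apply]
  simp only [mul_smul]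
  rfl

theorem gen_x_comm (f f' : Module.Dual ℂ V) :
    gen D (.x f) * gen D (.x f') = gen D (.x f') * gen D (.x f) := by
  have h := RingQuot.mkAlgHom_rel ℂ (Rel.x_comm (D := D) f f')
  rw [map_mul, map_mul] at h
  exact h

theorem gen_y_comm (y y' : V) :
    gen D (.y y) * gen D (.y y') = gen D (.y y') * gen D (.y y) := by
  have h := RingQuot.mkAlgHom_rel ℂ (Rel.y_comm (D := D) y y')
  rw [map_mul, map_mul] at h
  exact h

open scoped IsMulCommutative in
theorem exists_polyHom : ∃ φ : Poly V →ₐ[ℂ] RCA D, ∀ f, φ (lin f) = gen D (.x f) := by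
  let a : Fin (Module.finrank ℂ V) → RCA D := fun j => gen D (.x ((Module.finBasis ℂ V).coord j))
  have hcomm : ∀ p ∈ Set.range a, ∀ q ∈ Set.range a, p * q = q * p := by
    rintro _ ⟨i, rfl⟩ _ ⟨j, rfl⟩
    exact gen_x_comm D _ _
  -- Evaluation of polynomials needs a commutative target, so it is done in the subalgebra generated
  -- by the commuting coordinate elements.
  have := Algebra.isMulCommutative_adjoin ℂ hcomm
  let _ : CommRing (Algebra.adjoin ℂ (Set.range a)) := inferInstance
  let φ : Poly V →ₐ[ℂ] RCA D := (Algebra.adjoin ℂ (Set.range a)).val.comp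
    (MvPolynomial.aeval fun j => ⟨a j, Algebra.subset_adjoin ⟨j, rfl⟩⟩)
  have hφ : ∀ j, φ (MvPolynomial.X j) = a j := fun j => by
    simp [φ]
  refine ⟨φ, fun f => ?_⟩
  have h1 : f = ∑ j, f (Module.finBasis ℂ V j) • (Module.finBasis ℂ V).coord j :=
    (Module.finBasis ℂ V).ext fun i => by simp
  have h2 : gen D (.x f) = ∑ j, f (Module.finBasis ℂ V j) • a j := by
    change xHom D f = _
    conv_lhs => rw [h1]
    rw [map_sum]
    simp_rw [map_smul]
    rfl
  change φ (∑ j, f (Module.finBasis ℂ V j) • MvPolynomial.X j) = _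
  rw [h2, map_sum]
  simp_rw [map_smul, hφ]

/-- The subalgebra of polynomials in `H`. -/
def polyHom : Poly V →ₐ[ℂ] RCA D := (exists_polyHom D).choose

theorem polyHom_lin (f : Module.Dual ℂ V) : polyHom D (lin f) = gen D (.x f) :=
  (exists_polyHom D).choose_spec f

/-- The polynomial model of the standard module. -/
def Model (_ : Representation ℂ D.G W) : Type w := Poly V ⊗[ℂ] W

instance : AddCommGroup (Model D τ) := inferInstanceAs (AddCommGroup (Poly V ⊗[ℂ] W))

instance : Module ℂ (Model D τ) := inferInstanceAs (Module ℂ (Poly V ⊗[ℂ] W))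

instance : Module (RCA D) (Model D τ) :=
  Module.compHom (Poly V ⊗[ℂ] W) (dunklHom D τ).toRingHom

theorem model_smul (h : RCA D) (m : Model D τ) : h • m = dunklHom D τ h m := rfl

instance : IsScalarTower ℂ (RCA D) (Model D τ) where
  smul_assoc r h m := by
    rw [model_smul, model_smul, map_smul]
    rfl

theorem model_gen_smul (a : Gen D) (m : Model D τ) : gen D a • m = genOp D τ a m := by
  rw [model_smul, dunklHom_gen]

/-- The map from the standard module to its polynomial model. -/
def toModel : Verma D τ →ₗ[RCA D] Model D τ :=
  vermaLift D τ (X := Model D τ) (TensorProduct.mk ℂ (Poly V) W 1)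
    (fun a v => by
      rw [model_gen_smul]
      change TensorProduct.map (polyRep D a) (τ a) (1 ⊗ₜ v) = _
      rw [TensorProduct.map_tmul, polyRep_one_poly]
      rfl)
    (fun y v => by
      rw [model_gen_smul]
      exact dunkl_one D τ y v)

theorem toModel_one (v : W) : toModel D τ (vermaOne D τ v) = (1 : Poly V) ⊗ₜ[ℂ] v :=
  vermaLift_one D τ _ _ _ v

/-- The map from polynomials to the standard module. -/
def ofModel : Poly V ⊗[ℂ] W →ₗ[ℂ] Verma D τ :=
  TensorProduct.lift (LinearMap.mk₂ ℂ (fun p v => polyHom D p • vermaOne D τ v)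
    (fun p q v => by rw [map_add, add_smul]) (fun r p v => by rw [map_smul, smul_assoc])
    (fun p v v' => by rw [map_add, smul_add]) (fun r p v => by rw [map_smul, smul_comm]))

theorem ofModel_tmul (p : Poly V) (v : W) : ofModel D τ (p ⊗ₜ v) = polyHom D p • vermaOne D τ v :=
  rfl

theorem ofModel_polyMul (p : Poly V) (m : Poly V ⊗[ℂ] W) :
    ofModel D τ (polyMul W p m) = polyHom D p • ofModel D τ m := by
  induction m with
  | zero => simp
  | add a b ha hb => rw [map_add, map_add, ha, hb, map_add, smul_add]
  | tmul q v => rw [polyMul_tmul, ofModel_tmul, ofModel_tmul, map_mul, mul_smul]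

theorem ofModel_one (v : W) : ofModel D τ (1 ⊗ₜ v) = vermaOne D τ v := by
  rw [ofModel_tmul, map_one, one_smul]

theorem ofModel_valRep (a : D.G) (m : Poly V ⊗[ℂ] W) :
    ofModel D τ (valRep D τ a m) = gRep D (Verma D τ) a (ofModel D τ m) := by
  rw [← sub_eq_zero]
  refine eq_zero_of_lin (ofModel D τ ∘ₗ valRep D τ a - gRep D (Verma D τ) a ∘ₗ ofModel D τ) ?_ ?_ m
  · intro v
    rw [LinearMap.sub_apply, LinearMap.comp_apply, LinearMap.comp_apply, sub_eq_zero,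
      Representation.tprod_apply, TensorProduct.map_tmul, polyRep_one_poly, ofModel_one,
      ofModel_one]
    exact (gen_g_vermaOne D τ a v).symm
  · intro f m hm
    rw [LinearMap.sub_apply, LinearMap.comp_apply, LinearMap.comp_apply, sub_eq_zero] at hm ⊢
    rw [valRep_lin, ofModel_polyMul, ofModel_polyMul, hm, polyHom_lin, polyHom_lin]
    exact (gRep_x D (Verma D τ) a f _).symm

theorem map_commOp {E F : Type*} [AddCommGroup E] [Module ℂ E] [AddCommGroup F] [Module ℂ F]
    (ρ : Representation ℂ D.G E) (π : Representation ℂ D.G F) (T : E →ₗ[ℂ] F)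
    (hT : ∀ a m, T (ρ a m) = π a (T m)) (y : V) (f : Module.Dual ℂ V) (m : E) :
    T (commOp D ρ y f m) = commOp D π y f (T m) := by
  rw [commOp_apply, commOp_apply, map_sub, map_smul, map_sum]
  simp_rw [map_smul, hT]

theorem ofModel_dunkl (y : V) (m : Poly V ⊗[ℂ] W) :
    ofModel D τ (dunkl D τ y m) = gen D (.y y) • ofModel D τ m := by
  rw [← sub_eq_zero]
  refine eq_zero_of_lin (ofModel D τ ∘ₗ dunkl D τ y -
    Algebra.lsmul ℂ ℂ (Verma D τ) (gen D (.y y)) ∘ₗ ofModel D τ) ?_ ?_ m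
  · intro v
    simp only [LinearMap.sub_apply, LinearMap.comp_apply, Algebra.lsmul_coe]
    rw [dunkl_one, ofModel_one, gen_y_vermaOne, map_zero, sub_zero]
  · intro f m hm
    simp only [LinearMap.sub_apply, LinearMap.comp_apply, Algebra.lsmul_coe, sub_eq_zero] at hm ⊢
    rw [dunkl_lin, ofModel_polyMul, map_add, ofModel_polyMul, hm, polyHom_lin, gen_y_x_smul,
      map_commOp D _ _ (ofModel D τ) (ofModel_valRep D τ)]

theorem ofModel_gen (a : Gen D) (m : Poly V ⊗[ℂ] W) :
    ofModel D τ (genOp D τ a m) = gen D a • ofModel D τ m := by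
  cases a with
  | y v => exact ofModel_dunkl D τ v m
  | x f => exact (ofModel_polyMul D τ (lin f) m).trans (by rw [polyHom_lin])
  | g a => exact ofModel_valRep D τ a m

/-- The image is stable under all generators, because they act on polynomials by the model
operators, and it contains the lowest weight vectors. -/
theorem ofModel_surjective : Function.Surjective (ofModel D τ) := by
  have hQ := smul_mem_of_gen D (LinearMap.range (ofModel D τ)) (by
    rintro a _ ⟨m, rfl⟩
    exact ⟨_, ofModel_gen D τ a m⟩)
  let Q : Submodule (RCA D) (Verma D τ) :=
    { LinearMap.range (ofModel D τ) with smul_mem' := fun h m hm => hQ h m hm }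
  have : Q = ⊤ := verma_induction D τ fun v => ⟨_, ofModel_one D τ v⟩
  intro m
  have h : m ∈ Q := by rw [this]; trivial
  exact h

/-- The linear independence half of the PBW property: the Dunkl operators define an honest $\mathsf
H$-module on polynomials, so no collapse can occur in the standard module. -/
theorem toModel_ofModel (m : Poly V ⊗[ℂ] W) : toModel D τ (ofModel D τ m) = m := by
  refine (sub_eq_zero (G := Model D τ)).1 ?_
  refine eq_zero_of_lin (Z := Model D τ)
    ((toModel D τ).restrictScalars ℂ ∘ₗ ofModel D τ - LinearMap.id) ?_ ?_ m
  · intro v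
    refine sub_eq_zero.2 ?_
    change toModel D τ (ofModel D τ (1 ⊗ₜ v)) = _
    rw [ofModel_one, toModel_one]
    rfl
  · intro f m hm
    have hm' : toModel D τ (ofModel D τ m) = m := sub_eq_zero.1 hm
    refine sub_eq_zero.2 ?_
    change toModel D τ (ofModel D τ (polyMul W (lin f) m)) = polyMul W (lin f) m
    rw [ofModel_polyMul, map_smul, hm', polyHom_lin]
    exact model_gen_smul D τ (.x f) m

/-- The standard module is isomorphic to the space of `W`-valued polynomials. -/
def modelEquiv : (Poly V ⊗[ℂ] W) ≃ₗ[ℂ] Verma D τ :=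
  LinearEquiv.ofBijective (ofModel D τ)
    ⟨Function.LeftInverse.injective (g := toModel D τ) (toModel_ofModel D τ),
      ofModel_surjective D τ⟩

end Model

/-! ### Degrees in the polynomial model and in the standard module. -/

section ModelGrading

variable {V : Type u} [AddCommGroup V] [Module ℂ V] [FiniteDimensional ℂ V] (D : Datum V)
  {W : Type w} [AddCommGroup W] [Module ℂ W] (τ : Representation ℂ D.G W)

/-- The `W`-valued polynomials of degree `n`. -/
def polyPart (V : Type u) [AddCommGroup V] [Module ℂ V] [FiniteDimensional ℂ V]
    (W : Type w) [AddCommGroup W] [Module ℂ W] (n : ℤ) : Submodule ℂ (Poly V ⊗[ℂ] W) :=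
  Submodule.span ℂ {m | ∃ (k : ℕ) (p : Poly V) (x : W), (k : ℤ) = n ∧ p.IsHomogeneous k ∧
    m = p ⊗ₜ x}

theorem tmul_mem_polyPart {k : ℕ} {p : Poly V} (hp : p.IsHomogeneous k) (x : W) :
    p ⊗ₜ[ℂ] x ∈ polyPart V W k := Submodule.subset_span ⟨k, p, x, rfl, hp, rfl⟩

theorem polyPart_le {n : ℤ} {Q : Submodule ℂ (Poly V ⊗[ℂ] W)}
    (h : ∀ (k : ℕ) (p : Poly V) (x : W), (k : ℤ) = n → p.IsHomogeneous k → p ⊗ₜ x ∈ Q) :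
    polyPart V W n ≤ Q := by
  refine Submodule.span_le.2 ?_
  rintro _ ⟨k, p, x, hk, hp, rfl⟩
  exact h k p x hk hp

theorem polyPart_neg {n : ℤ} (hn : n < 0) : polyPart V W n = ⊥ := by
  rw [eq_bot_iff]
  exact polyPart_le fun k p x hk => by omega

/-- The projection to the polynomials of degree `n`. -/
def polyProj (V : Type u) [AddCommGroup V] [Module ℂ V] [FiniteDimensional ℂ V] (n : ℤ) :
    Poly V →ₗ[ℂ] Poly V :=
  if 0 ≤ n then MvPolynomial.homogeneousComponent n.toNat else 0

theorem polyProj_homogeneous {k : ℕ} {p : Poly V} (hp : p.IsHomogeneous k) (n : ℤ) :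
    polyProj V n p = if (k : ℤ) = n then p else 0 := by
  unfold polyProj
  split_ifs with h1 h2 h2
  · rw [MvPolynomial.homogeneousComponent_of_mem hp, if_pos (by omega)]
  · rw [MvPolynomial.homogeneousComponent_of_mem hp, if_neg (by omega)]
  · omega
  · rfl

/-- The grading of `W`-valued polynomials by degree. -/
def polyGrading (V : Type u) [AddCommGroup V] [Module ℂ V] [FiniteDimensional ℂ V]
    (W : Type w) [AddCommGroup W] [Module ℂ W] : Grading (polyPart V W) where
  proj n := TensorProduct.map (polyProj V n) LinearMap.id
  proj_mem n m := by
    induction m with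
    | zero => rw [map_zero]; exact Submodule.zero_mem _
    | add a b ha hb => rw [map_add]; exact Submodule.add_mem _ ha hb
    | tmul p x =>
      rw [TensorProduct.map_tmul, LinearMap.id_apply, polyProj]
      split_ifs with h
      · have := tmul_mem_polyPart
          (MvPolynomial.homogeneousComponent_isHomogeneous n.toNat p) x
        rwa [Int.toNat_of_nonneg h] at this
      · rw [LinearMap.zero_apply, TensorProduct.zero_tmul]
        exact Submodule.zero_mem _
  proj_self n m hm := by
    revert m
    change polyPart V W n ≤ LinearMap.eqLocus (TensorProduct.map (polyProj V n) LinearMap.id)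
      LinearMap.id
    refine polyPart_le fun k p x hk hp => ?_
    change TensorProduct.map (polyProj V n) LinearMap.id (p ⊗ₜ x) = p ⊗ₜ x
    rw [TensorProduct.map_tmul, polyProj_homogeneous hp, if_pos hk, LinearMap.id_apply]
  proj_ne n k m hm hk := by
    revert m
    change polyPart V W k ≤ LinearMap.ker (TensorProduct.map (polyProj V n) LinearMap.id)
    refine polyPart_le fun j p x hj hp => ?_
    rw [LinearMap.mem_ker, TensorProduct.map_tmul, polyProj_homogeneous hp, if_neg (by omega),
      TensorProduct.zero_tmul]
  iSup_eq_top := by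
    rw [eq_top_iff]
    rintro m -
    induction m with
    | zero => exact Submodule.zero_mem _
    | add a b ha hb => exact Submodule.add_mem _ ha hb
    | tmul p x =>
      rw [← MvPolynomial.sum_homogeneousComponent p, TensorProduct.sum_tmul]
      refine Submodule.sum_mem _ fun k _ => ?_
      exact Submodule.mem_iSup_of_mem (k : ℤ)
        (tmul_mem_polyPart (MvPolynomial.homogeneousComponent_isHomogeneous k p) x)

instance finite_polyPart [FiniteDimensional ℂ W] (n : ℤ) : FiniteDimensional ℂ (polyPart V W n) := by
  have h : FiniteDimensional ℂ (MvPolynomial.homogeneousSubmodule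
      (Fin (Module.finrank ℂ V)) ℂ n.toNat) :=
    Module.Finite.iff_fg.2 (MvPolynomial.homogeneousSubmodule_fg _ _ n.toNat)
  have : polyPart V W n ≤ LinearMap.range (TensorProduct.map
      (MvPolynomial.homogeneousSubmodule (Fin (Module.finrank ℂ V)) ℂ n.toNat).subtype
      (LinearMap.id : W →ₗ[ℂ] W)) := by
    refine polyPart_le fun k p x hk hp => ?_
    obtain rfl : k = n.toNat := by omega
    exact ⟨(⟨p, hp⟩ : MvPolynomial.homogeneousSubmodule _ ℂ n.toNat) ⊗ₜ x, rfl⟩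
  exact Submodule.finiteDimensional_of_le this

theorem polyMul_mem {j : ℕ} {q : Poly V} (hq : q.IsHomogeneous j) {n : ℤ} {m : Poly V ⊗[ℂ] W}
    (hm : m ∈ polyPart V W n) : polyMul W q m ∈ polyPart V W (n + j) := by
  revert m
  change polyPart V W n ≤ (polyPart V W (n + j)).comap (polyMul W q)
  refine polyPart_le fun k p x hk hp => ?_
  have := tmul_mem_polyPart (hq.mul hp) x
  rw [Submodule.mem_comap, polyMul_tmul]
  convert this using 2
  push_cast
  omega

theorem valRep_mem (a : D.G) {n : ℤ} {m : Poly V ⊗[ℂ] W} (hm : m ∈ polyPart V W n) :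
    valRep D τ a m ∈ polyPart V W n := by
  revert m
  change polyPart V W n ≤ (polyPart V W n).comap (valRep D τ a)
  refine polyPart_le fun k p x hk hp => ?_
  subst hk
  exact tmul_mem_polyPart (polyRep_homogeneous D a hp) _

/-- Induction through the commutation with linear forms, which avoids homogeneity of divided
differences. Constants are killed, so the part of degree $-1$ causes no trouble. -/
theorem dunkl_mem_nat (y : V) (k : ℕ) : ∀ m ∈ polyPart V W k,
    dunkl D τ y m ∈ polyPart V W (k - 1 : ℤ) := by
  induction k with
  | zero =>
    change polyPart V W (0 : ℕ) ≤ (polyPart V W _).comap (dunkl D τ y)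
    refine polyPart_le fun j p x hj hp => ?_
    obtain rfl : j = 0 := by omega
    have h1 : p = p.coeff 0 • 1 := by
      rw [MvPolynomial.smul_eq_C_mul, mul_one]
      exact MvPolynomial.totalDegree_eq_zero_iff_eq_C.1
        (by have := hp.totalDegree_le; omega)
    rw [h1, ← TensorProduct.smul_tmul', Submodule.mem_comap, map_smul, dunkl_one, smul_zero]
    exact Submodule.zero_mem _
  | succ k ih =>
    change polyPart V W ((k + 1 : ℕ) : ℤ) ≤ (polyPart V W _).comap (dunkl D τ y)
    refine polyPart_le fun j p x hj hp => ?_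
    obtain rfl : j = k + 1 := by omega
    refine homogeneous_induction
      (Q := ((polyPart V W _).comap (dunkl D τ y)).comap ((TensorProduct.mk ℂ (Poly V) W).flip x))
      (fun f p hp => ?_) hp
    change dunkl D τ y (polyMul W (lin f) (p ⊗ₜ x)) ∈ polyPart V W (((k + 1 : ℕ) : ℤ) - 1)
    rw [dunkl_lin]
    have h1 := tmul_mem_polyPart hp x
    have h2 := polyMul_mem (lin_mem f) (ih _ h1)
    have h3 : ((k + 1 : ℕ) : ℤ) - 1 = k := by push_cast; ring
    rw [h3]
    refine Submodule.add_mem _ ?_ ?_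
    · simpa using h2
    · rw [commOp_apply]
      refine Submodule.sub_mem _ (Submodule.smul_mem _ _ h1) (Submodule.sum_mem _ fun s _ => ?_)
      exact Submodule.smul_mem _ _ (valRep_mem D τ s.1 h1)

theorem dunkl_mem (y : V) {n : ℤ} {m : Poly V ⊗[ℂ] W} (hm : m ∈ polyPart V W n) :
    dunkl D τ y m ∈ polyPart V W (n - 1) := by
  rcases lt_or_ge n 0 with hn | hn
  · rw [polyPart_neg hn, Submodule.mem_bot] at hm
    rw [hm, map_zero]
    exact Submodule.zero_mem _
  · obtain ⟨k, rfl⟩ := Int.eq_ofNat_of_zero_le hn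
    exact dunkl_mem_nat D τ y k m hm

theorem genOp_mem (a : Gen D) {n : ℤ} {m : Poly V ⊗[ℂ] W} (hm : m ∈ polyPart V W n) :
    genOp D τ a m ∈ polyPart V W (n + a.deg) := by
  cases a with
  | y v => exact dunkl_mem D τ v hm
  | x f => exact polyMul_mem (lin_mem f) hm
  | g a => rw [Gen.deg, add_zero]; exact valRep_mem D τ a hm

/-! ### The grading of the standard module -/

theorem one_mem_degPart : (1 : RCA D) ∈ degPart D 0 :=
  Submodule.subset_span ⟨[], by simp, by simp⟩

theorem gen_mul_mem_degPart (a : Gen D) {n : ℤ} {h : RCA D} (hh : h ∈ degPart D n) :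
    gen D a * h ∈ degPart D (n + a.deg) := by
  induction hh using Submodule.span_induction with
  | zero => rw [mul_zero]; exact Submodule.zero_mem _
  | add x y _ _ hx hy => rw [mul_add]; exact Submodule.add_mem _ hx hy
  | smul r x _ hx => rw [mul_smul_comm]; exact Submodule.smul_mem _ r hx
  | mem x hx =>
    obtain ⟨l, hl, rfl⟩ := hx
    exact Submodule.subset_span ⟨a :: l, by simp [hl, add_comm], by simp⟩

theorem gen_smul_mem_vermaPart (a : Gen D) {n : ℤ} {m : Verma D τ} (hm : m ∈ vermaPart D τ n) :
    gen D a • m ∈ vermaPart D τ (n + a.deg) := by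
  induction hm using Submodule.span_induction with
  | zero => rw [smul_zero]; exact Submodule.zero_mem _
  | add x y _ _ hx hy => rw [smul_add]; exact Submodule.add_mem _ hx hy
  | smul r x _ hx => rw [smul_comm]; exact Submodule.smul_mem _ r hx
  | mem x hx =>
    obtain ⟨h, hh, v, rfl⟩ := hx
    exact Submodule.subset_span ⟨gen D a * h, gen_mul_mem_degPart D a hh, v, rfl⟩

theorem vermaOne_mem (v : W) : vermaOne D τ v ∈ vermaPart D τ 0 :=
  Submodule.subset_span ⟨1, one_mem_degPart D, v, rfl⟩

theorem ofModel_mem_nat (k : ℕ) : ∀ (p : Poly V) (x : W), p.IsHomogeneous k →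
    ofModel D τ (p ⊗ₜ x) ∈ vermaPart D τ k := by
  induction k with
  | zero =>
    intro p x hp
    have h1 : p = p.coeff 0 • 1 := by
      rw [MvPolynomial.smul_eq_C_mul, mul_one]
      exact MvPolynomial.totalDegree_eq_zero_iff_eq_C.1
        (by have := hp.totalDegree_le; omega)
    rw [h1, ← TensorProduct.smul_tmul', map_smul, ofModel_one]
    exact Submodule.smul_mem _ _ (vermaOne_mem D τ x)
  | succ k ih =>
    intro p x hp
    refine homogeneous_induction
      (Q := ((vermaPart D τ _).comap (ofModel D τ)).comap ((TensorProduct.mk ℂ (Poly V) W).flip x))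
      (fun f p hp => ?_) hp
    change ofModel D τ (polyMul W (lin f) (p ⊗ₜ x)) ∈ vermaPart D τ ((k + 1 : ℕ) : ℤ)
    have h := gen_smul_mem_vermaPart D τ (.x f) (ih p x hp)
    have h2 : (k : ℤ) + (Gen.x f : Gen D).deg = ((k + 1 : ℕ) : ℤ) := by simp [Gen.deg]
    rwa [ofModel_polyMul, polyHom_lin, ← h2]

/-- The degree parts of $M(\tau)$ are spans of words in the generators, and nothing in that shows
their sum to be direct. Matching them with polynomial degree provides directness, finite dimension
and vanishing in negative degrees. -/
theorem vermaPart_eq (n : ℤ) :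
    vermaPart D τ n = (polyPart V W n).map (modelEquiv D τ).toLinearMap := by
  refine le_antisymm (Submodule.span_le.2 ?_) (Submodule.map_le_iff_le_comap.2 ?_)
  · rintro _ ⟨h, hh, v, rfl⟩
    change _ ∈ (polyPart V W n).map (ofModel D τ)
    rw [mk_tmul]
    induction hh using Submodule.span_induction with
    | zero => rw [zero_smul]; exact Submodule.zero_mem _
    | add x y _ _ hx hy => rw [add_smul]; exact Submodule.add_mem _ hx hy
    | smul r x _ hx => rw [smul_assoc]; exact Submodule.smul_mem _ r hx
    | mem x hx =>
      obtain ⟨l, hl, rfl⟩ := hx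
      induction l generalizing n with
      | nil =>
        obtain rfl : 0 = n := by simpa using hl
        rw [List.map_nil, List.prod_nil, one_smul]
        exact ⟨1 ⊗ₜ v, by
          exact_mod_cast tmul_mem_polyPart (MvPolynomial.isHomogeneous_one _ ℂ) v,
          ofModel_one D τ v⟩
      | cons a l ih =>
        obtain ⟨m, hm, hm'⟩ := ih (n - a.deg) (by simp at hl; omega)
        rw [List.map_cons, List.prod_cons, mul_smul, ← hm', ← ofModel_gen]
        exact ⟨_, by simpa using genOp_mem D τ a hm, rfl⟩
  · refine polyPart_le fun k p x hk hp => ?_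
    subst hk
    exact ofModel_mem_nat D τ k p x hp

/-- The grading of the standard module. -/
def vermaGrading : Grading (vermaPart D τ) :=
  (polyGrading V W).transport (modelEquiv D τ) (vermaPart_eq D τ)

theorem vermaPart_neg {n : ℤ} (hn : n < 0) : vermaPart D τ n = ⊥ := by
  rw [vermaPart_eq, polyPart_neg hn, Submodule.map_bot]

instance finite_vermaPart [FiniteDimensional ℂ W] (n : ℤ) :
    FiniteDimensional ℂ (vermaPart D τ n) := by
  rw [vermaPart_eq]
  infer_instance

theorem vermaOne_injective : Function.Injective (vermaOne D τ) := by
  intro v v' h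
  have h1 := congrArg (toModel D τ) h
  rw [toModel_one, toModel_one] at h1
  have h2 : (1 : Poly V) ⊗ₜ[ℂ] v = (1 : Poly V) ⊗ₜ[ℂ] v' := h1
  -- Evaluation of polynomials at the origin recovers $v$ from $1\otimes v$.
  have h3 := congrArg ((TensorProduct.lid ℂ W) ∘ (TensorProduct.map
    (MvPolynomial.aeval (fun _ => (0 : ℂ)) : Poly V →ₐ[ℂ] ℂ).toLinearMap LinearMap.id)) h2
  simpa using h3

theorem vermaPart_zero : vermaPart D τ 0 = LinearMap.range (vermaOne D τ) := by
  refine le_antisymm ?_ ?_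
  · rw [vermaPart_eq, Submodule.map_le_iff_le_comap]
    refine polyPart_le fun k p x hk hp => ?_
    obtain rfl : k = 0 := by omega
    have h1 : p = p.coeff 0 • 1 := by
      rw [MvPolynomial.smul_eq_C_mul, mul_one]
      exact MvPolynomial.totalDegree_eq_zero_iff_eq_C.1
        (by have := hp.totalDegree_le; omega)
    refine ⟨p.coeff 0 • x, ?_⟩
    change _ = ofModel D τ (p ⊗ₜ x)
    rw [map_smul, ← ofModel_one, ← map_smul, TensorProduct.smul_tmul', ← h1]
  · rintro _ ⟨v, rfl⟩
    exact vermaOne_mem D τ v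

theorem tr_vermaPart [FiniteDimensional ℂ W] (g : D.G) (n : ℤ) :
    tr (gRep D (Verma D τ) g) (vermaPart D τ n) = tr (valRep D τ g) (polyPart V W n) := by
  rw [vermaPart_eq]
  refine (tr_map_injOn (fun m hm => valRep_mem D τ g hm) _ (ofModel_valRep D τ g) ?_).symm
  intro z _ hz
  exact (modelEquiv D τ).map_eq_zero_iff.1 hz

theorem tr_vermaPart_zero [FiniteDimensional ℂ W] (g : D.G) :
    tr (gRep D (Verma D τ) g) (vermaPart D τ 0) = τ.character g := by
  have h : vermaPart D τ 0 = (⊤ : Submodule ℂ W).map (vermaOne D τ) := by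
    rw [vermaPart_zero, Submodule.map_top]
  rw [h, ← tr_map_injOn (f := τ g) le_top (vermaOne D τ)
    (fun v => (gen_g_vermaOne D τ g v).symm)
    (fun v _ hv => vermaOne_injective D τ (by rw [hv, map_zero])), tr_eq le_top]
  exact LinearMap.trace_conj' ((τ g).restrict (p := ⊤) (q := ⊤) fun _ _ => trivial)
    (Submodule.topEquiv (R := ℂ) (M := W)) |>.symm

end ModelGrading

/-! ### The Euler operator and Schur's lemma. -/

section Euler

variable {V : Type u} [AddCommGroup V] [Module ℂ V] [FiniteDimensional ℂ V] (D : Datum V)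
  (X : Type v) [AddCommGroup X] [Module ℂ X] [Module (RCA D) X] [IsScalarTower ℂ (RCA D) X]

theorem sum_coord_smul (f : Module.Dual ℂ V) :
    ∑ j, f (Module.finBasis ℂ V j) • (Module.finBasis ℂ V).coord j = f :=
  (Module.finBasis ℂ V).ext fun i => by simp

theorem sum_coord_apply_smul (y : V) :
    ∑ j, (Module.finBasis ℂ V).coord j y • Module.finBasis ℂ V j = y :=
  (Module.finBasis ℂ V).sum_repr y

/-- The operators by which `V^*` acts. -/
def xAct : Module.Dual ℂ V →ₗ[ℂ] Module.End ℂ X :=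
  (Algebra.lsmul ℂ ℂ X : RCA D →ₐ[ℂ] Module.End ℂ X).toLinearMap ∘ₗ xHom D

/-- The operators by which `V` acts. -/
def yAct : V →ₗ[ℂ] Module.End ℂ X :=
  (Algebra.lsmul ℂ ℂ X : RCA D →ₐ[ℂ] Module.End ℂ X).toLinearMap ∘ₗ yHom D

/-- The Euler operator on a module. -/
def euler : Module.End ℂ X :=
  ∑ j, xAct D X ((Module.finBasis ℂ V).coord j) ∘ₗ yAct D X (Module.finBasis ℂ V j) +
    ∑ s : Refl D, eulerCoeff D s • gRep D X s.1

variable {X}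

theorem xAct_apply (f : Module.Dual ℂ V) (m : X) : xAct D X f m = gen D (.x f) • m := rfl

theorem yAct_apply (y : V) (m : X) : yAct D X y m = gen D (.y y) • m := rfl

theorem yAct_xAct (y : V) (f : Module.Dual ℂ V) (m : X) :
    yAct D X y (xAct D X f m) = xAct D X f (yAct D X y m) + commOp D (gRep D X) y f m :=
  gen_y_x_smul D y f m

theorem xAct_xAct (f f' : Module.Dual ℂ V) (m : X) :
    xAct D X f (xAct D X f' m) = xAct D X f' (xAct D X f m) := by
  simp only [xAct_apply, ← mul_smul, gen_x_comm D f f']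

theorem yAct_yAct (y y' : V) (m : X) :
    yAct D X y (yAct D X y' m) = yAct D X y' (yAct D X y m) := by
  simp only [yAct_apply, ← mul_smul, gen_y_comm D y y']

theorem gRep_xAct (a : D.G) (f : Module.Dual ℂ V) (m : X) :
    gRep D X a (xAct D X f m) = xAct D X (dualRep D a f) (gRep D X a m) := gRep_x D X a f m

theorem euler_apply (m : X) : euler D X m =
    ∑ j, xAct D X ((Module.finBasis ℂ V).coord j) (yAct D X (Module.finBasis ℂ V j) m) +
      ∑ s : Refl D, eulerCoeff D s • gRep D X s.1 m := by
  simp [euler, LinearMap.sum_apply]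

theorem eulerCoeff_mul (s : Refl D) : eulerCoeff D s * (nu D s / 2) = D.c s := by
  have := nu_ne_zero D s
  unfold eulerCoeff
  field_simp

/-- Commuting $\sum_jx_jy_j$ past $x$ produces $tx$ minus $\sum_sc(s)x(\alpha_s^\vee)\alpha_ss$.
Moving $x$ past the reflections in $\Omega$ produces the same sum with the opposite sign; this
cancellation dictates the coefficients $2c(s)/\nu_s$. -/
theorem euler_xAct (f : Module.Dual ℂ V) (m : X) :
    euler D X (xAct D X f m) = xAct D X f (euler D X m) + D.t • xAct D X f m := by
  have h1 : ∑ j, xAct D X ((Module.finBasis ℂ V).coord j)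
      (commOp D (gRep D X) (Module.finBasis ℂ V j) f m) = D.t • xAct D X f m -
        ∑ s : Refl D, (D.c s * f (D.αv s)) • xAct D X (D.α s) (gRep D X s.1 m) := by
    simp only [commOp_apply, map_sub, map_smul, map_sum, Finset.sum_sub_distrib]
    congr 1
    · conv_rhs => rw [← sum_coord_smul f, map_sum, LinearMap.sum_apply, Finset.smul_sum]
      simp_rw [map_smul, LinearMap.smul_apply, smul_smul]
    · rw [Finset.sum_comm]
      refine Finset.sum_congr rfl fun s _ => ?_
      conv_rhs => rw [← sum_coord_smul (D.α s), map_sum, LinearMap.sum_apply, Finset.smul_sum]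
      refine Finset.sum_congr rfl fun j _ => ?_
      rw [map_smul, LinearMap.smul_apply, smul_smul]
      congr 1
      ring
  have h2 : ∑ s : Refl D, eulerCoeff D s • gRep D X s.1 (xAct D X f m) =
      ∑ s : Refl D, eulerCoeff D s • xAct D X f (gRep D X s.1 m) +
        ∑ s : Refl D, (D.c s * f (D.αv s)) • xAct D X (D.α s) (gRep D X s.1 m) := by
    rw [← Finset.sum_add_distrib]
    refine Finset.sum_congr rfl fun s _ => ?_
    rw [gRep_xAct, refl_x, map_add, LinearMap.add_apply, smul_add, map_smul, LinearMap.smul_apply,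
      smul_smul, ← mul_assoc, eulerCoeff_mul]
  rw [euler_apply, euler_apply, h2, map_add, map_sum, map_sum]
  simp only [yAct_xAct, map_add, Finset.sum_add_distrib, h1, map_smul]
  rw [Finset.sum_congr rfl fun j _ => xAct_xAct D _ f _]
  abel

variable (X) in
theorem euler_map {Y : Type*} [AddCommGroup Y] [Module ℂ Y] [Module (RCA D) Y]
    [IsScalarTower ℂ (RCA D) Y] (T : X →ₗ[RCA D] Y) (m : X) :
    T (euler D X m) = euler D Y (T m) := by
  have h : ∀ (r : ℂ) (m : X), T (r • m) = r • T m := fun r m => by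
    rw [← algebraMap_smul (RCA D) r m, map_smul, algebraMap_smul]
  rw [euler_apply, euler_apply, map_add, map_sum, map_sum]
  congr 1
  · refine Finset.sum_congr rfl fun j _ => ?_
    rw [xAct_apply, yAct_apply, map_smul, map_smul]
    rfl
  · refine Finset.sum_congr rfl fun s _ => ?_
    rw [h]
    congr 1
    exact map_smul T (gen D (.g s.1)) m

theorem euler_smul_classOp {W : Type w} [AddCommGroup W] [Module ℂ W]
    (τ : Representation ℂ D.G W) (v : W) :
    euler D (Verma D τ) (vermaOne D τ v) = vermaOne D τ (classOp τ (eulerFun D) v) := by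
  rw [euler_apply]
  have h1 : ∀ j, yAct D (Verma D τ) (Module.finBasis ℂ V j) (vermaOne D τ v) = 0 :=
    fun j => gen_y_vermaOne D τ _ v
  simp only [h1, map_zero, Finset.sum_const_zero, zero_add]
  have h2 := sum_refl_eq D fun g => gRep D (Verma D τ) g (vermaOne D τ v)
  rw [h2, classOp, LinearMap.sum_apply, map_sum]
  refine Finset.sum_congr rfl fun g _ => ?_
  rw [LinearMap.smul_apply, map_smul]
  congr 1
  exact gen_g_vermaOne D τ g v

/-- The vectors of $V$ kill the lowest weight space, so only $\Omega$ contributes there, with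
eigenvalue $r$. Each multiplication by a linear form raises the eigenvalue by $t$. -/
theorem euler_vermaPart {W : Type w} [AddCommGroup W] [Module ℂ W]
    (τ : Representation ℂ D.G W) {r : ℂ} (hr : ∀ v, classOp τ (eulerFun D) v = r • v)
    {n : ℤ} {m : Verma D τ} (hm : m ∈ vermaPart D τ n) :
    euler D (Verma D τ) m = (D.t * n + r) • m := by
  have key : ∀ (k : ℕ) (p : Poly V) (x : W), p.IsHomogeneous k →
      euler D (Verma D τ) (ofModel D τ (p ⊗ₜ x)) = (D.t * k + r) • ofModel D τ (p ⊗ₜ x) := by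
    intro k
    induction k with
    | zero =>
      intro p x hp
      have h1 : p = p.coeff 0 • 1 := by
        rw [MvPolynomial.smul_eq_C_mul, mul_one]
        exact MvPolynomial.totalDegree_eq_zero_iff_eq_C.1
          (by have := hp.totalDegree_le; omega)
      rw [h1, ← TensorProduct.smul_tmul', map_smul, map_smul, ofModel_one, euler_smul_classOp, hr,
        map_smul, Nat.cast_zero, mul_zero, zero_add, smul_comm]
    | succ k ih =>
      intro p x hp
      let L : Poly V →ₗ[ℂ] Verma D τ :=
        (euler D (Verma D τ) - (D.t * (k + 1 : ℕ) + r) • LinearMap.id) ∘ₗ ofModel D τ ∘ₗ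
          (TensorProduct.mk ℂ (Poly V) W).flip x
      have hL : p ∈ LinearMap.ker L := by
        refine homogeneous_induction (fun f q hq => ?_) hp
        rw [LinearMap.mem_ker]
        change euler D (Verma D τ) (ofModel D τ (polyMul W (lin f) (q ⊗ₜ x))) -
          (D.t * (k + 1 : ℕ) + r) • ofModel D τ (polyMul W (lin f) (q ⊗ₜ x)) = 0
        rw [ofModel_polyMul, polyHom_lin, ← xAct_apply, euler_xAct, ih q x hq, map_smul,
          ← add_smul, ← sub_smul]
        have : D.t * (k : ℂ) + r + D.t - (D.t * ((k + 1 : ℕ) : ℂ) + r) = 0 := by push_cast; ring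
        rw [this, zero_smul]
      exact sub_eq_zero.1 hL
  rw [vermaPart_eq] at hm
  obtain ⟨z, hz, rfl⟩ := hm
  have hle : polyPart V W n ≤ LinearMap.ker
      ((euler D (Verma D τ) - (D.t * n + r) • LinearMap.id) ∘ₗ ofModel D τ) :=
    polyPart_le fun k p x hk hp => by
      subst hk
      have h := key k p x hp
      exact sub_eq_zero.2 (by exact_mod_cast h)
  exact sub_eq_zero.1 (hle hz)

/-- Schur's lemma for class functions. -/
theorem exists_classOp_scalar {W : Type w} [AddCommGroup W] [Module ℂ W] [FiniteDimensional ℂ W]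
    (τ : Representation ℂ D.G W) (hτ : τ.IsIrreducible) :
    ∃ r : ℂ, ∀ v, classOp τ (eulerFun D) v = r • v := by
  let T : Representation.IntertwiningMap τ τ :=
    ⟨classOp τ (eulerFun D), fun g => LinearMap.ext fun v =>
      classOp_comm τ (eulerFun_conj D) g v⟩
  obtain ⟨r, hr⟩ := Representation.IsIrreducible.algebraMap_intertwiningMap_bijective_of_isAlgClosed
    (ρ := τ) |>.2 T
  refine ⟨r, fun v => ?_⟩
  have h := congrArg (fun S : Representation.IntertwiningMap τ τ => S v) hr
  exact h.symm

/-! ### The square of the Dirac operator -/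

/-- A reflection changes each factor of a form by a multiple of $\alpha_s$, and terms with two such
factors vanish since $\alpha_s\wedge\alpha_s=0$. Thus $s$ is affine in
$\alpha_s\wedge\partial_{\alpha_s^\vee}$, which is how the group action appears in $D^2$. -/
theorem spinRep_refl (s : Refl D) (ω : Spin V) :
    spinRep D s.1 ω = ω + (nu D s / 2) •
      (ExteriorAlgebra.ι ℂ (D.α s) * partialY (D.αv s) ω) := by
  induction ω using CliffordAlgebra.left_induction with
  | algebraMap r =>
    have h1 : partialY (D.αv s) (algebraMap ℂ (Spin V) r) = 0 :=
      CliffordAlgebra.contractLeft_algebraMap _ _ r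
    have h2 : spinRep D s.1 (algebraMap ℂ (Spin V) r) = algebraMap ℂ (Spin V) r :=
      AlgHom.commutes (ExteriorAlgebra.map (dualRep D s.1)) r
    erw [h2, h1, mul_zero, smul_zero, add_zero]
  | add p q hp hq =>
    rw [map_add, hp, hq, map_add, mul_add, smul_add]
    abel
  | ι_mul p x hp =>
    change spinRep D s.1 (ExteriorAlgebra.ι ℂ x * p) = ExteriorAlgebra.ι ℂ x * p + (nu D s / 2) •
      (ExteriorAlgebra.ι ℂ (D.α s) * partialY (D.αv s) (ExteriorAlgebra.ι ℂ x * p))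
    have h1 : ExteriorAlgebra.ι ℂ (D.α s) * (ExteriorAlgebra.ι ℂ (D.α s) *
        partialY (D.αv s) p) = 0 := by
      rw [← mul_assoc, ExteriorAlgebra.ι_sq_zero, zero_mul]
    have h2 : ExteriorAlgebra.ι ℂ (D.α s) * (ExteriorAlgebra.ι ℂ x * partialY (D.αv s) p) =
        - (ExteriorAlgebra.ι ℂ x * (ExteriorAlgebra.ι ℂ (D.α s) * partialY (D.αv s) p)) := by
      rw [← mul_assoc, ← mul_assoc, ← neg_mul]
      congr 1
      exact eq_neg_of_add_eq_zero_left (ExteriorAlgebra.ι_add_mul_swap _ _)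
    rw [spinRep_mul, hp, refl_x, map_add, map_smul, partialY_mul]
    simp only [add_mul, mul_add, mul_sub, smul_mul_assoc, mul_smul_comm, h1, h2, smul_zero,
      add_zero, smul_sub, smul_neg, smul_smul]
    abel

omit [FiniteDimensional ℂ V] in
theorem partialY_swap (y y' : V) (ω : Spin V) :
    partialY y (partialY y' ω) = - partialY y' (partialY y ω) := by
  have h := partialY_partialY (y + y') ω
  rw [partialY_add, partialY_add, map_add, map_add, partialY_partialY, partialY_partialY, zero_add,
    add_zero] at h
  exact eq_neg_of_add_eq_zero_left h

/-- `partialY` as a linear map of `y`. -/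
def partialLin (V : Type u) [AddCommGroup V] [Module ℂ V] : V →ₗ[ℂ] Module.End ℂ (Spin V) where
  toFun := partialY
  map_add' y y' := LinearMap.ext fun ω => partialY_add y y' ω
  map_smul' r y := LinearMap.ext fun ω => partialY_smul r y ω

/-- The degree operator on the spin module. -/
def spinDeg (V : Type u) [AddCommGroup V] [Module ℂ V] [FiniteDimensional ℂ V] :
    Module.End ℂ (Spin V) :=
  ∑ j, LinearMap.mulLeft ℂ (ExteriorAlgebra.ι ℂ ((Module.finBasis ℂ V).coord j)) ∘ₗ
    partialY (Module.finBasis ℂ V j)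

theorem spinDeg_apply (ω : Spin V) : spinDeg V ω =
    ∑ j, ExteriorAlgebra.ι ℂ ((Module.finBasis ℂ V).coord j) *
      partialY (Module.finBasis ℂ V j) ω := by
  simp [spinDeg, LinearMap.sum_apply]

theorem spinDeg_ι_mul (x : Module.Dual ℂ V) (ω : Spin V) :
    spinDeg V (ExteriorAlgebra.ι ℂ x * ω) =
      ExteriorAlgebra.ι ℂ x * ω + ExteriorAlgebra.ι ℂ x * spinDeg V ω := by
  have h : ∀ j, ExteriorAlgebra.ι ℂ ((Module.finBasis ℂ V).coord j) *
      partialY (Module.finBasis ℂ V j) (ExteriorAlgebra.ι ℂ x * ω) =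
        ExteriorAlgebra.ι ℂ (x (Module.finBasis ℂ V j) • (Module.finBasis ℂ V).coord j) * ω +
          ExteriorAlgebra.ι ℂ x * (ExteriorAlgebra.ι ℂ ((Module.finBasis ℂ V).coord j) *
            partialY (Module.finBasis ℂ V j) ω) := by
    intro j
    rw [partialY_mul, mul_sub, map_smul, smul_mul_assoc, mul_smul_comm, sub_eq_add_neg,
      ← mul_assoc, ← mul_assoc (ExteriorAlgebra.ι ℂ x), ← neg_mul]
    congr 2
    exact (eq_neg_of_add_eq_zero_left (ExteriorAlgebra.ι_add_mul_swap _ _)).symm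
  rw [spinDeg_apply, spinDeg_apply, Finset.sum_congr rfl fun j _ => h j, Finset.sum_add_distrib,
    ← Finset.sum_mul, ← map_sum, sum_coord_smul, Finset.mul_sum]

theorem spinDeg_mem {l : ℕ} {ω : Spin V} (hω : ω ∈ ⋀[ℂ]^l (Module.Dual ℂ V)) :
    spinDeg V ω = (l : ℂ) • ω := by
  induction hω using Submodule.pow_induction_on_left' with
  | algebraMap r =>
    have h1 : ∀ z : V, partialY z (algebraMap ℂ (Spin V) r) = 0 := fun z =>
      CliffordAlgebra.contractLeft_algebraMap _ _ r
    simp only [spinDeg_apply, h1, mul_zero, Finset.sum_const_zero, Nat.cast_zero, zero_smul]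
  | add x y i hx hy ihx ihy => rw [map_add, ihx, ihy, smul_add]
  | mem_mul m hm i x hx ih =>
    obtain ⟨f, rfl⟩ := hm
    rw [spinDeg_ι_mul, ih, mul_smul_comm]
    push_cast
    module

variable (X) in
/-- The Koszul part of the Dirac operator. -/
def koszulOp : Module.End ℂ (X ⊗[ℂ] Spin V) :=
  ∑ j, TensorProduct.map (xAct D X ((Module.finBasis ℂ V).coord j))
    (partialY (Module.finBasis ℂ V j))

variable (X) in
/-- The de Rham part of the Dirac operator. -/
def deRhamOp : Module.End ℂ (X ⊗[ℂ] Spin V) :=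
  ∑ j, TensorProduct.map (yAct D X (Module.finBasis ℂ V j))
    (LinearMap.mulLeft ℂ (ExteriorAlgebra.ι ℂ ((Module.finBasis ℂ V).coord j)))

theorem diracOp_eq_sub (z : X ⊗[ℂ] Spin V) :
    diracOp D X z = (2 : ℂ) • deRhamOp D X z - koszulOp D X z := by
  induction z with
  | zero => simp
  | add a b ha hb => rw [map_add, ha, hb, map_add, map_add, smul_add]; abel
  | tmul m ω =>
    rw [diracOp_eq, deRhamOp, koszulOp]
    simp only [LinearMap.add_apply, LinearMap.sum_apply, TensorProduct.map_tmul,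
      LinearMap.neg_apply, LinearMap.smul_apply, TensorProduct.tmul_neg, TensorProduct.tmul_smul,
      Finset.sum_neg_distrib, Finset.smul_sum]
    rw [neg_add_eq_sub]
    rfl

theorem koszulOp_tmul (m : X) (ω : Spin V) : koszulOp D X (m ⊗ₜ ω) =
    ∑ j, xAct D X ((Module.finBasis ℂ V).coord j) m ⊗ₜ partialY (Module.finBasis ℂ V j) ω := by
  simp only [koszulOp, LinearMap.sum_apply, TensorProduct.map_tmul]

theorem deRhamOp_tmul (m : X) (ω : Spin V) : deRhamOp D X (m ⊗ₜ ω) =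
    ∑ j, yAct D X (Module.finBasis ℂ V j) m ⊗ₜ
      (ExteriorAlgebra.ι ℂ ((Module.finBasis ℂ V).coord j) * ω) := by
  simp only [deRhamOp, LinearMap.sum_apply, TensorProduct.map_tmul, LinearMap.mulLeft_apply]

theorem eq_zero_of_eq_neg {Z : Type*} [AddCommGroup Z] [Module ℂ Z] {a : Z} (h : a = -a) :
    a = 0 := by
  have h1 : (2 : ℂ) • a = 0 := by rw [two_smul]; exact add_eq_zero_iff_eq_neg.2 h
  exact (smul_eq_zero.1 h1).resolve_left two_ne_zero

/-- The $x_i$ commute while the $\partial_{y_i}$ anticommute, so exchanging the summation indices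
shows that the expression is its own negative. -/
theorem koszulOp_sq (z : X ⊗[ℂ] Spin V) : koszulOp D X (koszulOp D X z) = 0 := by
  induction z with
  | zero => simp
  | add a b ha hb => rw [map_add, map_add, ha, hb, add_zero]
  | tmul m ω =>
    refine eq_zero_of_eq_neg ?_
    rw [koszulOp_tmul, map_sum]
    simp only [koszulOp_tmul]
    conv_lhs => rw [Finset.sum_comm]
    rw [← Finset.sum_neg_distrib]
    refine Finset.sum_congr rfl fun i _ => ?_
    rw [← Finset.sum_neg_distrib]
    refine Finset.sum_congr rfl fun j _ => ?_
    rw [xAct_xAct, partialY_swap, TensorProduct.tmul_neg]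

theorem deRhamOp_sq (z : X ⊗[ℂ] Spin V) : deRhamOp D X (deRhamOp D X z) = 0 := by
  induction z with
  | zero => simp
  | add a b ha hb => rw [map_add, map_add, ha, hb, add_zero]
  | tmul m ω =>
    refine eq_zero_of_eq_neg ?_
    rw [deRhamOp_tmul, map_sum]
    simp only [deRhamOp_tmul]
    conv_lhs => rw [Finset.sum_comm]
    rw [← Finset.sum_neg_distrib]
    refine Finset.sum_congr rfl fun i _ => ?_
    rw [← Finset.sum_neg_distrib]
    refine Finset.sum_congr rfl fun j _ => ?_
    rw [yAct_yAct, ← TensorProduct.tmul_neg, ← mul_assoc, ← mul_assoc, ← neg_mul]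
    congr 2
    exact eq_neg_of_add_eq_zero_left (ExteriorAlgebra.ι_add_mul_swap _ _)

/-- The $t$-part of $[y_j,x_i]$ only sees $i=j$ and gives $t\deg$. The reflection part assembles to
$c(s)\,s\otimes\alpha_s\wedge\partial_{\alpha_s^\vee}$, which `spinRep_refl` rewrites as the
difference between the diagonal action of $s$ and its action on $X$ alone. -/
theorem sum_commOp_tmul (m : X) (ω : Spin V) :
    ∑ i, ∑ j, commOp D (gRep D X) (Module.finBasis ℂ V j) ((Module.finBasis ℂ V).coord i) m ⊗ₜ[ℂ]
      (ExteriorAlgebra.ι ℂ ((Module.finBasis ℂ V).coord j) * partialY (Module.finBasis ℂ V i) ω) =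
    D.t • (m ⊗ₜ[ℂ] spinDeg V ω) - (∑ s : Refl D, eulerCoeff D s • totRep D X s.1 (m ⊗ₜ[ℂ] ω) -
      ∑ s : Refl D, eulerCoeff D s • (gRep D X s.1 m ⊗ₜ[ℂ] ω)) := by
  classical
  simp only [commOp_apply, TensorProduct.sub_tmul, TensorProduct.sum_tmul, Finset.sum_sub_distrib]
  congr 1
  · rw [spinDeg_apply, TensorProduct.tmul_sum, Finset.smul_sum]
    refine Finset.sum_congr rfl fun i _ => ?_
    rw [Finset.sum_eq_single i]
    · simp [TensorProduct.smul_tmul']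
    · intro j _ hj
      have : (Module.finBasis ℂ V).coord i (Module.finBasis ℂ V j) = 0 := by
        simp [hj]
      rw [this, mul_zero, zero_smul, TensorProduct.zero_tmul]
    · simp
  · rw [← Finset.sum_sub_distrib]
    have h1 : ∀ s : Refl D, eulerCoeff D s • totRep D X s.1 (m ⊗ₜ[ℂ] ω) -
        eulerCoeff D s • (gRep D X s.1 m ⊗ₜ[ℂ] ω) = D.c s • (gRep D X s.1 m ⊗ₜ[ℂ]
          (ExteriorAlgebra.ι ℂ (D.α s) * partialY (D.αv s) ω)) := by
      intro s
      rw [Representation.tprod_apply, TensorProduct.map_tmul, spinRep_refl, TensorProduct.tmul_add,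
        smul_add, add_sub_cancel_left, TensorProduct.tmul_smul, smul_smul, eulerCoeff_mul]
    rw [Finset.sum_congr rfl fun s _ => h1 s]
    have h2 : ∀ s : Refl D, ExteriorAlgebra.ι ℂ (D.α s) * partialY (D.αv s) ω =
        ∑ i, ∑ j, (D.α s (Module.finBasis ℂ V j) * (Module.finBasis ℂ V).coord i (D.αv s)) •
          (ExteriorAlgebra.ι ℂ ((Module.finBasis ℂ V).coord j) *
            partialY (Module.finBasis ℂ V i) ω) := by
      intro s
      have h3 : partialY (D.αv s) ω = ∑ i, (Module.finBasis ℂ V).coord i (D.αv s) •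
          partialY (Module.finBasis ℂ V i) ω := by
        change partialLin V (D.αv s) ω = _
        conv_lhs => rw [← sum_coord_apply_smul (D.αv s), map_sum, LinearMap.sum_apply]
        simp_rw [map_smul, LinearMap.smul_apply]
        rfl
      conv_lhs => rw [h3, ← sum_coord_smul (D.α s), map_sum, Finset.sum_mul]
      rw [Finset.sum_comm]
      refine Finset.sum_congr rfl fun j _ => ?_
      rw [Finset.mul_sum]
      refine Finset.sum_congr rfl fun i _ => ?_
      rw [map_smul, smul_mul_smul_comm]
    simp_rw [h2, TensorProduct.tmul_sum, Finset.smul_sum]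
    conv_rhs => rw [Finset.sum_comm]
    refine Finset.sum_congr rfl fun i _ => ?_
    conv_rhs => rw [Finset.sum_comm]
    refine Finset.sum_congr rfl fun j _ => Finset.sum_congr rfl fun s _ => ?_
    rw [TensorProduct.tmul_smul, ← TensorProduct.smul_tmul', smul_smul, mul_assoc]

/-- A Cartan formula. The off-diagonal double sums cancel, leaving $\sum_jx_jy_j\otimes1$ and the
commutator terms. The reflections acting on $X$ alone complete the first sum to the Euler operator,
and the diagonal ones remain with a minus sign. -/
theorem koszulOp_deRhamOp_add (z : X ⊗[ℂ] Spin V) :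
    koszulOp D X (deRhamOp D X z) + deRhamOp D X (koszulOp D X z) =
      TensorProduct.map (euler D X) LinearMap.id z +
        D.t • TensorProduct.map LinearMap.id (spinDeg V) z -
          classOp (totRep D X) (eulerFun D) z := by
  induction z with
  | zero => simp
  | add a b ha hb =>
    simp only [map_add, smul_add]
    rw [add_add_add_comm, ha, hb]
    abel
  | tmul m ω =>
    have h1 : koszulOp D X (deRhamOp D X (m ⊗ₜ[ℂ] ω)) =
        ∑ i, xAct D X ((Module.finBasis ℂ V).coord i) (yAct D X (Module.finBasis ℂ V i) m) ⊗ₜ ω -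
          ∑ i, ∑ j, xAct D X ((Module.finBasis ℂ V).coord i)
            (yAct D X (Module.finBasis ℂ V j) m) ⊗ₜ[ℂ]
              (ExteriorAlgebra.ι ℂ ((Module.finBasis ℂ V).coord j) *
                partialY (Module.finBasis ℂ V i) ω) := by
      rw [deRhamOp_tmul, map_sum]
      simp only [koszulOp_tmul]
      rw [Finset.sum_comm, ← Finset.sum_sub_distrib]
      refine Finset.sum_congr rfl fun i _ => ?_
      simp only [partialY_mul, TensorProduct.tmul_sub, Finset.sum_sub_distrib]
      congr 1
      rw [Finset.sum_eq_single i]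
      · simp
      · intro j _ hj
        have : (Module.finBasis ℂ V).coord j (Module.finBasis ℂ V i) = 0 := by
          simp [hj.symm]
        rw [this, zero_smul, TensorProduct.tmul_zero]
      · simp
    have h2 : deRhamOp D X (koszulOp D X (m ⊗ₜ[ℂ] ω)) =
        ∑ i, ∑ j, xAct D X ((Module.finBasis ℂ V).coord i)
            (yAct D X (Module.finBasis ℂ V j) m) ⊗ₜ[ℂ]
              (ExteriorAlgebra.ι ℂ ((Module.finBasis ℂ V).coord j) *
                partialY (Module.finBasis ℂ V i) ω) +
        ∑ i, ∑ j, commOp D (gRep D X) (Module.finBasis ℂ V j)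
          ((Module.finBasis ℂ V).coord i) m ⊗ₜ[ℂ]
            (ExteriorAlgebra.ι ℂ ((Module.finBasis ℂ V).coord j) *
              partialY (Module.finBasis ℂ V i) ω) := by
      rw [koszulOp_tmul, map_sum]
      simp only [deRhamOp_tmul]
      rw [← Finset.sum_add_distrib]
      refine Finset.sum_congr rfl fun i _ => ?_
      rw [← Finset.sum_add_distrib]
      refine Finset.sum_congr rfl fun j _ => ?_
      rw [yAct_xAct, TensorProduct.add_tmul]
    have h3 := sum_refl_eq D fun g => totRep D X g (m ⊗ₜ[ℂ] ω)
    rw [h1, h2, sum_commOp_tmul, h3, TensorProduct.map_tmul, TensorProduct.map_tmul, euler_apply,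
      classOp, LinearMap.sum_apply, TensorProduct.add_tmul, TensorProduct.sum_tmul,
      TensorProduct.sum_tmul]
    simp only [LinearMap.smul_apply, LinearMap.id_apply, TensorProduct.smul_tmul']
    abel

theorem diracOp_sq (z : X ⊗[ℂ] Spin V) : diracOp D X (diracOp D X z) = (-2 : ℂ) •
    (TensorProduct.map (euler D X) LinearMap.id z +
      D.t • TensorProduct.map LinearMap.id (spinDeg V) z -
        classOp (totRep D X) (eulerFun D) z) := by
  rw [← koszulOp_deRhamOp_add, diracOp_eq_sub, diracOp_eq_sub]
  simp only [map_sub, map_smul, koszulOp_sq, deRhamOp_sq]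
  module

end Euler

/-! ### Traces on direct sums and tensor products. -/

section TraceSum

variable {A : Type*} [AddCommGroup A] [Module ℂ A]

/-- The operators `P` certify that the sum is direct: `P a` is the identity on one summand and kills
the others, so each step of the induction peels off one summand. -/
theorem tr_biSup {f : Module.End ℂ A} {Q : ℕ → Submodule ℂ A} {P : ℕ → Module.End ℂ A}
    (hself : ∀ l, ∀ z ∈ Q l, P l z = z) (hne : ∀ l k, l ≠ k → ∀ z ∈ Q k, P l z = 0)
    (hPf : ∀ l z, P l (f z) = f (P l z)) (hfin : ∀ l, FiniteDimensional ℂ (Q l))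
    (hQ : ∀ l, Q l ≤ (Q l).comap f) (s : Finset ℕ) :
    tr f (⨆ l ∈ s, Q l) = ∑ l ∈ s, tr f (Q l) := by
  classical
  induction s using Finset.induction_on with
  | empty => simp [tr_bot]
  | insert a s ha ih =>
    have hfd : FiniteDimensional ℂ (⨆ l ∈ insert a s, Q l : Submodule ℂ A) :=
      Submodule.finiteDimensional_finset_sup _ _ |> fun h => by
        rwa [Finset.sup_eq_iSup] at h
    have hst : (⨆ l ∈ insert a s, Q l) ≤ (⨆ l ∈ insert a s, Q l).comap f :=
      iSup₂_le fun l hl => (hQ l).trans (Submodule.comap_mono (le_iSup₂_of_le l hl le_rfl))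
    have hs0 : (⨆ l ∈ s, Q l) ≤ LinearMap.ker (P a) :=
      iSup₂_le fun l hl z hz => hne a l (fun h => ha (h ▸ hl)) z hz
    rw [tr_map_add hst (P a) (f' := f) (hPf a), Finset.sum_insert ha, ← ih, Finset.iSup_insert]
    have h1 : (Q a ⊔ ⨆ l ∈ s, Q l) ⊓ LinearMap.ker (P a) = ⨆ l ∈ s, Q l := by
      refine le_antisymm ?_ (le_inf le_sup_right hs0)
      rintro z ⟨hz, hz'⟩
      obtain ⟨x, hx, y, hy, rfl⟩ := Submodule.mem_sup.1 hz
      have hx0 : P a (x + y) = 0 := hz'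
      have hy0 : P a y = 0 := hs0 hy
      rw [map_add, hself a x hx, hy0, add_zero] at hx0
      rwa [hx0, zero_add]
    have h2 : (Q a ⊔ ⨆ l ∈ s, Q l).map (P a) = Q a := by
      refine le_antisymm ?_ fun z hz => ⟨z, Submodule.mem_sup_left hz, hself a z hz⟩
      rintro _ ⟨z, hz, rfl⟩
      obtain ⟨x, hx, y, hy, rfl⟩ := Submodule.mem_sup.1 hz
      have hy0 : P a y = 0 := hs0 hy
      rwa [map_add, hself a x hx, hy0, add_zero]
    rw [h1, h2, add_comm]

theorem tr_top (f : Module.End ℂ A) : tr f ⊤ = LinearMap.trace ℂ A f := by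
  rw [tr_eq (U := ⊤) (fun z _ => Submodule.mem_top)]
  exact (LinearMap.trace_conj' _ (Submodule.topEquiv : (⊤ : Submodule ℂ A) ≃ₗ[ℂ] A)).symm

theorem tr_map₂ {B : Type*} [AddCommGroup B] [Module ℂ B] {f : Module.End ℂ A}
    {f' : Module.End ℂ B} {U : Submodule ℂ A} {U' : Submodule ℂ B} [FiniteDimensional ℂ U]
    [FiniteDimensional ℂ U'] (h : U ≤ U.comap f) (h' : U' ≤ U'.comap f') :
    tr (TensorProduct.map f f') (Submodule.map₂ (TensorProduct.mk ℂ A B) U U') =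
      tr f U * tr f' U' := by
  have hinj : Function.Injective (TensorProduct.map U.subtype U'.subtype) :=
    TensorProduct.map_injective_of_flat_flat _ _ U.injective_subtype U'.injective_subtype
  have himg : (⊤ : Submodule ℂ (U ⊗[ℂ] U')).map (TensorProduct.map U.subtype U'.subtype) =
      Submodule.map₂ (TensorProduct.mk ℂ A B) U U' := by
    rw [Submodule.map_top, TensorProduct.range_map_eq_span_tmul, Submodule.map₂_eq_span_image2]
    congr 1
    ext z
    simp [Set.mem_image2]
  have h0 := tr_map_injOn (U := (⊤ : Submodule ℂ (U ⊗[ℂ] U')))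
    (f := TensorProduct.map (f.restrict h) (f'.restrict h')) (f' := TensorProduct.map f f')
    (fun _ _ => trivial) (TensorProduct.map U.subtype U'.subtype)
    (fun z => by
      induction z with
      | zero => simp
      | add a b ha hb => simp only [map_add, ha, hb]
      | tmul a b => rfl)
    (fun z _ hz => hinj (by rw [hz, map_zero]))
  rw [himg] at h0
  rw [← h0, tr_eq h, tr_eq h', ← LinearMap.trace_tensorProduct', tr_top]

end TraceSum

/-! ### Form degree and parity on the spin module. -/

section SpinGrading

variable {V : Type u} [AddCommGroup V] [Module ℂ V]

/-- The projection of the spin module to the forms of degree `l`. -/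
def spinProj (V : Type u) [AddCommGroup V] [Module ℂ V] (l : ℕ) : Module.End ℂ (Spin V) :=
  GradedAlgebra.proj (fun i : ℕ => ⋀[ℂ]^i (Module.Dual ℂ V)) l

theorem spinProj_mem (l : ℕ) (ω : Spin V) : spinProj V l ω ∈ ⋀[ℂ]^l (Module.Dual ℂ V) := by
  rw [spinProj, GradedAlgebra.proj_apply]
  exact SetLike.coe_mem _

theorem spinProj_self {l : ℕ} {ω : Spin V} (h : ω ∈ ⋀[ℂ]^l (Module.Dual ℂ V)) :
    spinProj V l ω = ω := by
  rw [spinProj, GradedAlgebra.proj_apply]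
  exact DirectSum.decompose_of_mem_same _ h

theorem spinProj_ne {l k : ℕ} (hlk : l ≠ k) {ω : Spin V} (h : ω ∈ ⋀[ℂ]^k (Module.Dual ℂ V)) :
    spinProj V l ω = 0 := by
  rw [spinProj, GradedAlgebra.proj_apply]
  exact DirectSum.decompose_of_mem_ne _ h hlk.symm

theorem spin_induction {motive : Spin V → Prop}
    (mem : ∀ l, ∀ ω ∈ ⋀[ℂ]^l (Module.Dual ℂ V), motive ω)
    (add : ∀ a b, motive a → motive b → motive (a + b)) (ω : Spin V) : motive ω :=
  DirectSum.Decomposition.inductionOn (fun i : ℕ => ⋀[ℂ]^i (Module.Dual ℂ V))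
    (mem 0 0 (Submodule.zero_mem _)) (fun {i} m => mem i m m.2) add ω

theorem partialY_zero_form {ω : Spin V} (h : ω ∈ ⋀[ℂ]^0 (Module.Dual ℂ V)) (y : V) :
    partialY y ω = 0 := by
  rw [ExteriorAlgebra.exteriorPower, pow_zero] at h
  obtain ⟨r, rfl⟩ := Submodule.mem_one.1 h
  exact CliffordAlgebra.contractLeft_algebraMap _ _ r

theorem ι_mul_mem {l : ℕ} {ω : Spin V} (h : ω ∈ ⋀[ℂ]^l (Module.Dual ℂ V)) (x : Module.Dual ℂ V) :
    ExteriorAlgebra.ι ℂ x * ω ∈ ⋀[ℂ]^(l + 1) (Module.Dual ℂ V) := by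
  rw [ExteriorAlgebra.exteriorPower, pow_succ']
  exact Submodule.mul_mem_mul ⟨x, rfl⟩ h

theorem partialY_mem {l : ℕ} {ω : Spin V} (h : ω ∈ ⋀[ℂ]^(l + 1) (Module.Dual ℂ V)) (y : V) :
    partialY y ω ∈ ⋀[ℂ]^l (Module.Dual ℂ V) := by
  induction l generalizing ω with
  | zero =>
    rw [ExteriorAlgebra.exteriorPower, zero_add, pow_one] at h
    obtain ⟨x, rfl⟩ := h
    have h1 : partialY y (1 : Spin V) = 0 := partialY_zero_form
      (by rw [ExteriorAlgebra.exteriorPower, pow_zero]; exact Submodule.one_le.1 le_rfl) y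
    have h2 := partialY_mul y x 1
    rw [mul_one, h1, mul_zero, sub_zero] at h2
    rw [h2, ExteriorAlgebra.exteriorPower, pow_zero]
    exact Submodule.smul_mem _ _ (Submodule.one_le.1 le_rfl)
  | succ l ih =>
    rw [ExteriorAlgebra.exteriorPower, pow_succ'] at h
    refine Submodule.mul_induction_on h ?_ ?_
    · rintro _ ⟨x, rfl⟩ ω hω
      rw [partialY_mul]
      exact Submodule.sub_mem _ (Submodule.smul_mem _ _ hω) (ι_mul_mem (ih hω) x)
    · intro a b ha hb
      rw [map_add]
      exact Submodule.add_mem _ ha hb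

theorem mem_spinPart {l : ℕ} {ω : Spin V} (h : ω ∈ ⋀[ℂ]^l (Module.Dual ℂ V)) :
    ω ∈ spinPart V (l : ZMod 2) :=
  (le_iSup₂_of_le (f := fun (k : ℕ) (_ : (k : ZMod 2) = l) => ⋀[ℂ]^k (Module.Dual ℂ V))
    l rfl le_rfl) h

theorem spinPart_le {ε : ZMod 2} {Q : Submodule ℂ (Spin V)}
    (h : ∀ l : ℕ, (l : ZMod 2) = ε → ∀ ω ∈ ⋀[ℂ]^l (Module.Dual ℂ V), ω ∈ Q) : spinPart V ε ≤ Q :=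
  iSup₂_le h

theorem spinProj_spinPart {ε : ZMod 2} {ω : Spin V} (h : ω ∈ spinPart V ε) (l : ℕ) :
    spinProj V l ω ∈ spinPart V ε ∧ ((l : ZMod 2) ≠ ε → spinProj V l ω = 0) := by
  have h1 : spinPart V ε ≤ (spinPart V ε).comap (spinProj V l) := spinPart_le fun k hk ω hω => by
    rw [Submodule.mem_comap]
    by_cases hlk : l = k
    · subst hlk
      rw [spinProj_self hω, ← hk]
      exact mem_spinPart hω
    · rw [spinProj_ne hlk hω]
      exact Submodule.zero_mem _
  refine ⟨h1 h, fun hl => ?_⟩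
  have h2 : spinPart V ε ≤ LinearMap.ker (spinProj V l) := spinPart_le fun k hk ω hω =>
    spinProj_ne (fun h => hl (by rw [h, hk])) hω
  exact h2 h

theorem ι_mul_spinPart {ε : ZMod 2} {ω : Spin V} (h : ω ∈ spinPart V ε) (x : Module.Dual ℂ V) :
    ExteriorAlgebra.ι ℂ x * ω ∈ spinPart V (ε + 1) := by
  have h1 : spinPart V ε ≤ (spinPart V (ε + 1)).comap
      (LinearMap.mulLeft ℂ (ExteriorAlgebra.ι ℂ x)) := spinPart_le fun k hk ω hω => by
    have := mem_spinPart (ι_mul_mem hω x)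
    rwa [Nat.cast_succ, hk] at this
  exact h1 h

theorem partialY_spinPart {ε : ZMod 2} {ω : Spin V} (h : ω ∈ spinPart V ε) (y : V) :
    partialY y ω ∈ spinPart V (ε + 1) := by
  have h1 : spinPart V ε ≤ (spinPart V (ε + 1)).comap (partialY y) := spinPart_le fun k hk ω hω => by
    rw [Submodule.mem_comap]
    cases k with
    | zero =>
      rw [partialY_zero_form hω]
      exact Submodule.zero_mem _
    | succ k =>
      have := mem_spinPart (partialY_mem hω y)
      convert this using 1
      rw [← hk]
      push_cast
      rw [add_assoc]
      have : (1 + 1 : ZMod 2) = 0 := by decide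
      rw [this, add_zero]
  exact h1 h

instance finite_exteriorPower [FiniteDimensional ℂ V] (l : ℕ) :
    FiniteDimensional ℂ (⋀[ℂ]^l (Module.Dual ℂ V)) := inferInstance

variable [FiniteDimensional ℂ V] (D : Datum V)

theorem spinRep_spinProj (g : D.G) (l : ℕ) (ω : Spin V) :
    spinProj V l (spinRep D g ω) = spinRep D g (spinProj V l ω) := by
  induction ω using spin_induction with
  | add a b ha hb => simp only [map_add, ha, hb]
  | mem k ω hω =>
    have h1 := exteriorPower_stable D g k hω
    by_cases hlk : l = k
    · subst hlk
      rw [spinProj_self hω]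
      exact spinProj_self h1
    · rw [spinProj_ne hlk hω, map_zero]
      exact spinProj_ne hlk h1

end SpinGrading

/-! ### The index theorem for modules with an Euler grading. -/

section Index

variable {V : Type u} [AddCommGroup V] [Module ℂ V] [FiniteDimensional ℂ V] (D : Datum V)
  {X : Type v} [AddCommGroup X] [Module ℂ X] [Module (RCA D) X] [IsScalarTower ℂ (RCA D) X]

/-- A graded module with finite-dimensional pieces in non-negative degrees on which the Euler
operator acts by an affine function of the degree. -/
structure EulerGraded (𝓧 : RepGrading (gRep D X)) where
  grading : Grading 𝓧.part
  gen_mem : ∀ (a : Gen D) (n : ℤ), ∀ m ∈ 𝓧.part n, gen D a • m ∈ 𝓧.part (n + a.deg)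
  neg : ∀ n < 0, 𝓧.part n = ⊥
  fin : ∀ n, FiniteDimensional ℂ (𝓧.part n)
  low : ℂ
  euler_eq : ∀ n, ∀ m ∈ 𝓧.part n, euler D X m = (D.t * n + low) • m

variable {D}

/-- The bigraded pieces of `X ⊗ S^*`. -/
def biPart (𝓧 : RepGrading (gRep D X)) (n : ℤ) (l : ℕ) : Submodule ℂ (X ⊗[ℂ] Spin V) :=
  Submodule.map₂ (TensorProduct.mk ℂ X (Spin V)) (𝓧.part (n - l)) (⋀[ℂ]^l (Module.Dual ℂ V))

theorem tmul_mem_totPart {𝓧 : RepGrading (gRep D X)} {n : ℤ} {l : ℕ} {m : X} {ω : Spin V}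
    (hm : m ∈ 𝓧.part (n - l)) (hω : ω ∈ ⋀[ℂ]^l (Module.Dual ℂ V)) :
    m ⊗ₜ[ℂ] ω ∈ totPart D 𝓧 n :=
  Submodule.mem_iSup_of_mem l (Submodule.apply_mem_map₂ _ hm hω)

theorem totPart_le {𝓧 : RepGrading (gRep D X)} {n : ℤ} {Q : Submodule ℂ (X ⊗[ℂ] Spin V)}
    (h : ∀ (l : ℕ), ∀ m ∈ 𝓧.part (n - l), ∀ ω ∈ ⋀[ℂ]^l (Module.Dual ℂ V), m ⊗ₜ[ℂ] ω ∈ Q) :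
    totPart D 𝓧 n ≤ Q :=
  iSup_le fun l => Submodule.map₂_le.2 fun m hm ω hω => h l m hm ω hω

omit [FiniteDimensional ℂ V] in
theorem evenOddPart_le {ε : ZMod 2} {Q : Submodule ℂ (X ⊗[ℂ] Spin V)}
    (h : ∀ (m : X), ∀ ω ∈ spinPart V ε, m ⊗ₜ[ℂ] ω ∈ Q) : evenOddPart (V := V) X ε ≤ Q :=
  Submodule.map₂_le.2 fun m _ ω hω => h m ω hω

omit [FiniteDimensional ℂ V] in
theorem tmul_mem_evenOddPart {ε : ZMod 2} (m : X) {ω : Spin V} (h : ω ∈ spinPart V ε) :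
    m ⊗ₜ[ℂ] ω ∈ evenOddPart (V := V) X ε := Submodule.apply_mem_map₂ _ trivial h

theorem diracOp_evenOddPart (ε : ZMod 2) :
    evenOddPart (V := V) X ε ≤ (evenOddPart (V := V) X (ε + 1)).comap (diracOp D X) := by
  refine evenOddPart_le fun m ω hω => ?_
  rw [Submodule.mem_comap, diracOp_eq_sub, deRhamOp_tmul, koszulOp_tmul]
  refine Submodule.sub_mem _ (Submodule.smul_mem _ _ ?_) ?_
  · exact Submodule.sum_mem _ fun j _ => tmul_mem_evenOddPart _ (ι_mul_spinPart hω _)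
  · exact Submodule.sum_mem _ fun j _ => tmul_mem_evenOddPart _ (partialY_spinPart hω _)

namespace EulerGraded

variable {𝓧 : RepGrading (gRep D X)} (𝓖 : EulerGraded D 𝓧)

include 𝓖

/-- The projection to the part of total degree `n`. -/
def totProj (n : ℤ) : Module.End ℂ (X ⊗[ℂ] Spin V) :=
  -- Form degrees $l>n$ may be left out, because they would pair with the negative degrees of $X$.
  ∑ l ∈ Finset.range (n.toNat + 1), TensorProduct.map (𝓖.grading.proj (n - l)) (spinProj V l)

theorem totProj_tmul {n k : ℤ} {j : ℕ} {m : X} {ω : Spin V}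
    (hm : m ∈ 𝓧.part (k - j)) (hω : ω ∈ ⋀[ℂ]^j (Module.Dual ℂ V)) :
    𝓖.totProj n (m ⊗ₜ[ℂ] ω) = if k = n then m ⊗ₜ[ℂ] ω else 0 := by
  rw [totProj, LinearMap.sum_apply]
  simp only [TensorProduct.map_tmul]
  rw [Finset.sum_eq_single j]
  · rw [spinProj_self hω]
    split_ifs with h
    · subst h
      rw [𝓖.grading.proj_self _ _ hm]
    · rw [𝓖.grading.proj_ne _ _ _ hm (by omega), TensorProduct.zero_tmul]
  · intro l _ hl
    rw [spinProj_ne hl hω, TensorProduct.tmul_zero]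
  · intro hj
    rw [Finset.mem_range] at hj
    rw [spinProj_self hω]
    have : 𝓖.grading.proj (n - j) m = 0 := by
      have h1 := 𝓖.grading.proj_mem (n - j) m
      rw [𝓖.neg _ (by omega)] at h1
      exact h1
    rw [this, TensorProduct.zero_tmul]

/-- The total grading of `X ⊗ S^*`. -/
def totGrading : Grading (totPart D 𝓧) where
  proj := 𝓖.totProj
  proj_mem n z := by
    rw [totProj, LinearMap.sum_apply]
    refine Submodule.sum_mem _ fun l _ => ?_
    induction z with
    | zero => rw [map_zero]; exact Submodule.zero_mem _
    | add a b ha hb => rw [map_add]; exact Submodule.add_mem _ ha hb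
    | tmul m ω => exact tmul_mem_totPart (𝓖.grading.proj_mem _ m) (spinProj_mem l ω)
  proj_self n z hz := by
    have h : totPart D 𝓧 n ≤ LinearMap.eqLocus (𝓖.totProj n) LinearMap.id :=
      totPart_le fun l m hm ω hω => by
        change 𝓖.totProj n (m ⊗ₜ ω) = m ⊗ₜ ω
        rw [𝓖.totProj_tmul hm hω, if_pos rfl]
    exact h hz
  proj_ne n k z hz hk := by
    have h : totPart D 𝓧 k ≤ LinearMap.ker (𝓖.totProj n) :=
      totPart_le fun l m hm ω hω => by
        rw [LinearMap.mem_ker, 𝓖.totProj_tmul hm hω, if_neg hk]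
    exact h hz
  iSup_eq_top := by
    rw [eq_top_iff]
    rintro z -
    induction z with
    | zero => exact Submodule.zero_mem _
    | add a b ha hb => exact Submodule.add_mem _ ha hb
    | tmul m ω =>
      induction ω using spin_induction with
      | add a b ha hb =>
        rw [TensorProduct.tmul_add]
        exact Submodule.add_mem _ ha hb
      | mem l ω hω =>
        refine 𝓖.grading.induction (motive := fun m => m ⊗ₜ[ℂ] ω ∈ ⨆ n, totPart D 𝓧 n) ?_ ?_ ?_ m
        · intro n m hm
          exact Submodule.mem_iSup_of_mem (n + l)
            (tmul_mem_totPart (by rwa [add_sub_cancel_right]) hω)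
        · rw [TensorProduct.zero_tmul]
          exact Submodule.zero_mem _
        · intro a b ha hb
          rw [TensorProduct.add_tmul]
          exact Submodule.add_mem _ ha hb

theorem totProj_evenOddPart (n : ℤ) (ε : ZMod 2) :
    evenOddPart (V := V) X ε ≤ (evenOddPart (V := V) X ε).comap (𝓖.totProj n) := by
  refine evenOddPart_le fun m ω hω => ?_
  rw [Submodule.mem_comap, totProj, LinearMap.sum_apply]
  exact Submodule.sum_mem _ fun l _ => tmul_mem_evenOddPart _ (spinProj_spinPart hω l).1

theorem xAct_mem {n : ℤ} {m : X} (hm : m ∈ 𝓧.part n) (f : Module.Dual ℂ V) :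
    xAct D X f m ∈ 𝓧.part (n + 1) := 𝓖.gen_mem (.x f) n m hm

theorem yAct_mem {n : ℤ} {m : X} (hm : m ∈ 𝓧.part n) (y : V) :
    yAct D X y m ∈ 𝓧.part (n - 1) := 𝓖.gen_mem (.y y) n m hm

theorem diracOp_totPart (n : ℤ) : totPart D 𝓧 n ≤ (totPart D 𝓧 n).comap (diracOp D X) := by
  refine totPart_le fun l m hm ω hω => ?_
  rw [Submodule.mem_comap, diracOp_eq_sub, deRhamOp_tmul, koszulOp_tmul]
  refine Submodule.sub_mem _ (Submodule.smul_mem _ _ ?_) ?_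
  · refine Submodule.sum_mem _ fun j _ => tmul_mem_totPart (l := l + 1) ?_ (ι_mul_mem hω _)
    have := 𝓖.yAct_mem hm (Module.finBasis ℂ V j)
    convert this using 2
    push_cast
    ring
  · refine Submodule.sum_mem _ fun j _ => ?_
    cases l with
    | zero =>
      rw [partialY_zero_form hω, TensorProduct.tmul_zero]
      exact Submodule.zero_mem _
    | succ l =>
      refine tmul_mem_totPart (l := l) ?_ (partialY_mem hω _)
      have := 𝓖.xAct_mem hm ((Module.finBasis ℂ V).coord j)
      convert this using 2
      push_cast
      ring

theorem diracOp_totProj (n : ℤ) (z : X ⊗[ℂ] Spin V) :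
    diracOp D X (𝓖.totProj n z) = 𝓖.totProj n (diracOp D X z) := by
  have h := 𝓖.totGrading.map_proj 𝓖.totGrading (diracOp D X) 0
    (fun n m hm => by rw [add_zero]; exact 𝓖.diracOp_totPart n hm) n z
  rwa [add_zero] at h

/-- In form degree $l$ the Euler operator gives $t(n-l)+r$ and the form degree gives $tl$. The sum
$tn+r$ no longer depends on $l$, so $D^2$ is affine in $\Omega$ on the whole part of total degree
$n$. -/
theorem diracOp_sq_totPart {n : ℤ} {z : X ⊗[ℂ] Spin V} (hz : z ∈ totPart D 𝓧 n) :
    diracOp D X (diracOp D X z) = (2 : ℂ) •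
      (classOp (totRep D X) (eulerFun D) - algebraMap ℂ _ (D.t * n + 𝓖.low)) z := by
  have h : totPart D 𝓧 n ≤ LinearMap.ker (TensorProduct.map (euler D X) LinearMap.id +
      D.t • TensorProduct.map LinearMap.id (spinDeg V) -
        (algebraMap ℂ (Module.End ℂ (X ⊗[ℂ] Spin V)) (D.t * n + 𝓖.low))) :=
    totPart_le fun l m hm ω hω => by
      rw [LinearMap.mem_ker, LinearMap.sub_apply, LinearMap.add_apply, LinearMap.smul_apply,
        TensorProduct.map_tmul, TensorProduct.map_tmul, 𝓖.euler_eq _ m hm, spinDeg_mem hω,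
        Module.algebraMap_end_apply, LinearMap.id_apply, LinearMap.id_apply, TensorProduct.tmul_smul,
        ← TensorProduct.smul_tmul', smul_smul, ← add_smul, ← sub_smul]
      convert zero_smul ℂ (m ⊗ₜ[ℂ] ω)
      push_cast
      ring
  have h1 := sub_eq_zero.1 (h hz)
  rw [LinearMap.add_apply, LinearMap.smul_apply] at h1
  rw [diracOp_sq, h1, LinearMap.sub_apply]
  module

/-- Up to the factor $2$, $D^2$ is a central element of the group algebra minus a scalar, and such
operators have no nilpotent part. -/
theorem diracOp_semisimple {n : ℤ} {z : X ⊗[ℂ] Spin V} (hz : z ∈ totPart D 𝓧 n)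
    (h : diracOp D X (diracOp D X (diracOp D X (diracOp D X z))) = 0) :
    diracOp D X (diracOp D X z) = 0 := by
  have hz' := 𝓖.diracOp_totPart n (𝓖.diracOp_totPart n hz)
  rw [𝓖.diracOp_sq_totPart hz', 𝓖.diracOp_sq_totPart hz, map_smul, smul_smul] at h
  have h2 := (smul_eq_zero.1 h).resolve_left (by norm_num)
  rw [𝓖.diracOp_sq_totPart hz, classOp_sub_sq _ (eulerFun_conj D) _ z h2, smul_zero]

theorem classOp_of_mem_ker {n : ℤ} {z : X ⊗[ℂ] Spin V} (hz : z ∈ totPart D 𝓧 n)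
    (h : z ∈ LinearMap.ker (diracOp D X)) :
    classOp (totRep D X) (eulerFun D) z = (D.t * n + 𝓖.low) • z := by
  have h1 := 𝓖.diracOp_sq_totPart hz
  rw [LinearMap.mem_ker.1 h, map_zero] at h1
  have h2 := (smul_eq_zero.1 h1.symm).resolve_left two_ne_zero
  rwa [LinearMap.sub_apply, Module.algebraMap_end_apply, sub_eq_zero] at h2

theorem biPart_eq_bot {n : ℤ} {l : ℕ} (h : n < l) : biPart 𝓧 n l = ⊥ := by
  rw [biPart, 𝓖.neg _ (by omega), Submodule.map₂_bot_left]

/-- The projection to the part of form degree `l`. -/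
def formProj (V : Type u) [AddCommGroup V] [Module ℂ V] (X : Type v) [AddCommGroup X] [Module ℂ X]
    (l : ℕ) : Module.End ℂ (X ⊗[ℂ] Spin V) :=
  TensorProduct.map LinearMap.id (spinProj V l)

omit 𝓖 in
theorem formProj_self {n : ℤ} {l : ℕ} {z : X ⊗[ℂ] Spin V} (hz : z ∈ biPart 𝓧 n l) :
    formProj V X l z = z := by
  have h : biPart 𝓧 n l ≤ LinearMap.eqLocus (formProj V X l) LinearMap.id :=
    Submodule.map₂_le.2 fun m _ ω hω => by
      change m ⊗ₜ[ℂ] spinProj V l ω = m ⊗ₜ ω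
      rw [spinProj_self hω]
  exact h hz

omit 𝓖 in
theorem formProj_ne {n : ℤ} {l k : ℕ} (hlk : l ≠ k) {z : X ⊗[ℂ] Spin V} (hz : z ∈ biPart 𝓧 n k) :
    formProj V X l z = 0 := by
  have h : biPart 𝓧 n k ≤ LinearMap.ker (formProj V X l) :=
    Submodule.map₂_le.2 fun m _ ω hω => by
      change m ⊗ₜ[ℂ] spinProj V l ω = 0
      rw [spinProj_ne hlk hω, TensorProduct.tmul_zero]
  exact h hz

theorem totPart_inf_evenOddPart (n : ℤ) (ε : ZMod 2) :
    totPart D 𝓧 n ⊓ evenOddPart (V := V) X ε =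
      ⨆ l ∈ (Finset.range (n.toNat + 1)).filter (fun l : ℕ => (l : ZMod 2) = ε), biPart 𝓧 n l := by
  refine le_antisymm ?_ (iSup₂_le fun l hl => le_inf (le_iSup (biPart 𝓧 n) l) ?_)
  · rintro z ⟨hz, hz'⟩
    have h1 : totPart D 𝓧 n ≤ LinearMap.eqLocus
        (∑ l ∈ Finset.range (n.toNat + 1), formProj V X l) LinearMap.id := by
      refine iSup_le fun k z hz => ?_
      change (∑ l ∈ Finset.range (n.toNat + 1), formProj V X l) z = z
      by_cases hk : n < k
      · have hz : z ∈ biPart 𝓧 n k := hz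
        rw [𝓖.biPart_eq_bot hk] at hz
        rw [(Submodule.mem_bot ℂ).1 hz, map_zero]
      · rw [LinearMap.sum_apply, Finset.sum_eq_single k]
        · exact formProj_self hz
        · intro l _ hl
          exact formProj_ne hl hz
        · intro h
          rw [Finset.mem_range] at h
          omega
    have h2 : ∀ l, formProj V X l z ∈ biPart 𝓧 n l := by
      intro l
      have : totPart D 𝓧 n ≤ (biPart 𝓧 n l).comap (formProj V X l) := by
        refine iSup_le fun k z hz => ?_
        rw [Submodule.mem_comap]
        by_cases hlk : l = k
        · subst hlk
          rw [formProj_self hz]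
          exact hz
        · rw [formProj_ne hlk hz]
          exact Submodule.zero_mem _
      exact this hz
    have h3 : ∀ l : ℕ, (l : ZMod 2) ≠ ε → formProj V X l z = 0 := by
      intro l hl
      have : evenOddPart (V := V) X ε ≤ LinearMap.ker (formProj V X l) :=
        evenOddPart_le fun m ω hω => by
          change m ⊗ₜ[ℂ] spinProj V l ω = 0
          rw [(spinProj_spinPart hω l).2 hl, TensorProduct.tmul_zero]
      exact this hz'
    have h4 : (∑ l ∈ Finset.range (n.toNat + 1), formProj V X l) z = z := h1 hz
    rw [← h4, LinearMap.sum_apply]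
    refine Submodule.sum_mem _ fun l hl => ?_
    by_cases hε : (l : ZMod 2) = ε
    · exact Submodule.mem_iSup_of_mem l (Submodule.mem_iSup_of_mem
        (Finset.mem_filter.2 ⟨hl, hε⟩) (h2 l))
    · rw [h3 l hε]
      exact Submodule.zero_mem _
  · refine Submodule.map₂_le.2 fun m _ ω hω => tmul_mem_evenOddPart m ?_
    rw [← (Finset.mem_filter.1 hl).2]
    exact mem_spinPart hω

theorem finite_biPart (n : ℤ) (l : ℕ) : FiniteDimensional ℂ (biPart 𝓧 n l) := by
  have := 𝓖.fin (n - l)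
  exact Module.Finite.iff_fg.2
    (Submodule.FG.map₂ _ (Module.Finite.iff_fg.1 inferInstance) (Module.Finite.iff_fg.1 inferInstance))

theorem finite_totPart_inf (n : ℤ) (ε : ZMod 2) :
    FiniteDimensional ℂ ↥(totPart D 𝓧 n ⊓ evenOddPart (V := V) X ε) := by
  rw [𝓖.totPart_inf_evenOddPart, ← Finset.sup_eq_iSup]
  have := 𝓖.finite_biPart n
  exact Submodule.finiteDimensional_finset_sup _ _

theorem tr_biPart (g : D.G) (n : ℤ) (l : ℕ) : tr (totRep D X g) (biPart 𝓧 n l) =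
    tr (gRep D X g) (𝓧.part (n - l)) * tr (spinRep D g) (⋀[ℂ]^l (Module.Dual ℂ V)) := by
  have := 𝓖.fin (n - l)
  exact tr_map₂ (𝓧.stable _ g) (exteriorPower_stable D g l)

theorem tr_totPart_inf (g : D.G) (n : ℤ) (ε : ZMod 2) :
    tr (totRep D X g) (totPart D 𝓧 n ⊓ evenOddPart (V := V) X ε) =
      ∑ l ∈ (Finset.range (n.toNat + 1)).filter (fun l : ℕ => (l : ZMod 2) = ε),
        tr (gRep D X g) (𝓧.part (n - l)) * tr (spinRep D g) (⋀[ℂ]^l (Module.Dual ℂ V)) := by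
  rw [𝓖.totPart_inf_evenOddPart, tr_biSup (P := formProj V X) (fun l z hz => formProj_self hz)
    (fun l k h z hz => formProj_ne h hz) ?_ (𝓖.finite_biPart n) ?_]
  · exact Finset.sum_congr rfl fun l _ => 𝓖.tr_biPart g n l
  · intro l z
    induction z with
    | zero => simp only [map_zero]
    | add a b ha hb => simp only [map_add, ha, hb]
    | tmul m ω =>
      change gRep D X g m ⊗ₜ[ℂ] spinProj V l (spinRep D g ω) =
        gRep D X g m ⊗ₜ[ℂ] spinRep D g (spinProj V l ω)
      rw [spinRep_spinProj]
  · exact fun l => map₂_stable D X g _ _ (𝓧.stable _ g) (exteriorPower_stable D g l)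

/-- As $D$ preserves the total degree, a homogeneous element of the image has a homogeneous
preimage. The cohomology in degree $n$ can therefore be computed inside a finite-dimensional space.
-/
theorem totPart_inf_imPart (n : ℤ) (ε : ZMod 2) :
    totPart D 𝓧 n ⊓ kerPart D X ε ⊓ imPart D X ε =
      totPart D 𝓧 n ⊓ evenOddPart (V := V) X ε ⊓ LinearMap.ker (diracOp D X) ⊓
        (totPart D 𝓧 n ⊓ evenOddPart (V := V) X (ε + 1)).map (diracOp D X) := by
  ext z
  constructor
  · rintro ⟨⟨h1, h2, h3⟩, w, hw, rfl⟩
    refine ⟨⟨⟨h1, h2⟩, h3⟩, 𝓖.totProj n w, ⟨𝓖.totGrading.proj_mem n w,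
      𝓖.totProj_evenOddPart n _ hw⟩, ?_⟩
    rw [𝓖.diracOp_totProj]
    exact 𝓖.totGrading.proj_self n _ h1
  · rintro ⟨⟨⟨h1, h2⟩, h3⟩, w, ⟨-, hw⟩, rfl⟩
    exact ⟨⟨h1, h2, h3⟩, w, hw, rfl⟩

theorem diracCoh_character (g : D.G) (n : ℤ) (ε : ZMod 2) :
    ((diracCohGrading D 𝓧 ε).rep n).character g =
      tr (totRep D X g) (totPart D 𝓧 n ⊓ evenOddPart (V := V) X ε ⊓ LinearMap.ker (diracOp D X)) -
      tr (totRep D X g) (totPart D 𝓧 n ⊓ evenOddPart (V := V) X ε ⊓ LinearMap.ker (diracOp D X) ⊓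
        (totPart D 𝓧 n ⊓ evenOddPart (V := V) X (ε + 1)).map (diracOp D X)) := by
  set K := kerPart D X ε
  set I := (imPart D X ε).submoduleOf K
  set U := (totPart D 𝓧 n).submoduleOf K
  let f := (totRep D X).subrepresentation K (kerPart_stable D X ε) g
  have hfd := 𝓖.finite_totPart_inf n ε
  have hUfd : FiniteDimensional ℂ U := by
    refine FiniteDimensional.of_injective
      (LinearMap.restrict K.subtype (p := U) (q := totPart D 𝓧 n ⊓ evenOddPart (V := V) X ε)
        fun z hz => ⟨hz, z.2.1⟩) ?_
    intro a b h
    have h' : ((a : K) : X ⊗[ℂ] Spin V) = (b : K) :=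
      congrArg (fun z : ↥(totPart D 𝓧 n ⊓ evenOddPart (V := V) X ε) => (z : X ⊗[ℂ] Spin V)) h
    exact Subtype.ext (Subtype.ext h')
  have hU : U ≤ U.comap f := fun z hz => totPart_stable D 𝓧 n g hz
  have hI : U ⊓ I ≤ (U ⊓ I).comap f :=
    fun z hz => ⟨hU hz.1, imPart_stable D X ε g hz.2⟩
  have h1 := tr_map_add hU I.mkQ (f' := diracCohRep D X ε g) (fun z => rfl)
  rw [Submodule.ker_mkQ] at h1
  have h2 := tr_map_injOn hU K.subtype (f' := totRep D X g) (fun z => rfl)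
    (fun z _ h => Subtype.ext h)
  have h3 := tr_map_injOn hI K.subtype (f' := totRep D X g) (fun z => rfl)
    (fun z _ h => Subtype.ext h)
  have h4 : U.map K.subtype =
      totPart D 𝓧 n ⊓ evenOddPart (V := V) X ε ⊓ LinearMap.ker (diracOp D X) := by
    change ((totPart D 𝓧 n).comap K.subtype).map K.subtype = _
    rw [Submodule.map_comap_subtype, inf_comm, inf_assoc]
    rfl
  have h5 : (U ⊓ I).map K.subtype = totPart D 𝓧 n ⊓ evenOddPart (V := V) X ε ⊓
      LinearMap.ker (diracOp D X) ⊓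
        (totPart D 𝓧 n ⊓ evenOddPart (V := V) X (ε + 1)).map (diracOp D X) := by
    rw [← 𝓖.totPart_inf_imPart]
    ext z
    constructor
    · rintro ⟨z, ⟨hz, hz'⟩, rfl⟩
      exact ⟨⟨hz, z.2⟩, hz'⟩
    · rintro ⟨⟨hz, hz'⟩, hz''⟩
      exact ⟨⟨z, hz'⟩, ⟨hz, hz''⟩, rfl⟩
  rw [h4] at h2
  rw [h5] at h3
  rw [subrep_character, ← h2, ← h3, h1]
  exact (add_sub_cancel_left _ _).symm

/-- The index theorem: the Dirac index is the virtual module `X ⊗ S^{*,+} - X ⊗ S^{*,-}`. -/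
theorem indexCharCoeff_eq (g : D.G) (n : ℤ) : indexCharCoeff D 𝓧 g n =
    ∑ l ∈ Finset.range (n.toNat + 1), (-1) ^ l *
      (tr (gRep D X g) (𝓧.part (n - l)) * tr (spinRep D g) (⋀[ℂ]^l (Module.Dual ℂ V))) := by
  have := 𝓖.finite_totPart_inf n
  have h2 : (1 + 1 : ZMod 2) = 0 := by decide
  have hst : ∀ ε, totPart D 𝓧 n ⊓ evenOddPart (V := V) X ε ≤
      (totPart D 𝓧 n ⊓ evenOddPart (V := V) X ε).comap (totRep D X g) := fun ε z hz =>
    ⟨totPart_stable D 𝓧 n g hz.1, evenOddPart_stable D X g ε hz.2⟩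
  have hD : ∀ ε, (totPart D 𝓧 n ⊓ evenOddPart (V := V) X ε).map (diracOp D X) ≤
      totPart D 𝓧 n ⊓ evenOddPart (V := V) X (ε + 1) := by
    rintro ε _ ⟨z, hz, rfl⟩
    exact ⟨𝓖.diracOp_totPart n hz.1, diracOp_evenOddPart ε hz.2⟩
  -- Applied to the even and odd parts of total degree $n$, where semisimplicity of $D^2$ is the
  -- required hypothesis.
  have h := euler_poincare (hst 0) (hst 1) (T := diracOp D X)
    (fun z => (dirac_comm D X g z).symm) (by simpa using hD 0) (by simpa [h2] using hD 1)
    (fun z hz h => 𝓖.diracOp_semisimple hz.1 h) (fun z hz h => 𝓖.diracOp_semisimple hz.1 h)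
  rw [indexCharCoeff, 𝓖.diracCoh_character, 𝓖.diracCoh_character, zero_add, h2, ← h,
    𝓖.tr_totPart_inf, 𝓖.tr_totPart_inf, Finset.sum_filter, Finset.sum_filter,
    ← Finset.sum_sub_distrib]
  refine Finset.sum_congr rfl fun l _ => ?_
  have h01 : (0 : ZMod 2) ≠ 1 := by decide
  rcases Nat.even_or_odd l with hl | hl
  · rw [(ZMod.natCast_eq_zero_iff_even).2 hl, if_pos rfl, if_neg h01, hl.neg_one_pow, sub_zero,
      one_mul]
  · rw [(ZMod.natCast_eq_one_iff_odd).2 hl, if_neg h01.symm, if_pos rfl, hl.neg_one_pow, zero_sub,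
      neg_one_mul]

theorem totPart_neg {n : ℤ} (hn : n < 0) : totPart D 𝓧 n = ⊥ :=
  eq_bot_iff.2 (totPart_le fun l m hm ω _ => by
    rw [𝓖.neg _ (by omega)] at hm
    rw [(Submodule.mem_bot ℂ).1 hm, TensorProduct.zero_tmul]
    exact Submodule.zero_mem _)

theorem indexCharCoeff_eq_zero {n : ℤ} (h : totPart D 𝓧 n ⊓ LinearMap.ker (diracOp D X) = ⊥)
    (g : D.G) : indexCharCoeff D 𝓧 g n = 0 := by
  have h1 : ∀ ε, totPart D 𝓧 n ⊓ evenOddPart (V := V) X ε ⊓ LinearMap.ker (diracOp D X) = ⊥ :=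
    fun ε => eq_bot_iff.2 (le_trans (inf_le_inf_right _ inf_le_left) h.le)
  rw [indexCharCoeff, 𝓖.diracCoh_character, 𝓖.diracCoh_character]
  simp only [h1, bot_inf_eq, tr_bot, sub_zero]

/-- The kernel contains the homogeneous components of its elements, and these survive only in
degrees $0\le n<N$, each of which is finite-dimensional. -/
theorem finite_diracCoh {N : ℕ}
    (h : ∀ n : ℤ, N ≤ n → totPart D 𝓧 n ⊓ LinearMap.ker (diracOp D X) = ⊥) (ε : ZMod 2) :
    FiniteDimensional ℂ (DiracCoh D X ε) := by
  have hfd : ∀ n : ℤ, FiniteDimensional ℂ ↥(totPart D 𝓧 n ⊓ evenOddPart (V := V) X ε) :=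
    fun n => 𝓖.finite_totPart_inf n ε
  have hle : kerPart D X ε ≤ (Finset.range N).sup
      (fun k : ℕ => totPart D 𝓧 k ⊓ evenOddPart (V := V) X ε) := by
    rintro z ⟨hz, hz'⟩
    refine 𝓖.totGrading.mem_of_proj_mem fun n => ?_
    have h1 : 𝓖.totProj n z ∈ totPart D 𝓧 n := 𝓖.totGrading.proj_mem n z
    have h2 : 𝓖.totProj n z ∈ LinearMap.ker (diracOp D X) := by
      rw [LinearMap.mem_ker, 𝓖.diracOp_totProj, LinearMap.mem_ker.1 hz', map_zero]
    change 𝓖.totProj n z ∈ _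
    by_cases hn : N ≤ n
    · have h3 := h n hn ▸ Submodule.mem_inf.2 ⟨h1, h2⟩
      rw [(Submodule.mem_bot ℂ).1 h3]
      exact Submodule.zero_mem _
    · by_cases hn0 : n < 0
      · rw [𝓖.totPart_neg hn0] at h1
        rw [(Submodule.mem_bot ℂ).1 h1]
        exact Submodule.zero_mem _
      · lift n to ℕ using by omega
        exact Finset.le_sup (f := fun k : ℕ => totPart D 𝓧 k ⊓ evenOddPart (V := V) X ε)
          (Finset.mem_range.2 (by omega)) ⟨h1, 𝓖.totProj_evenOddPart n ε hz⟩
  have : FiniteDimensional ℂ ↥((Finset.range N).sup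
      (fun k : ℕ => totPart D 𝓧 k ⊓ evenOddPart (V := V) X ε)) :=
    Submodule.finiteDimensional_finset_sup _ _
  have : FiniteDimensional ℂ (kerPart D X ε) := Submodule.finiteDimensional_of_le hle
  infer_instance

end EulerGraded

end Index

/-! ### The determinant as the alternating character of the exterior powers. -/

section Determinant

/-- The polynomial $X^N-1$ is squarefree over $\mathbb C$, so an endomorphism annihilated by it is
diagonalizable. -/
theorem exists_eigenbasis {E : Type*} [AddCommGroup E] [Module ℂ E] [FiniteDimensional ℂ E]
    (f : Module.End ℂ E) {N : ℕ} (hN : 0 < N) (hf : f ^ N = 1) :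
    ∃ (b : Module.Basis (Fin (Module.finrank ℂ E)) ℂ E) (r : Fin (Module.finrank ℂ E) → ℂ),
      ∀ i, f (b i) = r i • b i := by
  have hsq : Squarefree (Polynomial.X ^ N - 1 : ℂ[X]) :=
    (Polynomial.X_pow_sub_one_separable_iff.2 (by exact_mod_cast hN.ne')).squarefree
  have hss : f.IsSemisimple := Module.End.isSemisimple_of_squarefree_aeval_eq_zero hsq
    (by simp [hf])
  have htop : ⨆ μ, f.eigenspace μ = ⊤ := by
    rw [← Module.End.iSup_maxGenEigenspace_eq_top f]
    exact iSup_congr fun μ => (hss.isFinitelySemisimple.maxGenEigenspace_eq_eigenspace μ).symm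
  have hint : DirectSum.IsInternal fun μ => f.eigenspace μ :=
    DirectSum.isInternal_submodule_of_iSupIndep_of_iSup_eq_top f.eigenspaces_iSupIndep htop
  let b := hint.collectedBasis fun μ => Module.finBasis ℂ (f.eigenspace μ)
  have hfin : Finite (Σ μ, Fin (Module.finrank ℂ (f.eigenspace μ))) := Module.Finite.finite_basis b
  have := Fintype.ofFinite (Σ μ, Fin (Module.finrank ℂ (f.eigenspace μ)))
  let e := Fintype.equivFinOfCardEq (Module.finrank_eq_card_basis b).symm
  refine ⟨b.reindex e, fun i => (e.symm i).1, fun i => ?_⟩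
  rw [Module.Basis.reindex_apply]
  exact Module.End.mem_eigenspace_iff.1 (hint.collectedBasis_mem _ _)

theorem coeff_prod_one_sub {d : ℕ} (r : Fin d → ℂ) (l : ℕ) :
    (∏ i, (1 - Polynomial.X * Polynomial.C (r i))).coeff l =
      (-1) ^ l * ∑ s : Set.powersetCard (Fin d) l, ∏ i ∈ s.1, r i := by
  classical
  have h1 : ∀ i, (1 - Polynomial.X * Polynomial.C (r i) : ℂ[X]) =
      1 + Polynomial.C (-r i) * Polynomial.X := fun i => by
    rw [map_neg]; ring
  simp_rw [h1]
  rw [Finset.prod_one_add, Polynomial.finsetSum_coeff]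
  have h2 : ∀ s : Finset (Fin d), (∏ i ∈ s, (Polynomial.C (-r i) * Polynomial.X : ℂ[X])).coeff l =
      if s.card = l then (-1) ^ l * ∏ i ∈ s, r i else 0 := by
    intro s
    rw [Finset.prod_mul_distrib, Finset.prod_const, ← map_prod, Polynomial.coeff_C_mul_X_pow]
    by_cases h : s.card = l
    · rw [if_pos h, if_pos h.symm, Finset.prod_neg, h]
    · rw [if_neg h, if_neg (Ne.symm h)]
  simp_rw [h2]
  rw [Finset.powerset_univ, ← Finset.sum_filter, Finset.mul_sum]
  exact Finset.sum_subtype _ (fun s => by simp [Set.powersetCard]) _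

variable {V : Type u} [AddCommGroup V] [Module ℂ V] [FiniteDimensional ℂ V] (D : Datum V)

theorem trace_exteriorPower {E : Type*} [AddCommGroup E] [Module ℂ E] {d : ℕ}
    (b : Module.Basis (Fin d) ℂ E) (f : Module.End ℂ E) {r : Fin d → ℂ}
    (hr : ∀ i, f (b i) = r i • b i) (l : ℕ) :
    LinearMap.trace ℂ _ (exteriorPower.map l f) =
      ∑ s : Set.powersetCard (Fin d) l, ∏ i ∈ s.1, r i := by
  classical
  rw [LinearMap.trace_eq_matrix_trace ℂ (b.exteriorPower l), Matrix.trace]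
  refine Finset.sum_congr rfl fun s _ => ?_
  rw [Matrix.diag_apply, LinearMap.toMatrix_apply]
  have h : exteriorPower.map l f (b.exteriorPower l s) = (∏ i ∈ s.1, r i) • b.exteriorPower l s := by
    rw [exteriorPower.basis_apply, exteriorPower.map_apply_ιMulti_family]
    have h1 : (f ∘ b : Fin d → E) = fun i => r i • b i := funext hr
    rw [h1]
    simp only [exteriorPower.ιMulti_family]
    have h2 := (exteriorPower.ιMulti ℂ l (M := E)).map_smul_univ
      (fun i => r (Set.powersetCard.ofFinEmbEquiv.symm s i))
      (fun i => b (Set.powersetCard.ofFinEmbEquiv.symm s i))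
    refine h2.trans ?_
    congr 1
    have h3 := Finset.map_orderEmbOfFin_univ s.1 s.2
    conv_rhs => rw [← h3, Finset.prod_map]
    rfl
  rw [h, map_smul, Module.Basis.repr_self]
  simp

/-- One eigenbasis of $g$ on $V^*$ serves both quantities: it diagonalizes $1-gq$, and its exterior
products are an eigenbasis of each exterior power. The coefficients of the determinant and the
traces become the same elementary symmetric functions up to sign. -/
theorem exists_detDual_eq (g : D.G) : ∃ r : Fin (Module.finrank ℂ (Module.Dual ℂ V)) → ℂ,
    detDual D g = ∏ i, (1 - Polynomial.X * Polynomial.C (r i)) ∧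
      ∀ l, tr (spinRep D g) (⋀[ℂ]^l (Module.Dual ℂ V)) =
        ∑ s : Set.powersetCard (Fin (Module.finrank ℂ (Module.Dual ℂ V))) l, ∏ i ∈ s.1, r i := by
  classical
  obtain ⟨b, r, hr⟩ := exists_eigenbasis (dualRep D g) (N := Nat.card D.G) Nat.card_pos
    (by rw [← map_pow, pow_card_eq_one', map_one])
  refine ⟨r, ?_, fun l => ?_⟩
  · rw [detDual, ← LinearMap.det_toMatrix (b.baseChange ℂ[X])]
    have : LinearMap.toMatrix (b.baseChange ℂ[X]) (b.baseChange ℂ[X])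
        (1 - (Polynomial.X : ℂ[X]) • (dualRep D g).baseChange ℂ[X]) =
          Matrix.diagonal fun i => 1 - Polynomial.X * Polynomial.C (r i) := by
      ext1 i j
      rw [LinearMap.toMatrix_apply, LinearMap.sub_apply, LinearMap.smul_apply,
        Module.Basis.baseChange_apply, LinearMap.baseChange_tmul, hr, Module.End.one_apply,
        map_sub, map_smul, Finsupp.sub_apply, Finsupp.smul_apply,
        Module.Basis.baseChange_repr_tmul, Module.Basis.baseChange_repr_tmul, map_smul,
        Module.Basis.repr_self, Matrix.diagonal_apply]
      by_cases h : i = j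
      · subst h
        simp [Algebra.smul_def]
      · simp [h]
    rw [this, Matrix.det_diagonal]
  · rw [← trace_exteriorPower b _ hr, tr_eq (exteriorPower_stable D g l)]
    congr 1
    refine exteriorPower.linearMap_ext (AlternatingMap.ext fun m => Subtype.ext ?_)
    change ExteriorAlgebra.map (dualRep D g) (ExteriorAlgebra.ιMulti ℂ l m) =
      ((exteriorPower.map l (dualRep D g) (exteriorPower.ιMulti ℂ l m) : _) : Spin V)
    rw [ExteriorAlgebra.map_apply_ιMulti, exteriorPower.map_apply_ιMulti]
    rfl

theorem detDual_coeff (g : D.G) (l : ℕ) :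
    (detDual D g).coeff l = (-1) ^ l * tr (spinRep D g) (⋀[ℂ]^l (Module.Dual ℂ V)) := by
  obtain ⟨r, h1, h2⟩ := exists_detDual_eq D g
  rw [h1, h2, coeff_prod_one_sub]

theorem detDual_coeff_zero (g : D.G) : (detDual D g).coeff 0 = 1 := by
  obtain ⟨r, h1, -⟩ := exists_detDual_eq D g
  rw [h1, Polynomial.coeff_zero_eq_eval_zero, Polynomial.eval_prod]
  simp

theorem exteriorPower_eq_bot {l : ℕ} (hl : Module.finrank ℂ V < l) :
    ⋀[ℂ]^l (Module.Dual ℂ V) = ⊥ := by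
  have h := exteriorPower.finrank_eq ℂ (M := Module.Dual ℂ V) l
  rw [Subspace.dual_finrank_eq, Nat.choose_eq_zero_of_lt hl] at h
  exact Submodule.finrank_eq_zero.1 h

end Determinant

/-! ### The Koszul identity for standard modules. -/

section Standard

variable {V : Type u} [AddCommGroup V] [Module ℂ V] [FiniteDimensional ℂ V] (D : Datum V)
  {W : Type w} [AddCommGroup W] [Module ℂ W] (τ : Representation ℂ D.G W)

/-- The grading of the standard module as a representation of `G`. -/
def vermaRepGrading : RepGrading (gRep D (Verma D τ)) := ⟨vermaPart D τ, vermaPart_stable D τ⟩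

/-- The standard module as an Euler-graded module. -/
def vermaEuler [FiniteDimensional ℂ W] {r : ℂ} (hr : ∀ v, classOp τ (eulerFun D) v = r • v) :
    EulerGraded D (vermaRepGrading D τ) where
  grading := vermaGrading D τ
  gen_mem a _ _ hm := gen_smul_mem_vermaPart D τ a hm
  neg _ hn := vermaPart_neg D τ hn
  fin n := finite_vermaPart D τ n
  low := r
  euler_eq _ _ hm := euler_vermaPart D τ hr hm

/-- The datum with the parameters `t = 1` and `c = 0`. -/
def weylDatum : Datum V := { D with t := 1, c := fun _ => 0, c_conj := fun _ _ _ => rfl }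

theorem classOp_eulerFun_eq_zero (hc : ∀ s, D.c s = 0) {E : Type*} [AddCommGroup E] [Module ℂ E]
    (ρ : Representation ℂ D.G E) : classOp ρ (eulerFun D) = 0 := by
  rw [classOp]
  refine Finset.sum_eq_zero fun g _ => ?_
  have : eulerFun D g = 0 := by
    unfold eulerFun
    split_ifs with h
    · rw [eulerCoeff, hc, mul_zero, zero_div]
    · rfl
  rw [this, zero_smul]

/-- Without reflection terms $\Omega=0$, so $D^2=-2n$ in total degree $n$ and the kernel vanishes
for $n\ne0$. The index formula then says that the alternating sum is zero; the index theorem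
replaces exactness of the Koszul complex. -/
theorem sum_tr_polyPart_of_weyl (ht : D.t = 1) (hc : ∀ s, D.c s = 0) [FiniteDimensional ℂ W]
    (g : D.G) {n : ℕ} (hn : n ≠ 0) :
    ∑ l ∈ Finset.range (n + 1), (-1) ^ l * (tr (valRep D τ g) (polyPart V W (n - l)) *
      tr (spinRep D g) (⋀[ℂ]^l (Module.Dual ℂ V))) = 0 := by
  let 𝓖 := vermaEuler D τ (r := 0) (fun v => by
    rw [classOp_eulerFun_eq_zero D hc, zero_smul, LinearMap.zero_apply])
  have h := 𝓖.indexCharCoeff_eq_zero (n := n) (by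
    rw [eq_bot_iff]
    rintro z ⟨hz, hz'⟩
    have h1 := 𝓖.classOp_of_mem_ker hz hz'
    rw [classOp_eulerFun_eq_zero D hc, LinearMap.zero_apply, ht] at h1
    have h2 : (1 * ((n : ℤ) : ℂ) + 0) • z = 0 := h1.symm
    refine (smul_eq_zero.1 h2).resolve_left ?_
    simpa using hn) g
  rw [𝓖.indexCharCoeff_eq, Int.toNat_natCast] at h
  rw [← h]
  refine Finset.sum_congr rfl fun l _ => ?_
  rw [← tr_vermaPart]
  rfl

/-- The Koszul identity: the graded character of a standard module is
`χ_τ / det_{V^*}(1 - g q)`. -/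
theorem sum_tr_vermaPart [FiniteDimensional ℂ W] (g : D.G) (n : ℕ) :
    ∑ l ∈ Finset.range (n + 1), (-1) ^ l * (tr (gRep D (Verma D τ) g) (vermaPart D τ (n - l)) *
      tr (spinRep D g) (⋀[ℂ]^l (Module.Dual ℂ V))) = if n = 0 then τ.character g else 0 := by
  split_ifs with hn
  · subst hn
    have h1 := detDual_coeff D g 0
    rw [detDual_coeff_zero] at h1
    rw [zero_add, Finset.sum_range_one, mul_left_comm, ← h1, mul_one, Nat.cast_zero, sub_zero,
      tr_vermaPart_zero]
  · simp only [tr_vermaPart]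
    -- The action of $G$ on polynomials does not involve $t$ and $c$, so the identity may be read
    -- off from the parameters $t=1$, $c=0$.
    exact sum_tr_polyPart_of_weyl (weylDatum D) τ rfl (fun _ => rfl) g hn

end Standard

/-! ### Vanishing of the Dirac kernel in large degrees. -/

section Vanishing

variable {V : Type u} [AddCommGroup V] [Module ℂ V] [FiniteDimensional ℂ V] {D : Datum V}
  {X : Type v} [AddCommGroup X] [Module ℂ X] [Module (RCA D) X] [IsScalarTower ℂ (RCA D) X]
  {𝓧 : RepGrading (gRep D X)} (𝓖 : EulerGraded D 𝓧)

include 𝓖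

/-- A nonzero kernel vector in degree $n$ makes $tn+r$ an eigenvalue of $\Omega$. These numbers are
distinct for $t\ne0$, and only finitely many are available. -/
theorem EulerGraded.exists_bound_of_ne_zero (ht : D.t ≠ 0) :
    ∃ N : ℕ, ∀ n : ℤ, N ≤ n → totPart D 𝓧 n ⊓ LinearMap.ker (diracOp D X) = ⊥ := by
  obtain ⟨S, hS, h⟩ := exists_finite_classOp_eigenvalues.{u, max u v} (eulerFun D)
  have hinj : Function.Injective fun n : ℤ => D.t * n + 𝓖.low := fun a b hab => by
    have := mul_left_cancel₀ ht (add_right_cancel hab)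
    exact_mod_cast this
  obtain ⟨N, hN⟩ := (hS.preimage hinj.injOn).bddAbove
  refine ⟨(N + 1).toNat, fun n hn => ?_⟩
  rw [eq_bot_iff]
  rintro z ⟨hz, hz'⟩
  by_contra hz0
  have h3 := hN (h _ _ _ (𝓖.classOp_of_mem_ker hz hz') hz0)
  omega

omit 𝓖 in
theorem exists_bound_of_finite {K : ℕ} (hK : ∀ n : ℤ, K ≤ n → 𝓧.part n = ⊥) :
    ∃ N : ℕ, ∀ n : ℤ, N ≤ n → totPart D 𝓧 n ⊓ LinearMap.ker (diracOp D X) = ⊥ := by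
  -- Forms have degree at most $\dim V$, so from here on the factor in $X$ would have degree at
  -- least `K`.
  refine ⟨K + Module.finrank ℂ V, fun n hn => ?_⟩
  rw [eq_bot_iff]
  refine inf_le_left.trans (totPart_le fun l m hm ω hω => ?_)
  by_cases hl : Module.finrank ℂ V < l
  · rw [exteriorPower_eq_bot hl] at hω
    rw [(Submodule.mem_bot ℂ).1 hω, TensorProduct.tmul_zero]
    exact Submodule.zero_mem _
  · rw [hK _ (by push_cast at hn; omega)] at hm
    rw [(Submodule.mem_bot ℂ).1 hm, TensorProduct.zero_tmul]
    exact Submodule.zero_mem _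

end Vanishing

/-! ### Graded submodules and the maximal proper one. -/

section Graded

variable {V : Type u} [AddCommGroup V] [Module ℂ V] [FiniteDimensional ℂ V] (D : Datum V)
  {W : Type w} [AddCommGroup W] [Module ℂ W] (τ : Representation ℂ D.G W)

variable {D} in
theorem degPart_smul_mem {X : Type*} [AddCommGroup X] [Module ℂ X] [Module (RCA D) X]
    [IsScalarTower ℂ (RCA D) X] {part : ℤ → Submodule ℂ X}
    (hgen : ∀ (a : Gen D) (n : ℤ), ∀ m ∈ part n, gen D a • m ∈ part (n + a.deg))
    {n k : ℤ} {h : RCA D} (hh : h ∈ degPart D n) {m : X} (hm : m ∈ part k) :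
    h • m ∈ part (n + k) := by
  induction hh using Submodule.span_induction with
  | zero => rw [zero_smul]; exact Submodule.zero_mem _
  | add x y _ _ hx hy => rw [add_smul]; exact Submodule.add_mem _ hx hy
  | smul r x _ hx => rw [smul_assoc]; exact Submodule.smul_mem _ r hx
  | mem x hx =>
    obtain ⟨l, rfl, rfl⟩ := hx
    induction l with
    | nil => simpa using hm
    | cons a l ih =>
      have h1 : ((a :: l).map (gen D)).prod = gen D a * (l.map (gen D)).prod := List.prod_cons
      rw [h1, mul_smul, List.map_cons, List.sum_cons]
      convert hgen a _ _ ih using 2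
      ring

variable {D} in
theorem vermaLift_mem {X : Type*} [AddCommGroup X] [Module ℂ X] [Module (RCA D) X]
    [IsScalarTower ℂ (RCA D) X] {part : ℤ → Submodule ℂ X}
    (hgen : ∀ (a : Gen D) (n : ℤ), ∀ m ∈ part n, gen D a • m ∈ part (n + a.deg))
    {u : W →ₗ[ℂ] X} (hg : ∀ a v, gen D (.g a) • u v = u (τ a v))
    (hy : ∀ y v, gen D (.y y) • u v = 0) {k : ℤ} (hu : ∀ v, u v ∈ part k) (n : ℤ) :
    ∀ m ∈ vermaPart D τ n, vermaLift D τ u hg hy m ∈ part (n + k) := by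
  intro m hm
  induction hm using Submodule.span_induction with
  | zero => rw [map_zero]; exact Submodule.zero_mem _
  | add x y _ _ hx hy => rw [map_add]; exact Submodule.add_mem _ hx hy
  | smul r x _ hx =>
    rw [← algebraMap_smul (RCA D) r x, map_smul, algebraMap_smul]
    exact Submodule.smul_mem _ r hx
  | mem x hx =>
    obtain ⟨h, hh, v, rfl⟩ := hx
    rw [mk_tmul, map_smul, vermaLift_one]
    exact degPart_smul_mem hgen hh (hu v)

variable {D τ}

theorem isGraded_iff {N : Submodule (RCA D) (Verma D τ)} :
    IsGraded D τ N ↔ ∀ n, ∀ m ∈ N, (vermaGrading D τ).proj n m ∈ N := by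
  constructor
  · intro h n m hm
    have hle : (⨆ n : ℤ, N.restrictScalars ℂ ⊓ vermaPart D τ n) ≤
        (N.restrictScalars ℂ).comap ((vermaGrading D τ).proj n) := by
      refine iSup_le fun k z hz => ?_
      rw [Submodule.mem_comap]
      by_cases hk : k = n
      · subst hk
        rw [(vermaGrading D τ).proj_self _ _ hz.2]
        exact hz.1
      · rw [(vermaGrading D τ).proj_ne _ _ _ hz.2 hk]
        exact Submodule.zero_mem _
    exact hle (h hm)
  · intro h m hm
    exact (vermaGrading D τ).mem_of_proj_mem fun n => Submodule.mem_iSup_of_mem n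
      ⟨h n m hm, (vermaGrading D τ).proj_mem n m⟩

theorem isGraded_bot : IsGraded D τ ⊥ := isGraded_iff.2 fun n m hm => by
  rw [(Submodule.mem_bot _).1 hm, map_zero]
  exact Submodule.zero_mem _

theorem isGraded_top : IsGraded D τ ⊤ := isGraded_iff.2 fun _ _ _ => trivial

/-- A proper graded submodule does not meet the lowest degree. -/
theorem proj_zero_of_mem (hτ : τ.IsIrreducible) {N : Submodule (RCA D) (Verma D τ)}
    (hN : IsGraded D τ N) (hNt : N ≠ ⊤) {m : Verma D τ} (hm : m ∈ N) :
    (vermaGrading D τ).proj 0 m = 0 := by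
  have h0 := isGraded_iff.1 hN 0 m hm
  have h1 := (vermaGrading D τ).proj_mem 0 m
  rw [vermaPart_zero] at h1
  obtain ⟨v, hv⟩ := h1
  -- The lowest weight vectors lying in `N` form a $G$-stable subspace of $\tau$. If it were all of
  -- $\tau$, then `N` would contain generators of $M(\tau)$.
  have h2 := IsIrreducible.eq_bot_or_eq_top hτ ((N.restrictScalars ℂ).comap (vermaOne D τ))
    fun g v hv => by
      change vermaOne D τ (τ g v) ∈ N
      rw [← gen_g_vermaOne]
      exact N.smul_mem _ hv
  rcases h2 with h2 | h2
  · have h3 : v ∈ (N.restrictScalars ℂ).comap (vermaOne D τ) := by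
      change vermaOne D τ v ∈ N
      rwa [hv]
    rw [h2, Submodule.mem_bot] at h3
    rw [← hv, h3, map_zero]
  · refine absurd (verma_induction D τ fun v => ?_) hNt
    have h3 : v ∈ (N.restrictScalars ℂ).comap (vermaOne D τ) := by rw [h2]; trivial
    exact h3

theorem ne_top_of_proj_zero (hτ : τ.IsIrreducible) {N : Submodule (RCA D) (Verma D τ)}
    (h : ∀ m ∈ N, (vermaGrading D τ).proj 0 m = 0) : N ≠ ⊤ := by
  rintro rfl
  have := IsIrreducible.nontrivial hτ
  obtain ⟨v, hv⟩ := exists_ne (0 : W)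
  have h1 := h (vermaOne D τ v) trivial
  rw [(vermaGrading D τ).proj_self _ _ (vermaOne_mem D τ v)] at h1
  exact hv (vermaOne_injective D τ (by rw [h1, map_zero]))

/-- Missing degree $0$ is preserved by sums, unlike mere properness. Hence the sum of all proper
graded submodules is itself graded and proper. -/
theorem maxSub_aux (hτ : τ.IsIrreducible) {m : Verma D τ} (hm : m ∈ maxSub D τ) :
    (vermaGrading D τ).proj 0 m = 0 ∧ ∀ n, (vermaGrading D τ).proj n m ∈ maxSub D τ := by
  rw [maxSub, sSup_eq_iSup'] at hm
  refine Submodule.iSup_induction _ (motive := fun m => (vermaGrading D τ).proj 0 m = 0 ∧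
    ∀ n, (vermaGrading D τ).proj n m ∈ maxSub D τ) hm ?_ ?_ ?_
  · rintro ⟨N, hN, hNt⟩ m hm
    exact ⟨proj_zero_of_mem hτ hN hNt hm, fun n =>
      le_sSup (a := N) (show N ∈ {N | IsGraded D τ N ∧ N ≠ ⊤} from ⟨hN, hNt⟩)
        (isGraded_iff.1 hN n m hm)⟩
  · simp
  · rintro a b ⟨ha, ha'⟩ ⟨hb, hb'⟩
    refine ⟨by rw [map_add, ha, hb, add_zero], fun n => ?_⟩
    rw [map_add]
    exact Submodule.add_mem _ (ha' n) (hb' n)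

theorem isGraded_maxSub (hτ : τ.IsIrreducible) : IsGraded D τ (maxSub D τ) :=
  isGraded_iff.2 fun n _ hm => (maxSub_aux hτ hm).2 n

theorem maxSub_ne_top (hτ : τ.IsIrreducible) : maxSub D τ ≠ ⊤ :=
  ne_top_of_proj_zero hτ fun _ hm => (maxSub_aux hτ hm).1

theorem le_maxSub {N : Submodule (RCA D) (Verma D τ)} (hN : IsGraded D τ N) (hNt : N ≠ ⊤) :
    N ≤ maxSub D τ := le_sSup (show N ∈ {N | IsGraded D τ N ∧ N ≠ ⊤} from ⟨hN, hNt⟩)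

theorem vermaOne_notMem_maxSub (hτ : τ.IsIrreducible) {v : W} (h : vermaOne D τ v ∈ maxSub D τ) :
    v = 0 := by
  have h1 := (maxSub_aux hτ h).1
  rw [(vermaGrading D τ).proj_self _ _ (vermaOne_mem D τ v)] at h1
  exact vermaOne_injective D τ (by rw [h1, map_zero])

/-! ### Graded quotients of the standard modules -/

/-- The grading inherited by the quotient of a standard module. -/
def quotPart (N : Submodule (RCA D) (Verma D τ)) (n : ℤ) : Submodule ℂ (Verma D τ ⧸ N) :=
  (vermaPart D τ n).map (N.mkQ.restrictScalars ℂ)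

/-- The quotient of a standard module by a graded submodule is graded. -/
def quotGrading {N : Submodule (RCA D) (Verma D τ)} (hN : IsGraded D τ N) :
    Grading (quotPart N) :=
  (vermaGrading D τ).quotient (N.mkQ.restrictScalars ℂ) N.mkQ_surjective
    (fun n m hm => (Submodule.Quotient.mk_eq_zero N).2
      (isGraded_iff.1 hN n m ((Submodule.Quotient.mk_eq_zero N).1 hm))) fun _ => rfl

theorem quotGrading_mk {N : Submodule (RCA D) (Verma D τ)} (hN : IsGraded D τ N) (n : ℤ)
    (m : Verma D τ) : (quotGrading hN).proj n (Submodule.Quotient.mk m) =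
      Submodule.Quotient.mk ((vermaGrading D τ).proj n m) := by
  have h := (vermaGrading D τ).map_proj (quotGrading hN) (N.mkQ.restrictScalars ℂ) 0
    (fun n m hm => by rw [add_zero]; exact ⟨m, hm, rfl⟩) n m
  rw [add_zero] at h
  exact h.symm

theorem gen_smul_mem_quotPart (N : Submodule (RCA D) (Verma D τ)) (a : Gen D) (n : ℤ) :
    ∀ m ∈ quotPart N n, gen D a • m ∈ quotPart N (n + a.deg) := by
  rintro _ ⟨m, hm, rfl⟩
  exact ⟨gen D a • m, gen_smul_mem_vermaPart D τ a hm, rfl⟩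

theorem quotPart_neg (N : Submodule (RCA D) (Verma D τ)) {n : ℤ} (hn : n < 0) :
    quotPart N n = ⊥ := by
  rw [quotPart, vermaPart_neg D τ hn, Submodule.map_bot]

/-- The simple module as an Euler-graded module. -/
def simpleEuler [FiniteDimensional ℂ W] (hτ : τ.IsIrreducible) {r : ℂ}
    (hr : ∀ v, classOp τ (eulerFun D) v = r • v) : EulerGraded D (simpleGrading D τ) where
  grading := quotGrading (isGraded_maxSub hτ)
  gen_mem a n m hm := gen_smul_mem_quotPart (maxSub D τ) a n m hm
  neg _ hn := quotPart_neg _ hn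
  fin n := inferInstanceAs
    (FiniteDimensional ℂ ((vermaPart D τ n).map ((maxSub D τ).mkQ.restrictScalars ℂ)))
  low := r
  euler_eq n := by
    rintro _ ⟨m, hm, rfl⟩
    have h := euler_map D (Verma D τ) (maxSub D τ).mkQ m
    rw [euler_vermaPart D τ hr hm] at h
    exact h.symm

section Lift

variable {W' : Type v} [AddCommGroup W'] [Module ℂ W'] {σ : Representation ℂ D.G W'}
  {N : Submodule (RCA D) (Verma D τ)} (hN : IsGraded D τ N)

include hN

theorem vermaLift_proj {u : W' →ₗ[ℂ] Verma D τ ⧸ N}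
    (hg : ∀ a v, gen D (.g a) • u v = u (σ a v)) (hy : ∀ y v, gen D (.y y) • u v = 0) {k : ℤ}
    (hu : ∀ v, u v ∈ quotPart N k) (n : ℤ) (m : Verma D σ) :
    vermaLift D σ u hg hy ((vermaGrading D σ).proj n m) =
      (quotGrading hN).proj (n + k) (vermaLift D σ u hg hy m) :=
  have h : ∀ (r : ℂ) (m : Verma D σ), vermaLift D σ u hg hy (r • m) =
      r • vermaLift D σ u hg hy m := fun r m => by
    rw [← algebraMap_smul (RCA D) r m, map_smul, algebraMap_smul]
  (vermaGrading D σ).map_proj (quotGrading hN)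
    { toFun := vermaLift D σ u hg hy, map_add' := map_add _, map_smul' := h } k
    (vermaLift_mem σ (gen_smul_mem_quotPart N) hg hy hu) n m

theorem isGraded_comap_map {u : W' →ₗ[ℂ] Verma D τ ⧸ N}
    (hg : ∀ a v, gen D (.g a) • u v = u (σ a v)) (hy : ∀ y v, gen D (.y y) • u v = 0) {k : ℤ}
    (hu : ∀ v, u v ∈ quotPart N k) {P : Submodule (RCA D) (Verma D σ)} (hP : IsGraded D σ P) :
    IsGraded D τ ((P.map (vermaLift D σ u hg hy)).comap N.mkQ) := by
  refine isGraded_iff.2 fun n m hm => ?_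
  obtain ⟨z, hz, hzm⟩ := hm
  refine ⟨(vermaGrading D σ).proj (n - k) z, isGraded_iff.1 hP _ _ hz, ?_⟩
  rw [vermaLift_proj hN hg hy hu, sub_add_cancel, hzm]
  exact quotGrading_mk hN n m

theorem isGraded_ker {u : W' →ₗ[ℂ] Verma D τ ⧸ N}
    (hg : ∀ a v, gen D (.g a) • u v = u (σ a v)) (hy : ∀ y v, gen D (.y y) • u v = 0) {k : ℤ}
    (hu : ∀ v, u v ∈ quotPart N k) : IsGraded D σ (LinearMap.ker (vermaLift D σ u hg hy)) := by
  refine isGraded_iff.2 fun n m hm => ?_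
  rw [LinearMap.mem_ker, vermaLift_proj hN hg hy hu, LinearMap.mem_ker.1 hm, map_zero]

end Lift

end Graded

/-! ### Singular vectors and simplicity of the quotient. -/

section Simplicity

variable {V : Type u} [AddCommGroup V] [Module ℂ V] [FiniteDimensional ℂ V] {D : Datum V}
  {W : Type w} [AddCommGroup W] [Module ℂ W] {τ : Representation ℂ D.G W}

/-- A homogeneous singular vector of the simple module in positive degree is zero. -/
theorem singular_eq_zero (hτ : τ.IsIrreducible) {n : ℤ} (hn : 0 < n) {z : Simple D τ}
    (hz : z ∈ quotPart (maxSub D τ) n) (hy : ∀ y, gen D (.y y) • z = 0) : z = 0 := by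
  let U : Submodule ℂ (Simple D τ) :=
    { carrier := {z | z ∈ quotPart (maxSub D τ) n ∧ ∀ y, gen D (.y y) • z = 0}
      zero_mem' := ⟨Submodule.zero_mem _, fun y => smul_zero _⟩
      add_mem' := fun {a b} ha hb => ⟨Submodule.add_mem _ ha.1 hb.1, fun y => by
        rw [smul_add, ha.2, hb.2, add_zero]⟩
      smul_mem' := fun r a ha => ⟨Submodule.smul_mem _ r ha.1, fun y => by
        have : SMulCommClass ℂ (RCA D) (Simple D τ) := IsScalarTower.to_smulCommClass
        rw [← smul_comm, ha.2, smul_zero]⟩ }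
  have hU : ∀ g, U ≤ U.comap (gRep D (Simple D τ) g) := by
    rintro g z ⟨hz, hy⟩
    refine ⟨?_, fun y => ?_⟩
    · have := gen_smul_mem_quotPart (maxSub D τ) (.g g) n z hz
      rwa [Gen.deg, add_zero] at this
    · have h := gRep_y D (Simple D τ) g (stdRep D.G g⁻¹ y) z
      rw [Representation.self_inv_apply] at h
      refine h.symm.trans ?_
      have h0 : yHom D (stdRep D.G g⁻¹ y) • z = 0 := hy _
      rw [h0, map_zero]
  let σ := (gRep D (Simple D τ)).subrepresentation U hU
  have hg : ∀ a v, gen D (.g a) • U.subtype v = U.subtype (σ a v) := fun a v => rfl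
  have hy' : ∀ y v, gen D (.y y) • U.subtype v = 0 := fun y v => v.2.2 y
  have hgr := isGraded_comap_map (isGraded_maxSub hτ) hg hy' (k := n) (fun v => v.2.1)
    (isGraded_top (D := D) (τ := σ))
  -- The submodule generated by the singular vectors of degree $n$ is the image of a standard module
  -- shifted by $n>0$. It misses degree $0$, so its preimage is proper and lies in the maximal
  -- graded submodule.
  have hne : ((⊤ : Submodule (RCA D) (Verma D σ)).map (vermaLift D σ U.subtype hg hy')).comap
      (maxSub D τ).mkQ ≠ ⊤ := by
    refine ne_top_of_proj_zero hτ fun m hm => ?_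
    obtain ⟨x, -, hx⟩ := hm
    have h1 := vermaLift_proj (isGraded_maxSub hτ) hg hy' (k := n) (fun v => v.2.1) (-n) x
    have h2 : (vermaGrading D σ).proj (-n) x = 0 := by
      have := (vermaGrading D σ).proj_mem (-n) x
      rwa [vermaPart_neg D σ (by omega), Submodule.mem_bot] at this
    rw [h2, map_zero, neg_add_cancel, hx] at h1
    have h3 : (vermaGrading D τ).proj 0 m ∈ maxSub D τ := by
      rw [← Submodule.Quotient.mk_eq_zero, ← quotGrading_mk (isGraded_maxSub hτ)]
      exact h1.symm
    have h4 := (maxSub_aux hτ h3).1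
    rwa [(vermaGrading D τ).proj_self _ _ ((vermaGrading D τ).proj_mem 0 m)] at h4
  have hle := le_maxSub hgr hne
  obtain ⟨m, rfl⟩ := Submodule.Quotient.mk_surjective _ z
  refine (Submodule.Quotient.mk_eq_zero _).2 (hle ⟨vermaOne D σ ⟨_, hz, hy⟩, trivial, ?_⟩)
  rw [vermaLift_one]
  rfl

/-- If $z$ is not singular, some $yz$ is nonzero and its degree bound is one lower. Negative degrees
vanish, so the process stops. -/
theorem exists_singular (hτ : τ.IsIrreducible) (Q : Submodule (RCA D) (Simple D τ)) (K : ℕ) :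
    ∀ z ∈ Q, z ≠ 0 → (∀ n : ℤ, K ≤ n → (quotGrading (isGraded_maxSub hτ)).proj n z = 0) →
      ∃ z' ∈ Q, z' ≠ 0 ∧ ∀ y, gen D (.y y) • z' = 0 := by
  set 𝓖 := quotGrading (isGraded_maxSub hτ)
  induction K with
  | zero =>
    intro z _ hz h
    refine absurd (𝓖.eq_zero fun n => ?_) hz
    by_cases hn : 0 ≤ n
    · exact h n (by exact_mod_cast hn)
    · have := 𝓖.proj_mem n z
      rwa [quotPart_neg _ (by omega), Submodule.mem_bot] at this
  | succ K ih =>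
    intro z hzQ hz h
    by_cases hy : ∀ y, gen D (.y y) • z = 0
    · exact ⟨z, hzQ, hz, hy⟩
    · push Not at hy
      obtain ⟨y, hy⟩ := hy
      refine ih _ (Q.smul_mem _ hzQ) hy fun n hn => ?_
      have h1 := 𝓖.map_proj 𝓖 (yAct D (Simple D τ) y) (-1)
        (fun n m hm => gen_smul_mem_quotPart (maxSub D τ) (.y y) n m hm) (n + 1) z
      rw [h (n + 1) (by push_cast; omega), map_zero, add_neg_cancel_right] at h1
      exact h1.symm

/-- The submodule `Q` need not be graded. It contains a singular vector, whose homogeneous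
components are again singular; those of positive degree vanish, so the vector lies in the copy of
$\tau$ in degree $0$. Irreducibility of $\tau$ then puts all generators into `Q`. -/
theorem isSimpleModule_simple (hτ : τ.IsIrreducible) : IsSimpleModule (RCA D) (Simple D τ) := by
  set 𝓖 := quotGrading (isGraded_maxSub hτ) with h𝓖
  have : Nontrivial (Simple D τ) := Submodule.Quotient.nontrivial_iff.2 (maxSub_ne_top hτ)
  rw [isSimpleModule_iff]
  refine { eq_bot_or_eq_top := fun Q => or_iff_not_imp_left.2 fun hQ => ?_ }
  obtain ⟨z, hzQ, hz⟩ := Submodule.exists_mem_ne_zero_of_ne_bot hQ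
  obtain ⟨s, -, hs⟩ := 𝓖.exists_sum z
  obtain ⟨K, hK⟩ := s.bddAbove
  obtain ⟨z', hz'Q, hz', hy⟩ := exists_singular hτ Q (K + 1).toNat z hzQ hz fun n hn =>
    hs n fun h => by have := hK h; omega
  have h0 : z' ∈ quotPart (maxSub D τ) 0 := by
    refine 𝓖.mem_of_proj_mem fun n => ?_
    rcases lt_trichotomy n 0 with hn | hn | hn
    · have := 𝓖.proj_mem n z'
      rw [quotPart_neg _ hn, Submodule.mem_bot] at this
      rw [this]
      exact Submodule.zero_mem _
    · subst hn
      exact 𝓖.proj_mem 0 z'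
    · rw [singular_eq_zero hτ hn (𝓖.proj_mem n z') fun y => ?_]
      · exact Submodule.zero_mem _
      · have h1 := 𝓖.map_proj 𝓖 (yAct D (Simple D τ) y) (-1)
          (fun n m hm => gen_smul_mem_quotPart (maxSub D τ) (.y y) n m hm) n z'
        rw [yAct_apply, yAct_apply, hy, map_zero] at h1
        exact h1
  obtain ⟨m, hm, rfl⟩ := h0
  rw [SetLike.mem_coe, vermaPart_zero] at hm
  obtain ⟨v, rfl⟩ := hm
  have h2 := IsIrreducible.eq_bot_or_eq_top hτ
    (((Q.comap (maxSub D τ).mkQ).restrictScalars ℂ).comap (vermaOne D τ)) fun g v hv => by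
      change (maxSub D τ).mkQ (vermaOne D τ (τ g v)) ∈ Q
      rw [← gen_g_vermaOne, map_smul]
      exact Q.smul_mem _ hv
  rcases h2 with h2 | h2
  · have h3 : v ∈ ((Q.comap (maxSub D τ).mkQ).restrictScalars ℂ).comap (vermaOne D τ) := hz'Q
    rw [h2, Submodule.mem_bot] at h3
    exact absurd (by rw [h3, map_zero, map_zero]) hz'
  · have h3 : Q.comap (maxSub D τ).mkQ = ⊤ := verma_induction D τ fun v => by
      have h3 : v ∈ ((Q.comap (maxSub D τ).mkQ).restrictScalars ℂ).comap (vermaOne D τ) := by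
        rw [h2]; trivial
      exact h3
    rw [eq_top_iff]
    rintro z -
    obtain ⟨m, rfl⟩ := Submodule.Quotient.mk_surjective _ z
    have : m ∈ Q.comap (maxSub D τ).mkQ := by rw [h3]; trivial
    exact this

end Simplicity

/-! ### Invariant polynomials at t = 0 and boundedness of the simple modules. -/

section Invariants

variable {V : Type u} [AddCommGroup V] [Module ℂ V] [FiniteDimensional ℂ V] {D : Datum V}
  {W : Type w} [AddCommGroup W] [Module ℂ W] {τ : Representation ℂ D.G W}

/-- At `t = 0` multiplication by an invariant polynomial commutes with the Dunkl operators. -/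
theorem dunkl_polyMul_invariant (ht : D.t = 0) {f : Poly V} (hf : ∀ g, polyRep D g f = f) (y : V)
    (m : Poly V ⊗[ℂ] W) : dunkl D τ y (polyMul W f m) = polyMul W f (dunkl D τ y m) := by
  induction m with
  | zero => simp only [map_zero]
  | add a b ha hb => simp only [map_add, ha, hb]
  | tmul p x =>
    -- At $t=0$ the derivative disappears, and divided differences are linear over the invariants.
    rw [polyMul_tmul, dunkl_tmul, dunkl_tmul, ht, zero_smul, zero_smul, zero_sub, zero_sub, map_neg,
      map_sum]
    congr 1
    refine Finset.sum_congr rfl fun s _ => ?_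
    rw [divided_invariant_mul D s (hf s.1), map_smul, polyMul_tmul]

theorem gen_invariant_smul (ht : D.t = 0) {f : Poly V} (hf : ∀ g, polyRep D g f = f) (a : Gen D)
    (m : Verma D τ) : gen D a • polyHom D f • m = polyHom D f • gen D a • m := by
  obtain ⟨z, rfl⟩ := ofModel_surjective D τ m
  rw [← ofModel_polyMul, ← ofModel_gen, ← ofModel_gen, ← ofModel_polyMul]
  congr 1
  cases a with
  | y v => exact dunkl_polyMul_invariant ht hf v z
  | x φ =>
    change polyMul W (lin φ) (polyMul W f z) = polyMul W f (polyMul W (lin φ) z)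
    rw [← LinearMap.comp_apply, ← Module.End.mul_eq_comp, ← polyMul_mul, mul_comm, polyMul_mul]
    rfl
  | g a =>
    change valRep D τ a (polyMul W f z) = polyMul W f (valRep D τ a z)
    induction z with
    | zero => simp only [map_zero]
    | add a b ha hb => simp only [map_add, ha, hb]
    | tmul p x =>
      change polyRep D a (f * p) ⊗ₜ[ℂ] τ a x = (f * polyRep D a p) ⊗ₜ[ℂ] τ a x
      rw [polyRep_mul_poly, hf]

theorem polyHom_smul_mem {k : ℕ} {f : Poly V} (hk : f.IsHomogeneous k) (n : ℤ) :
    ∀ m ∈ vermaPart D τ n, polyHom D f • m ∈ vermaPart D τ (n + k) := by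
  intro m hm
  rw [vermaPart_eq] at hm ⊢
  obtain ⟨z, hz, rfl⟩ := hm
  exact ⟨polyMul W f z, polyMul_mem hk hz, ofModel_polyMul D τ f z⟩

/-- At `t = 0` the invariants of positive degree annihilate the simple modules. -/
theorem invariant_smul_mem_maxSub (hτ : τ.IsIrreducible) (ht : D.t = 0) {k : ℕ} (hk0 : 0 < k)
    {f : Poly V} (hk : f.IsHomogeneous k) (hf : ∀ g, polyRep D g f = f) (m : Verma D τ) :
    polyHom D f • m ∈ maxSub D τ := by
  have hcomm : SMulCommClass ℂ (RCA D) (Verma D τ) := IsScalarTower.to_smulCommClass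
  have hsmul : ∀ (h : RCA D) (m : Verma D τ), polyHom D f • h • m = h • polyHom D f • m := by
    intro h m
    let Q : Submodule ℂ (RCA D) :=
      { carrier := {h | ∀ m : Verma D τ, polyHom D f • h • m = h • polyHom D f • m}
        zero_mem' := fun m => by rw [zero_smul, smul_zero, zero_smul]
        add_mem' := fun {a b} ha hb m => by rw [add_smul, smul_add, ha, hb, add_smul]
        smul_mem' := fun r a ha m => by rw [smul_assoc, ← smul_comm, ha, smul_assoc] }
    suffices hQ : h ∈ Q from hQ m
    obtain ⟨p, rfl⟩ := freeHom_surjective D h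
    induction p using FreeAlgebra.induction with
    | grade0 r =>
      intro m
      rw [AlgHom.commutes, algebraMap_smul, algebraMap_smul, smul_comm]
    | grade1 a => exact fun m => (gen_invariant_smul ht hf a m).symm
    | mul p q hp hq =>
      intro m
      rw [map_mul, mul_smul, hp, hq, mul_smul]
    | add p q hp hq =>
      rw [map_add]
      exact Q.add_mem hp hq
  -- Multiplication by `f` is an $\mathsf H$-endomorphism that raises degrees by $k>0$. Its image is
  -- graded and misses degree $0$, hence lies in the maximal proper graded submodule.
  let F : Verma D τ →ₗ[RCA D] Verma D τ :=
    { toFun := fun m => polyHom D f • m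
      map_add' := smul_add _
      map_smul' := hsmul }
  have hproj : ∀ n m, polyHom D f • (vermaGrading D τ).proj n m =
      (vermaGrading D τ).proj (n + k) (polyHom D f • m) := fun n m =>
    (vermaGrading D τ).map_proj (vermaGrading D τ)
      (Algebra.lsmul ℂ ℂ (Verma D τ) (polyHom D f)) k (polyHom_smul_mem hk) n m
  have hgr : IsGraded D τ (LinearMap.range F) := by
    refine isGraded_iff.2 fun n m hm => ?_
    obtain ⟨z, rfl⟩ := hm
    refine ⟨(vermaGrading D τ).proj (n - k) z, ?_⟩
    change polyHom D f • _ = (vermaGrading D τ).proj n (polyHom D f • z)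
    rw [hproj, sub_add_cancel]
  have hne : LinearMap.range F ≠ ⊤ := by
    refine ne_top_of_proj_zero hτ fun m hm => ?_
    obtain ⟨z, rfl⟩ := hm
    have h1 := hproj (-k) z
    have h2 : (vermaGrading D τ).proj (-k) z = 0 := by
      have := (vermaGrading D τ).proj_mem (-k) z
      rwa [vermaPart_neg D τ (by omega), Submodule.mem_bot] at this
    rw [h2, smul_zero, neg_add_cancel] at h1
    exact h1.symm
  exact le_maxSub hgr hne ⟨m, rfl⟩

/-- Expanding $\prod_g(\varphi_g+x)=0$ gives a monic equation for $x$ with elementary symmetric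
coefficients. -/
theorem pow_card_eq_sum_esymm {A σ : Type*} [CommRing A] [Algebra ℂ A] [Fintype σ] (φ : σ → A)
    {x : A} {a : σ} (h : φ a + x = 0) :
    x ^ Fintype.card σ = ∑ j ∈ Finset.range (Fintype.card σ),
      -(MvPolynomial.aeval φ (MvPolynomial.esymm σ ℂ (j + 1))) *
        x ^ (Fintype.card σ - (j + 1)) := by
  classical
  have hprod : ∏ g, (φ g + x) = 0 := Finset.prod_eq_zero (Finset.mem_univ a) h
  have hterm : ∀ j, ∑ t ∈ Finset.powersetCard j (Finset.univ : Finset σ),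
      (∏ g ∈ t, φ g) * ∏ _g ∈ Finset.univ \ t, x =
        MvPolynomial.aeval φ (MvPolynomial.esymm σ ℂ j) * x ^ (Fintype.card σ - j) := by
    intro j
    simp only [MvPolynomial.esymm, map_sum, map_prod, MvPolynomial.aeval_X]
    rw [Finset.sum_mul]
    refine Finset.sum_congr rfl fun t ht => ?_
    rw [Finset.prod_const, Finset.card_sdiff_of_subset (Finset.subset_univ t), Finset.card_univ,
      (Finset.mem_powersetCard.1 ht).2]
  rw [Finset.prod_add, Finset.sum_powerset, Finset.card_univ, Finset.sum_range_succ'] at hprod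
  simp only [hterm] at hprod
  rw [MvPolynomial.esymm_zero, map_one, one_mul, Nat.sub_zero] at hprod
  simp only [neg_mul, Finset.sum_neg_distrib]
  exact eq_neg_of_add_eq_zero_right hprod

/-- The elementary symmetric polynomials in the orbit of a linear form. -/
def orbitEsymm (D : Datum V) (f : Module.Dual ℂ V) (j : ℕ) : Poly V :=
  letI := Fintype.ofFinite D.G
  MvPolynomial.aeval (fun g => -lin (dualRep D g f)) (MvPolynomial.esymm D.G ℂ j)

theorem orbitEsymm_homogeneous (f : Module.Dual ℂ V) (j : ℕ) :
    (orbitEsymm D f j).IsHomogeneous j := by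
  let _ := Fintype.ofFinite D.G
  simp only [orbitEsymm, MvPolynomial.esymm, map_sum, map_prod, MvPolynomial.aeval_X]
  refine MvPolynomial.IsHomogeneous.sum _ _ _ fun t ht => ?_
  have := MvPolynomial.IsHomogeneous.prod t (fun g => -lin (dualRep D g f)) (fun _ => 1)
    fun g _ => (lin_mem _).neg
  rwa [Finset.sum_const, smul_eq_mul, mul_one, (Finset.mem_powersetCard.1 ht).2] at this

theorem polyRep_orbitEsymm (f : Module.Dual ℂ V) (j : ℕ) (g : D.G) :
    polyRep D g (orbitEsymm D f j) = orbitEsymm D f j := by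
  let _ := Fintype.ofFinite D.G
  have h1 : (polyAct D g).comp (MvPolynomial.aeval fun g => -lin (dualRep D g f)) =
      (MvPolynomial.aeval fun g => -lin (dualRep D g f)).comp
        (MvPolynomial.rename (R := ℂ) (Equiv.mulLeft g)) := by
    refine MvPolynomial.algHom_ext fun a => ?_
    rw [AlgHom.comp_apply, AlgHom.comp_apply, MvPolynomial.rename_X, MvPolynomial.aeval_X,
      MvPolynomial.aeval_X, map_neg, polyAct_lin, Equiv.coe_mulLeft, map_mul]
    rfl
  have h2 := DFunLike.congr_fun h1 (MvPolynomial.esymm D.G ℂ j)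
  rw [AlgHom.comp_apply, AlgHom.comp_apply, MvPolynomial.rename_esymm] at h2
  exact h2

/-- With $\varphi_g=-gf$ and $x=f$ the factor at $g=1$ is zero. So $f^{|G|}$ lies in the ideal
generated by the invariants of positive degree, which annihilate the simple quotient. -/
theorem lin_pow_smul_mem_maxSub (hτ : τ.IsIrreducible) (ht : D.t = 0) (f : Module.Dual ℂ V)
    (m : Verma D τ) : polyHom D (lin f ^ Nat.card D.G) • m ∈ maxSub D τ := by
  let _ := Fintype.ofFinite D.G
  have h := pow_card_eq_sum_esymm (fun g : D.G => -lin (dualRep D g f)) (x := lin f) (a := 1)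
    (by rw [map_one, Module.End.one_apply, neg_add_cancel])
  rw [Nat.card_eq_fintype_card, h, map_sum, Finset.sum_smul]
  refine Submodule.sum_mem _ fun j _ => ?_
  rw [map_mul, mul_smul, map_neg, neg_smul]
  exact Submodule.neg_mem _ (invariant_smul_mem_maxSub hτ ht j.succ_pos
    (orbitEsymm_homogeneous f _) (polyRep_orbitEsymm f _) _)

/-- At `t = 0` the simple modules vanish in large degrees. -/
theorem exists_quotPart_maxSub_eq_bot (hτ : τ.IsIrreducible) (ht : D.t = 0) :
    ∃ K : ℕ, ∀ n : ℤ, K ≤ n → quotPart (maxSub D τ) n = ⊥ := by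
  refine ⟨Module.finrank ℂ V * Nat.card D.G + 1, fun n hn => ?_⟩
  suffices h : vermaPart D τ n ≤ (maxSub D τ).restrictScalars ℂ by
    rw [eq_bot_iff]
    rintro _ ⟨m, hm, rfl⟩
    exact (Submodule.Quotient.mk_eq_zero _).2 (h hm)
  rw [vermaPart_eq, Submodule.map_le_iff_le_comap]
  refine polyPart_le fun k p x hk hp => ?_
  change ofModel D τ (p ⊗ₜ x) ∈ maxSub D τ
  rw [ofModel_tmul, p.as_sum, map_sum, Finset.sum_smul]
  refine Submodule.sum_mem _ fun s hs => ?_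
  have hdeg : s.degree = k := by
    have := hp (MvPolynomial.mem_support_iff.1 hs)
    rwa [Finsupp.degree_eq_weight_one]
  -- Pigeonhole: a monomial of degree above $\dim V\cdot|G|$ is divisible by the $|G|$-th power of a
  -- coordinate.
  obtain ⟨j, hj⟩ : ∃ j, Nat.card D.G ≤ s j := by
    by_contra! hlt
    have h1 : s.degree ≤ ∑ _j : Fin (Module.finrank ℂ V), Nat.card D.G := by
      rw [Finsupp.degree_eq_sum]
      exact Finset.sum_le_sum fun j _ => (hlt j).le
    rw [Finset.sum_const, Finset.card_univ, Fintype.card_fin, smul_eq_mul] at h1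
    push_cast at hn
    have h2 : (s.degree : ℤ) ≤ Module.finrank ℂ V * Nat.card D.G := by exact_mod_cast h1
    omega
  have h1 : MvPolynomial.monomial s (p.coeff s) =
      lin ((Module.finBasis ℂ V).coord j) ^ Nat.card D.G *
        MvPolynomial.monomial (s - Finsupp.single j (Nat.card D.G)) (p.coeff s) := by
    rw [lin_coord, MvPolynomial.X_pow_eq_monomial, MvPolynomial.monomial_mul, one_mul,
      add_tsub_cancel_of_le (Finsupp.single_le_iff.2 hj)]
  rw [h1, map_mul, mul_smul]
  exact lin_pow_smul_mem_maxSub hτ ht _ _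

end Invariants

/-! ### The character formula. -/

section CharacterFormula

theorem coe_powerSeries_coeff {R : Type*} [Semiring R] {f : R⟦X⟧} {c : ℤ → R}
    (h : ∀ n : ℕ, PowerSeries.coeff n f = c n) (hneg : ∀ n < 0, c n = 0) (n : ℤ) :
    (f : LaurentSeries R).coeff n = c n := by
  rw [PowerSeries.coeff_coe]
  split_ifs with hn
  · exact (hneg n hn).symm
  · rw [h]
    congr 1
    omega

theorem exists_polynomial_coeff {R : Type*} [Semiring R] {c : ℤ → R} {N : ℕ}
    (h : ∀ n : ℤ, N ≤ n → c n = 0) : ∃ p : R[X], ∀ n : ℕ, p.coeff n = c n := by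
  refine ⟨∑ k ∈ Finset.range N, Polynomial.monomial k (c k), fun n => ?_⟩
  rw [Polynomial.finsetSum_coeff]
  simp only [Polynomial.coeff_monomial]
  rw [Finset.sum_ite_eq' (Finset.range N) n fun k => c k]
  split_ifs with hn
  · rfl
  · rw [Finset.mem_range, not_lt] at hn
    exact (h n (by exact_mod_cast hn)).symm

variable {V : Type u} [AddCommGroup V] [Module ℂ V] [FiniteDimensional ℂ V] {D : Datum V}

section

variable {X : Type v} [AddCommGroup X] [Module ℂ X] [Module (RCA D) X] [IsScalarTower ℂ (RCA D) X]
  {𝓧 : RepGrading (gRep D X)} (𝓖 : EulerGraded D 𝓧)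

include 𝓖

omit 𝓖 in
theorem charCoeff_eq_tr (g : D.G) (n : ℤ) :
    charCoeff D 𝓧 g n = tr (gRep D X g) (𝓧.part n) := subrep_character _ _ _ g

theorem EulerGraded.indexCharCoeff_neg (g : D.G) {n : ℤ} (hn : n < 0) :
    indexCharCoeff D 𝓧 g n = 0 :=
  𝓖.indexCharCoeff_eq_zero (by rw [𝓖.totPart_neg hn, bot_inf_eq]) g

/-- The index theorem is the coefficientwise form of
$\mathrm{ch}\,I_D=\mathrm{ch}\,X\cdot\det_{V^*}(1-gq)$. Division is legitimate because the
determinant has constant term $1$. -/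
theorem EulerGraded.character_formula {N : ℕ}
    (hN : ∀ n : ℤ, N ≤ n → totPart D 𝓧 n ⊓ LinearMap.ker (diracOp D X) = ⊥) (g : D.G) :
    ∃ (chL : ℂ⟦X⟧) (chI : ℂ[X]),
      (∀ n : ℤ, (chL : LaurentSeries ℂ).coeff n = charCoeff D 𝓧 g n) ∧
      (∀ n : ℤ, ((chI : ℂ⟦X⟧) : LaurentSeries ℂ).coeff n = indexCharCoeff D 𝓧 g n) ∧
      (chL : LaurentSeries ℂ) = ((chI : ℂ⟦X⟧) : LaurentSeries ℂ) /
        ((detDual D g : ℂ⟦X⟧) : LaurentSeries ℂ) := by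
  obtain ⟨p, hp⟩ := exists_polynomial_coeff (c := indexCharCoeff D 𝓧 g)
    fun n hn => 𝓖.indexCharCoeff_eq_zero (hN n hn) g
  refine ⟨PowerSeries.mk fun n => charCoeff D 𝓧 g n, p, ?_, ?_, ?_⟩
  · refine coe_powerSeries_coeff (fun n => PowerSeries.coeff_mk _ _) fun n hn => ?_
    rw [charCoeff_eq_tr, 𝓖.neg n hn, tr_bot]
  · exact coe_powerSeries_coeff (fun n => by rw [Polynomial.coeff_coe, hp])
      fun n hn => 𝓖.indexCharCoeff_neg g hn
  · have hdet : ((detDual D g : ℂ⟦X⟧) : LaurentSeries ℂ) ≠ 0 := by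
      intro h
      have h1 := congrArg (fun f : LaurentSeries ℂ => f.coeff 0) h
      simp only [PowerSeries.coeff_coe, HahnSeries.coeff_zero] at h1
      simp [detDual_coeff_zero] at h1
    rw [eq_div_iff hdet, ← PowerSeries.coe_mul]
    congr 1
    ext n
    rw [mul_comm, PowerSeries.coeff_mul, Finset.Nat.sum_antidiagonal_eq_sum_range_succ_mk,
      Polynomial.coeff_coe, hp, 𝓖.indexCharCoeff_eq, Int.toNat_natCast]
    refine Finset.sum_congr rfl fun l hl => ?_
    rw [Polynomial.coeff_coe, detDual_coeff, PowerSeries.coeff_mk, charCoeff_eq_tr,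
      Nat.cast_sub (by rw [Finset.mem_range] at hl; omega)]
    ring

end

variable {W : Type w} [AddCommGroup W] [Module ℂ W] [FiniteDimensional ℂ W]
  {τ : Representation ℂ D.G W}

/-- Two different mechanisms: for $t=0$ the module itself vanishes in large degrees, for $t\ne0$ the
kernel is bounded by the eigenvalues of $\Omega$. -/
theorem exists_simple_bound (hτ : τ.IsIrreducible) : ∃ N : ℕ, ∀ n : ℤ, N ≤ n →
    totPart D (simpleGrading D τ) n ⊓ LinearMap.ker (diracOp D (Simple D τ)) = ⊥ := by
  by_cases ht : D.t = 0
  · obtain ⟨K, hK⟩ := exists_quotPart_maxSub_eq_bot hτ ht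
    exact exists_bound_of_finite (𝓧 := simpleGrading D τ) hK
  · obtain ⟨r, hr⟩ := exists_classOp_scalar D τ hτ
    exact (simpleEuler hτ hr).exists_bound_of_ne_zero ht

end CharacterFormula

/-- Both quotients are identified with the common image. The compatibility clause makes degrees
comparable across the isomorphism. -/
theorem exists_quotient_equiv {R A C M : Type*} [Ring R] [AddCommGroup A] [Module R A]
    [AddCommGroup C] [Module R C] [AddCommGroup M] [Module R M] (f : A →ₗ[R] C) (θ : M →ₗ[R] C)
    (h : LinearMap.range f = LinearMap.range θ) {P : Submodule R A} {Q : Submodule R M}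
    (hP : LinearMap.ker f = P) (hQ : LinearMap.ker θ = Q) :
    ∃ e : (A ⧸ P) ≃ₗ[R] (M ⧸ Q), ∀ a z, f a = θ z →
      e (Submodule.Quotient.mk a) = Submodule.Quotient.mk z := by
  subst hP hQ
  refine ⟨f.quotKerEquivRange.trans ((LinearEquiv.ofEq _ _ h).trans θ.quotKerEquivRange.symm),
    fun a z haz => ?_⟩
  rw [LinearEquiv.trans_apply, LinearEquiv.trans_apply, LinearEquiv.symm_apply_eq]
  exact Subtype.ext haz

/-! ### Shifted simple subquotients and refinement of filtrations. -/

section Subquotients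

variable {V : Type u} [AddCommGroup V] [Module ℂ V] [FiniteDimensional ℂ V] {D : Datum V}
  {W : Type w} [AddCommGroup W] [Module ℂ W] {τ : Representation ℂ D.G W}

/-- The homogeneous parts of a submodule of a standard module. -/
def subPart (N : Submodule (RCA D) (Verma D τ)) (n : ℤ) : Submodule ℂ (Verma D τ) :=
  N.restrictScalars ℂ ⊓ vermaPart D τ n

theorem subPart_stable (N : Submodule (RCA D) (Verma D τ)) (n : ℤ) (g : D.G) :
    subPart N n ≤ (subPart N n).comap (gRep D (Verma D τ) g) :=
  fun _ hm => ⟨N.smul_mem _ hm.1, vermaPart_stable D τ n g hm.2⟩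

theorem subPart_neg (N : Submodule (RCA D) (Verma D τ)) {n : ℤ} (hn : n < 0) :
    subPart N n = ⊥ := by
  rw [subPart, vermaPart_neg D τ hn, inf_bot_eq]

theorem subPart_mono {N N' : Submodule (RCA D) (Verma D τ)} (h : N ≤ N') (n : ℤ) :
    subPart N n ≤ subPart N' n := fun _ hm => ⟨h hm.1, hm.2⟩

instance finite_subPart [FiniteDimensional ℂ W] (N : Submodule (RCA D) (Verma D τ)) (n : ℤ) :
    FiniteDimensional ℂ (subPart N n) :=
  Submodule.finiteDimensional_of_le (inf_le_right : subPart N n ≤ vermaPart D τ n)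

section Shifted

variable {W' : Type v} [AddCommGroup W'] [Module ℂ W'] {σ : Representation ℂ D.G W'}
  {N N' : Submodule (RCA D) (Verma D τ)} {k : ℤ}

/-- The definition of a shifted simple subquotient only asks that degree parts go into degree parts.
Since both sides are gradings, the isomorphism commutes with the projections and therefore maps
degree parts onto degree parts. -/
theorem exists_of_mem_simplePart (hσ : σ.IsIrreducible) (hN' : IsGraded D τ N')
    {e : (↥N' ⧸ N.submoduleOf N') ≃ₗ[RCA D] Simple D σ}
    (he : ∀ (n : ℤ) (m : N'), (m : Verma D τ) ∈ vermaPart D τ (n + k) →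
      e (Submodule.Quotient.mk m) ∈ (simpleGrading D σ).part n) {n : ℤ} {z : Simple D σ}
    (hz : z ∈ (simpleGrading D σ).part n) :
    ∃ m : N', (m : Verma D τ) ∈ vermaPart D τ (n + k) ∧ e (Submodule.Quotient.mk m) = z := by
  set 𝓖 := quotGrading (isGraded_maxSub hσ)
  set 𝓥 := vermaGrading D τ
  have key : ∀ m : N', e (Submodule.Quotient.mk ⟨𝓥.proj (n + k) m, isGraded_iff.1 hN' _ _ m.2⟩) =
      𝓖.proj n (e (Submodule.Quotient.mk m)) := by
    have h1 : ∀ m : N', ∀ j, (m : Verma D τ) ∈ vermaPart D τ j →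
        e (Submodule.Quotient.mk ⟨𝓥.proj (n + k) m, isGraded_iff.1 hN' _ _ m.2⟩) =
          𝓖.proj n (e (Submodule.Quotient.mk m)) := by
      intro m j hm
      have hm' : e (Submodule.Quotient.mk m) ∈ quotPart (maxSub D σ) (j - k) :=
        he (j - k) m (by rwa [sub_add_cancel])
      by_cases hj : j = n + k
      · subst hj
        rw [add_sub_cancel_right] at hm'
        rw [𝓖.proj_self _ _ hm']
        congr 2
        exact Subtype.ext (𝓥.proj_self _ _ hm)
      · rw [𝓖.proj_ne _ _ _ hm' (by omega)]
        have : (⟨𝓥.proj (n + k) m, isGraded_iff.1 hN' _ _ m.2⟩ : N') = 0 :=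
          Subtype.ext (𝓥.proj_ne _ _ _ hm hj)
        rw [this]
        exact map_zero e
    intro m
    obtain ⟨s, hs, -⟩ := 𝓥.exists_sum (m : Verma D τ)
    let π : ℤ → N' → N' := fun j m => ⟨𝓥.proj j m, isGraded_iff.1 hN' _ _ m.2⟩
    have hm : m = ∑ j ∈ s, π j m := by
      refine Subtype.ext ?_
      rw [AddSubmonoidClass.coe_finsetSum]
      exact hs
    let L₁ : N' →+ Simple D σ := e.toLinearMap.toAddMonoidHom.comp
      ((N.submoduleOf N').mkQ.toAddMonoidHom.comp
        { toFun := π (n + k)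
          map_zero' := Subtype.ext (map_zero (𝓥.proj (n + k)))
          map_add' := fun a b => Subtype.ext (map_add (𝓥.proj (n + k)) _ _) })
    let L₂ : N' →+ Simple D σ := (𝓖.proj n).toAddMonoidHom.comp (e.toLinearMap.toAddMonoidHom.comp
      (N.submoduleOf N').mkQ.toAddMonoidHom)
    change L₁ m = L₂ m
    rw [hm, map_sum, map_sum]
    exact Finset.sum_congr rfl fun j _ => h1 (π j m) j (𝓥.proj_mem j _)
  obtain ⟨m, hm⟩ := Submodule.Quotient.mk_surjective _ (e.symm z)
  refine ⟨_, 𝓥.proj_mem (n + k) m, (key m).trans ?_⟩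
  rw [hm, LinearEquiv.apply_symm_apply]
  exact 𝓖.proj_self n z hz

theorem exists_lowest (hσ : σ.IsIrreducible) (hN' : IsGraded D τ N')
    {e : (↥N' ⧸ N.submoduleOf N') ≃ₗ[RCA D] Simple D σ}
    (he : ∀ (n : ℤ) (m : N'), (m : Verma D τ) ∈ vermaPart D τ (n + k) →
      e (Submodule.Quotient.mk m) ∈ (simpleGrading D σ).part n) :
    ∃ m : N', (m : Verma D τ) ∈ vermaPart D τ k ∧ e (Submodule.Quotient.mk m) ≠ 0 ∧
      e (Submodule.Quotient.mk m) ∈ (simpleGrading D σ).part 0 := by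
  have := IsIrreducible.nontrivial hσ
  obtain ⟨v, hv⟩ := exists_ne (0 : W')
  have hz : (Submodule.Quotient.mk (vermaOne D σ v) : Simple D σ) ∈ (simpleGrading D σ).part 0 :=
    ⟨_, vermaOne_mem D σ v, rfl⟩
  obtain ⟨m, hm, hmz⟩ := exists_of_mem_simplePart hσ hN' he hz
  rw [zero_add] at hm
  refine ⟨m, hm, ?_, hmz ▸ hz⟩
  rw [hmz, Ne, Submodule.Quotient.mk_eq_zero]
  exact fun h => hv (vermaOne_notMem_maxSub hσ h)

theorem IsShiftedSimple.nonneg (hσ : σ.IsIrreducible) (hN' : IsGraded D τ N')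
    (h : IsShiftedSimple D τ σ k N N') : 0 ≤ k := by
  obtain ⟨e, he⟩ := h
  obtain ⟨m, hm, hm0, -⟩ := exists_lowest hσ hN' he
  by_contra hk
  rw [vermaPart_neg D τ (by omega), Submodule.mem_bot] at hm
  have : m = 0 := Subtype.ext hm
  subst this
  exact hm0 (map_zero e)

/-- A lowest vector of the subquotient has Euler eigenvalue $tk+r$ as the class of a vector of
degree $k$ in $M(\tau)$, and $r'$ as a lowest vector of $L(\sigma)$. -/
theorem IsShiftedSimple.euler_eq [FiniteDimensional ℂ W] [FiniteDimensional ℂ W']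
    (hσ : σ.IsIrreducible) (hN' : IsGraded D τ N')
    (h : IsShiftedSimple D τ σ k N N') {r r' : ℂ} (hr : ∀ v, classOp τ (eulerFun D) v = r • v)
    (hr' : ∀ v, classOp σ (eulerFun D) v = r' • v) : D.t * k + r = r' := by
  obtain ⟨e, he⟩ := h
  obtain ⟨m, hm, hm0, hm1⟩ := exists_lowest hσ hN' he
  let T : N' →ₗ[RCA D] Simple D σ := e.toLinearMap ∘ₗ (N.submoduleOf N').mkQ
  have h1 : euler D (Simple D σ) (T m) = (D.t * (0 : ℤ) + r') • T m :=
    (simpleEuler hσ hr').euler_eq 0 (T m) hm1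
  have h2 : euler D N' m = (D.t * k + r) • m := by
    refine Subtype.ext ?_
    have h3 := euler_map D N' N'.subtype m
    rw [Submodule.subtype_apply, Submodule.subtype_apply, euler_vermaPart D τ hr hm] at h3
    exact h3
  have h3 := euler_map D N' T m
  rw [h2, h1] at h3
  have h4 : T ((D.t * k + r) • m) = (D.t * k + r) • T m := map_smul (T.restrictScalars ℂ) _ _
  rw [h4, ← sub_eq_zero, ← sub_smul, smul_eq_zero] at h3
  have h5 := sub_eq_zero.1 (h3.resolve_right hm0)
  rw [h5, Int.cast_zero, mul_zero, zero_add]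

theorem IsShiftedSimple.tr_eq [FiniteDimensional ℂ W] (hσ : σ.IsIrreducible) (hNN' : N ≤ N')
    (hN' : IsGraded D τ N') (h : IsShiftedSimple D τ σ k N N') (g : D.G) (n : ℤ) :
    tr (gRep D (Verma D τ) g) (subPart N' (n + k)) =
      tr (gRep D (Verma D τ) g) (subPart N (n + k)) +
        tr (gRep D (Simple D σ) g) ((simpleGrading D σ).part n) := by
  obtain ⟨e, he⟩ := h
  let T : N' →ₗ[ℂ] Simple D σ := (e.toLinearMap ∘ₗ (N.submoduleOf N').mkQ).restrictScalars ℂ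
  let i : N' →ₗ[ℂ] Verma D τ := N'.subtype.restrictScalars ℂ
  let U : Submodule ℂ N' := (vermaPart D τ (n + k)).comap i
  have hi : Function.Injective i := Subtype.val_injective
  have hUfd : FiniteDimensional ℂ U := by
    refine FiniteDimensional.of_injective
      (LinearMap.restrict i (p := U) (q := vermaPart D τ (n + k)) fun z hz => hz) ?_
    intro a b hab
    have h' : i a = i b :=
      congrArg (fun z : ↥(vermaPart D τ (n + k)) => (z : Verma D τ)) hab
    exact Subtype.ext (hi h')
  have hU : U ≤ U.comap (gRep D N' g) := fun z hz => vermaPart_stable D τ _ g hz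
  have hTker : ∀ z : N', T z = 0 ↔ (z : Verma D τ) ∈ N := fun z => by
    change e (Submodule.Quotient.mk z) = 0 ↔ _
    rw [LinearEquiv.map_eq_zero_iff, Submodule.Quotient.mk_eq_zero]
    rfl
  have hTg : ∀ z, T (gRep D N' g z) = gRep D (Simple D σ) g (T z) := fun z =>
    map_smul (e.toLinearMap ∘ₗ (N.submoduleOf N').mkQ) (gen D (.g g)) z
  have hUT : U ⊓ LinearMap.ker T ≤ (U ⊓ LinearMap.ker T).comap (gRep D N' g) := by
    rintro z ⟨hz, hz'⟩
    refine ⟨hU hz, ?_⟩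
    rw [SetLike.mem_coe, LinearMap.mem_ker] at hz' ⊢
    rw [hTg, hz', map_zero]
  have h1 := tr_map_add hU T hTg
  have h2 := tr_map_injOn hU i (f' := gRep D (Verma D τ) g) (fun _ => rfl)
    (fun z _ h => hi (h.trans (map_zero i).symm))
  have h3 := tr_map_injOn hUT i (f' := gRep D (Verma D τ) g) (fun _ => rfl)
    (fun z _ h => hi (h.trans (map_zero i).symm))
  have h4 : U.map i = subPart N' (n + k) := by
    ext z
    constructor
    · rintro ⟨z, hz, rfl⟩
      exact ⟨z.2, hz⟩
    · rintro ⟨hz, hz'⟩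
      exact ⟨⟨z, hz⟩, hz', rfl⟩
  have h5 : (U ⊓ LinearMap.ker T).map i = subPart N (n + k) := by
    ext z
    constructor
    · rintro ⟨z, ⟨hz, hz'⟩, rfl⟩
      exact ⟨(hTker z).1 hz', hz⟩
    · rintro ⟨hz, hz'⟩
      exact ⟨⟨z, hNN' hz⟩, ⟨hz', (hTker _).2 hz⟩, rfl⟩
  have h6 : U.map T = (simpleGrading D σ).part n := by
    ext z
    constructor
    · rintro ⟨z, hz, rfl⟩
      exact he n z hz
    · intro hz
      obtain ⟨m, hm, hmz⟩ := exists_of_mem_simplePart hσ hN' he hz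
      exact ⟨m, hm, hmz⟩
  rw [h4] at h2
  rw [h5] at h3
  rw [h6] at h1
  rw [← h2, ← h3, h1]

end Shifted

section Refinement

variable {ι : Type*} {W' : ι → Type v} [∀ i, AddCommGroup (W' i)] [∀ i, Module ℂ (W' i)]
  {σ : ∀ i, Representation ℂ D.G (W' i)}

/-- As nothing changes in degree $n-1$, vectors of $V$ kill the degree $n$ part of $N'/N$. An
irreducible $G$-submodule there receives a map $\varphi$ from its standard module; `A` and `B` are
the preimages of the image of $\varphi$ and of the image of the maximal proper submodule. The last
clause makes the step visible in degree $n$, so that refinement terminates. -/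
theorem exists_shiftedSimple_between [FiniteDimensional ℂ W] (hirr : ∀ i, (σ i).IsIrreducible)
    (hall : IsExhaustive σ)
    {N N' : Submodule (RCA D) (Verma D τ)} (hN : IsGraded D τ N) (hNN' : N ≤ N') {n : ℤ}
    (hne : subPart N n ≠ subPart N' n) (heq : subPart N (n - 1) = subPart N' (n - 1)) :
    ∃ (j : ι) (B A : Submodule (RCA D) (Verma D τ)), IsGraded D τ B ∧ IsGraded D τ A ∧ N ≤ B ∧
      B ≤ A ∧ A ≤ N' ∧ IsShiftedSimple D τ (σ j) n B A ∧ ∃ a ∈ subPart A n, a ∉ B := by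
  let U : Submodule ℂ (Verma D τ ⧸ N) := (subPart N' n).map (N.mkQ.restrictScalars ℂ)
  have hU0 : U ≠ ⊥ := by
    intro h0
    refine hne (le_antisymm (subPart_mono hNN' n) fun m hm => ⟨?_, hm.2⟩)
    have h1 : N.mkQ.restrictScalars ℂ m ∈ U := ⟨m, hm, rfl⟩
    rw [h0, Submodule.mem_bot] at h1
    exact (Submodule.Quotient.mk_eq_zero N).1 h1
  have hU : ∀ g, U ≤ U.comap (gRep D (Verma D τ ⧸ N) g) := by
    rintro g _ ⟨m, hm, rfl⟩
    exact ⟨gRep D (Verma D τ) g m, subPart_stable N' n g hm, rfl⟩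
  have hUy : ∀ y, ∀ z ∈ U, gen D (.y y) • z = 0 := by
    rintro y _ ⟨m, hm, rfl⟩
    have h1 : gen D (.y y) • m ∈ subPart N' (n - 1) :=
      ⟨N'.smul_mem _ hm.1, gen_smul_mem_vermaPart D τ (.y y) hm.2⟩
    rw [← heq] at h1
    exact (Submodule.Quotient.mk_eq_zero N).2 h1.1
  obtain ⟨j, u, hu, hug, hur⟩ := hall.exists_sub (gRep D (Verma D τ ⧸ N)) U hU0 hU
  have huU : ∀ v, u v ∈ U := fun v => hur ⟨v, rfl⟩
  have hg : ∀ a v, gen D (.g a) • u v = u (σ j a v) := fun a v => (hug a v).symm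
  have hy : ∀ y v, gen D (.y y) • u v = 0 := fun y v => hUy y _ (huU v)
  have hun : ∀ v, u v ∈ quotPart N n := fun v =>
    Submodule.map_mono (inf_le_right : subPart N' n ≤ vermaPart D τ n) (huU v)
  set φ := vermaLift D (σ j) u hg hy with hφ
  have hφ1 : ∀ v, φ (vermaOne D (σ j) v) = u v := vermaLift_one D (σ j) u hg hy
  -- The kernel is graded, and proper since $\varphi$ is injective on the lowest weight space. Hence
  -- $\varphi$ induces an isomorphism of $L(\sigma_j)$ with $A/B$.
  have hker : LinearMap.ker φ ≤ maxSub D (σ j) := by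
    refine le_maxSub (isGraded_ker hN hg hy hun) fun htop => ?_
    have := IsIrreducible.nontrivial (hirr j)
    obtain ⟨v, hv⟩ := exists_ne (0 : W' j)
    have h1 : vermaOne D (σ j) v ∈ LinearMap.ker φ := by rw [htop]; trivial
    rw [LinearMap.mem_ker, hφ1] at h1
    exact hv (hu (by rw [h1, map_zero]))
  have hmem : ∀ z, φ z ∈ (maxSub D (σ j)).map φ → z ∈ maxSub D (σ j) := by
    rintro z ⟨x, hx, hxz⟩
    have h1 : z - x ∈ LinearMap.ker φ := by rw [LinearMap.mem_ker, map_sub, hxz, sub_self]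
    have := Submodule.add_mem _ (hker h1) hx
    rwa [sub_add_cancel] at this
  set A := ((⊤ : Submodule (RCA D) (Verma D (σ j))).map φ).comap N.mkQ with hA
  set B := ((maxSub D (σ j)).map φ).comap N.mkQ with hB
  have hBA : B ≤ A := Submodule.comap_mono (Submodule.map_mono le_top)
  have hAN' : A ≤ N' := by
    have h1 : (N'.map N.mkQ).comap φ = ⊤ := verma_induction D (σ j) fun v => by
      obtain ⟨m, hm, hmv⟩ := huU v
      rw [Submodule.mem_comap, hφ1, ← hmv]
      exact ⟨m, hm.1, rfl⟩
    rintro m ⟨z, -, hz⟩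
    have h2 : z ∈ (N'.map N.mkQ).comap φ := by rw [h1]; trivial
    obtain ⟨m', hm', hmz⟩ := h2
    have h3 : m - m' ∈ N := by
      rw [← Submodule.Quotient.mk_eq_zero]
      change N.mkQ (m - m') = 0
      rw [map_sub, hmz, hz, sub_self]
    have := N'.add_mem (hNN' h3) hm'
    rwa [sub_add_cancel] at this
  refine ⟨j, B, A, isGraded_comap_map hN hg hy hun (isGraded_maxSub (hirr j)),
    isGraded_comap_map hN hg hy hun isGraded_top, ?_, hBA, hAN', ?_, ?_⟩
  · intro m hm
    refine ⟨0, Submodule.zero_mem _, ?_⟩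
    rw [map_zero]
    exact ((Submodule.Quotient.mk_eq_zero N).2 hm).symm
  · let q := ((maxSub D (σ j)).map φ).mkQ
    obtain ⟨e, he⟩ := exists_quotient_equiv (q ∘ₗ N.mkQ ∘ₗ A.subtype) (q ∘ₗ φ)
      (P := B.submoduleOf A) (Q := maxSub D (σ j)) (by
        ext z
        constructor
        · rintro ⟨⟨a, x, -, hx⟩, rfl⟩
          exact ⟨x, congrArg q hx⟩
        · rintro ⟨x, rfl⟩
          obtain ⟨a, ha⟩ := N.mkQ_surjective (φ x)
          exact ⟨⟨a, x, trivial, ha.symm⟩, congrArg q ha⟩) (by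
        ext a
        rw [LinearMap.mem_ker]
        exact Submodule.Quotient.mk_eq_zero _) (by
        ext z
        rw [LinearMap.mem_ker]
        refine (Submodule.Quotient.mk_eq_zero _).trans ⟨hmem z, fun hz => ⟨z, hz, rfl⟩⟩)
    refine ⟨e, fun k m hm => ?_⟩
    obtain ⟨z, -, hz⟩ := m.2
    have h1 : φ ((vermaGrading D (σ j)).proj k z) = N.mkQ m := by
      rw [hφ, vermaLift_proj hN hg hy hun, ← hφ, hz]
      refine (quotGrading_mk hN _ _).trans ?_
      rw [(vermaGrading D τ).proj_self _ _ hm]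
      rfl
    rw [he m _ (congrArg q h1.symm)]
    exact ⟨_, (vermaGrading D (σ j)).proj_mem k z, rfl⟩
  · have := IsIrreducible.nontrivial (hirr j)
    obtain ⟨v, hv⟩ := exists_ne (0 : W' j)
    obtain ⟨a, ha, hav⟩ := huU v
    have hav' : φ (vermaOne D (σ j) v) = N.mkQ a := (hφ1 v).trans hav.symm
    refine ⟨a, ⟨⟨_, trivial, hav'⟩, ha.2⟩, fun haB => ?_⟩
    have h1 : N.mkQ a ∈ (maxSub D (σ j)).map φ := haB
    rw [← hav'] at h1
    exact hv (vermaOne_notMem_maxSub (hirr j) (hmem _ h1))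

/-- The steps of a refined filtration: the subquotient is a shifted simple module or vanishes in
degrees at most `K`. -/
def Step (σ : ∀ i, Representation ℂ D.G (W' i)) (K : ℕ) (N N' : Submodule (RCA D) (Verma D τ)) :
    Prop :=
  N ≤ N' ∧ IsGraded D τ N ∧ IsGraded D τ N' ∧
    ((∃ j k, IsShiftedSimple D τ (σ j) k N N') ∨ ∀ n : ℕ, n ≤ K → subPart N n = subPart N' n)

/-- Induction on the total dimension of $N'/N$ in degrees at most `K`, which drops when a shifted
simple piece is inserted. Truncation at `K` makes this measure finite without assuming that
$M(\tau)$ has finite length. -/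
theorem exists_refinement [FiniteDimensional ℂ W] (hirr : ∀ i, (σ i).IsIrreducible)
    (hall : IsExhaustive σ) (K : ℕ) {N N' : Submodule (RCA D) (Verma D τ)}
    (hN : IsGraded D τ N) (hN' : IsGraded D τ N') (hNN' : N ≤ N') :
    Relation.ReflTransGen (Step σ K) N N' := by
  classical
  let r : Submodule (RCA D) (Verma D τ) → ℕ := fun N =>
    ∑ n ∈ Finset.range (K + 1), Module.finrank ℂ (subPart N n)
  have hr : ∀ {N N' : Submodule (RCA D) (Verma D τ)}, N ≤ N' → r N ≤ r N' := fun h =>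
    Finset.sum_le_sum fun n _ => Submodule.finrank_mono (subPart_mono h n)
  induction hd : r N' - r N using Nat.strong_induction_on generalizing N N' with
  | _ d ih =>
  by_cases hall0 : ∀ n : ℕ, n ≤ K → subPart N n = subPart N' n
  · exact Relation.ReflTransGen.single ⟨hNN', hN, hN', Or.inr hall0⟩
  · push Not at hall0
    -- The lowest degree in which the two submodules differ; agreement one degree below makes the
    -- new vectors singular.
    have hex := Nat.find_spec hall0
    have hmin : ∀ m < Nat.find hall0, ¬ (m ≤ K ∧ subPart N m ≠ subPart N' m) :=
      fun m hm => Nat.find_min hall0 hm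
    set n := Nat.find hall0
    have heq : subPart N ((n : ℤ) - 1) = subPart N' ((n : ℤ) - 1) := by
      rcases Nat.eq_zero_or_pos n with h0 | h0
      · rw [subPart_neg _ (by omega), subPart_neg _ (by omega)]
      · have := hmin (n - 1) (by omega)
        push Not at this
        have h1 := this (by omega)
        rwa [Nat.cast_sub h0, Nat.cast_one] at h1
    obtain ⟨j, B, A, hBg, hAg, hNB, hBA, hAN', hs, a, ha, haB⟩ :=
      exists_shiftedSimple_between hirr hall hN hNN' hex.2 heq
    have hlt : r B < r A := by
      refine Finset.sum_lt_sum (fun n _ => Submodule.finrank_mono (subPart_mono hBA n))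
        ⟨n, Finset.mem_range.2 (by omega), Submodule.finrank_lt_finrank_of_lt ?_⟩
      exact lt_of_le_of_ne (subPart_mono hBA n) fun h => haB (h ▸ ha : a ∈ subPart B n).1
    have h1 := hr hNB
    have h2 := hr hAN'
    refine (ih (r B - r N) (by omega) hN hBg hNB rfl).trans
      (Relation.ReflTransGen.head ⟨hBA, hBg, hAg, Or.inl ⟨j, n, hs⟩⟩
        (ih (r N' - r A) (by omega) hAg hN' hAN' rfl))

end Refinement

end Subquotients

/-! ### Composition multiplicities as coefficients of a power series. -/

section Multiplicities

variable {V : Type u} [AddCommGroup V] [Module ℂ V] [FiniteDimensional ℂ V] {D : Datum V}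

/-- The graded multiplicity of `σ` as a power series. -/
def multSeries {E : Type*} [AddCommGroup E] [Module ℂ E] {ρ : Representation ℂ D.G E}
    (𝓔 : RepGrading ρ) {W : Type*} [AddCommGroup W] [Module ℂ W] (σ : Representation ℂ D.G W) :
    ℤ⟦X⟧ := PowerSeries.mk fun n => (𝓔.mult σ (n : ℤ) : ℤ)

theorem mult_of_part_eq_bot {E : Type*} [AddCommGroup E] [Module ℂ E] {ρ : Representation ℂ D.G E}
    (𝓔 : RepGrading ρ) {W : Type*} [AddCommGroup W] [Module ℂ W] [FiniteDimensional ℂ W]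
    (σ : Representation ℂ D.G W) {n : ℤ} (h : 𝓔.part n = ⊥) : 𝓔.mult σ n = 0 := by
  have : FiniteDimensional ℂ (𝓔.part n) := by rw [h]; infer_instance
  have h1 := 𝓔.mult_eq_pairing σ n
  simp only [h, tr_bot] at h1
  have h2 : (fun _ : D.G => (0 : ℂ)) = 0 := rfl
  rw [h2, map_zero] at h1
  exact_mod_cast h1

/-- The grading of a submodule of a standard module. -/
def subGrading {W : Type w} [AddCommGroup W] [Module ℂ W] {τ : Representation ℂ D.G W}
    (N : Submodule (RCA D) (Verma D τ)) : RepGrading (gRep D (Verma D τ)) :=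
  ⟨subPart N, subPart_stable N⟩

section

variable {W W' : Type w} [AddCommGroup W] [Module ℂ W] [FiniteDimensional ℂ W]
  [AddCommGroup W'] [Module ℂ W'] [FiniteDimensional ℂ W']
  {τ : Representation ℂ D.G W} {σ : Representation ℂ D.G W'}

theorem IsShiftedSimple.mult_eq {N N' : Submodule (RCA D) (Verma D τ)} {k : ℤ}
    (hσ : σ.IsIrreducible) (hNN' : N ≤ N') (hN' : IsGraded D τ N')
    (h : IsShiftedSimple D τ σ k N N') {W'' : Type*} [AddCommGroup W''] [Module ℂ W'']
    [FiniteDimensional ℂ W''] (π : Representation ℂ D.G W'') (n : ℤ) :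
    (subGrading N').mult π n = (subGrading N).mult π n + (simpleGrading D σ).mult π (n - k) := by
  have h1 : FiniteDimensional ℂ ((subGrading N').part n) := finite_subPart N' n
  have h2 : FiniteDimensional ℂ ((subGrading N).part n) := finite_subPart N n
  have h3 : FiniteDimensional ℂ ((simpleGrading D σ).part (n - k)) := inferInstanceAs
    (FiniteDimensional ℂ ((vermaPart D σ (n - k)).map ((maxSub D σ).mkQ.restrictScalars ℂ)))
  have h4 : ((subGrading N').mult π n : ℂ) =
      (subGrading N).mult π n + (simpleGrading D σ).mult π (n - k) := by
    rw [RepGrading.mult_eq_pairing, RepGrading.mult_eq_pairing, RepGrading.mult_eq_pairing,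
      ← map_add]
    congr 1
    ext g
    have := h.tr_eq hσ hNN' hN' g (n - k)
    rwa [sub_add_cancel] at this
  exact_mod_cast h4

theorem IsShiftedSimple.multSeries_eq {N N' : Submodule (RCA D) (Verma D τ)} {k : ℕ}
    (hσ : σ.IsIrreducible) (hNN' : N ≤ N') (hN' : IsGraded D τ N')
    (h : IsShiftedSimple D τ σ k N N') {W'' : Type*} [AddCommGroup W''] [Module ℂ W'']
    [FiniteDimensional ℂ W''] (π : Representation ℂ D.G W'') :
    multSeries (subGrading N') π =
      multSeries (subGrading N) π + PowerSeries.X ^ k * multSeries (simpleGrading D σ) π := by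
  ext n
  rw [map_add, PowerSeries.coeff_X_pow_mul', multSeries, multSeries, multSeries,
    PowerSeries.coeff_mk, PowerSeries.coeff_mk, h.mult_eq hσ hNN' hN' π]
  push_cast
  congr 1
  split_ifs with hkn
  · rw [PowerSeries.coeff_mk, Nat.cast_sub hkn]
  · rw [mult_of_part_eq_bot]
    · rfl
    · exact quotPart_neg _ (by omega)

theorem tr_simplePart_zero (hσ : σ.IsIrreducible) (g : D.G) :
    tr (gRep D (Simple D σ) g) ((simpleGrading D σ).part 0) = σ.character g := by
  rw [← tr_vermaPart_zero D σ g]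
  refine (tr_map_injOn (fun m hm => vermaPart_stable D σ 0 g hm)
    ((maxSub D σ).mkQ.restrictScalars ℂ) (fun _ => rfl) fun m hm h0 => ?_).symm
  have h1 := (maxSub_aux hσ ((Submodule.Quotient.mk_eq_zero _).1 h0)).1
  rwa [(vermaGrading D σ).proj_self _ _ hm] at h1

end

variable {ι : Type v} [Fintype ι] [DecidableEq ι] {W : ι → Type w} [∀ i, AddCommGroup (W i)]
  [∀ i, Module ℂ (W i)] [∀ i, FiniteDimensional ℂ (W i)] (τ : ∀ i, Representation ℂ D.G (W i))

/-- The graded multiplicities of the `τ j` in the simple modules. -/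
def simpleMat : Matrix ι ι ℤ⟦X⟧ :=
  Matrix.of fun i j => multSeries (simpleGrading D (τ i)) (τ j)

variable {τ} (hirr : ∀ i, (τ i).IsIrreducible)
  (hdistinct : ∀ i j, Nonempty ((τ i).Equiv (τ j)) → i = j) (hall : IsExhaustive τ)

section

include hirr hdistinct

/-- The constant term of the matrix is the identity, because the degree $0$ part of $L(\tau_i)$ is
$\tau_i$. -/
theorem isUnit_det_simpleMat : IsUnit (simpleMat τ).det := by
  rw [PowerSeries.isUnit_iff_constantCoeff]
  have h : (simpleMat τ).map (PowerSeries.constantCoeff (R := ℤ)) = 1 := by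
    ext i j
    rw [Matrix.map_apply, ← PowerSeries.coeff_zero_eq_constantCoeff_apply]
    change PowerSeries.coeff 0 (multSeries _ _) = _
    rw [multSeries, PowerSeries.coeff_mk]
    have h3 : FiniteDimensional ℂ ((simpleGrading D (τ i)).part (0 : ℕ)) := inferInstanceAs
      (FiniteDimensional ℂ ((vermaPart D (τ i) 0).map
        ((maxSub D (τ i)).mkQ.restrictScalars ℂ)))
    have h4 := (simpleGrading D (τ i)).mult_eq_pairing (τ j) (0 : ℕ)
    have h5 : (fun g => tr (gRep D (Simple D (τ i)) g) ((simpleGrading D (τ i)).part (0 : ℕ))) =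
        (τ i).character := funext fun g => tr_simplePart_zero (hirr i) g
    rw [h5, pairing_irreducible hirr hdistinct] at h4
    rw [Matrix.one_apply]
    by_cases hij : i = j
    · rw [if_pos hij.symm] at h4
      rw [if_pos hij]
      exact_mod_cast h4
    · rw [if_neg (Ne.symm hij)] at h4
      rw [if_neg hij]
      exact_mod_cast h4
  have h2 := RingHom.map_det (PowerSeries.constantCoeff (R := ℤ)) (simpleMat τ)
  rw [h2, RingHom.mapMatrix_apply, h, Matrix.det_one]
  exact isUnit_one

end

/-- The coefficient counting the composition factors `L(τ j)` in degree `k`. -/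
def compCoeff {i : ι} (j : ι) (k : ℕ) (N : Submodule (RCA D) (Verma D (τ i))) : ℤ :=
  PowerSeries.coeff k
    (Matrix.vecMul (fun j => multSeries (subGrading N) (τ j)) (simpleMat τ)⁻¹ j)

/-- The coefficient of $q^k$ in a product only involves coefficients up to $k$. Steps of a
filtration that are invisible up to degree $k$ are therefore not counted. -/
theorem compCoeff_congr {i : ι} (j : ι) {k : ℕ} {N N' : Submodule (RCA D) (Verma D (τ i))}
    (h : ∀ n : ℕ, n ≤ k → subPart N n = subPart N' n) : compCoeff j k N = compCoeff j k N' := by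
  simp only [compCoeff, Matrix.vecMul, dotProduct, map_sum]
  refine Finset.sum_congr rfl fun l _ => ?_
  rw [PowerSeries.coeff_mul, PowerSeries.coeff_mul]
  refine Finset.sum_congr rfl fun p hp => ?_
  congr 1
  simp only [multSeries, PowerSeries.coeff_mk]
  have h1 := h p.1 (by have := Finset.HasAntidiagonal.mem_antidiagonal.1 hp; omega)
  have hfin : ∀ N : Submodule (RCA D) (Verma D (τ i)),
      FiniteDimensional ℂ ((subGrading N).part p.1) := fun N => finite_subPart N _
  have h2 : ((subGrading N).mult (τ l) p.1 : ℂ) = (subGrading N').mult (τ l) p.1 := by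
    rw [RepGrading.mult_eq_pairing, RepGrading.mult_eq_pairing]
    congr 1
    ext g
    exact congrArg (tr _) h1
  exact_mod_cast h2

section

include hirr hdistinct

/-- Across such a step the multiplicity vector grows by $q^{k'}$ times row $j'$ of the matrix of the
simple modules. Multiplication by the inverse matrix turns this into $q^{k'}$ times a unit vector.
-/
theorem compCoeff_shiftedSimple {i j' : ι} (j : ι) (k : ℕ) {k' : ℤ}
    {N N' : Submodule (RCA D) (Verma D (τ i))} (hNN' : N ≤ N') (hN' : IsGraded D (τ i) N')
    (h : IsShiftedSimple D (τ i) (τ j') k' N N') :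
    compCoeff j k N' = compCoeff j k N + if j' = j ∧ k' = k then 1 else 0 := by
  lift k' to ℕ using h.nonneg (hirr j') hN'
  have h1 : (fun j => multSeries (subGrading N') (τ j)) =
      (fun j => multSeries (subGrading N) (τ j)) + (PowerSeries.X ^ k' : ℤ⟦X⟧) • simpleMat τ j' :=
    funext fun j => h.multSeries_eq (hirr j') hNN' hN' (τ j)
  have h2 : Matrix.vecMul (simpleMat τ j') (simpleMat τ)⁻¹ = (1 : Matrix ι ι ℤ⟦X⟧) j' := by
    rw [← Matrix.mul_nonsing_inv _ (isUnit_det_simpleMat hirr hdistinct)]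
    rfl
  rw [compCoeff, compCoeff, h1, Matrix.add_vecMul, Matrix.smul_vecMul, h2, Pi.add_apply, map_add,
    Pi.smul_apply, smul_eq_mul, Matrix.one_apply]
  congr 1
  by_cases hj : j' = j
  · rw [if_pos hj, mul_one, PowerSeries.coeff_X_pow]
    refine if_congr ?_ rfl rfl
    rw [and_iff_right hj, Nat.cast_inj, eq_comm]
  · rw [if_neg hj, mul_zero, map_zero, if_neg (fun h => hj h.1)]

open Classical in
theorem compCoeff_step {i : ι} (j : ι) (k : ℕ)
    {N N' : Submodule (RCA D) (Verma D (τ i))} (h : Step τ k N N') :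
    compCoeff j k N ≤ compCoeff j k N' ∧ compCoeff j k N' ≤ compCoeff j k N +
      if IsShiftedSimple D (τ i) (τ j) k N N' then 1 else 0 := by
  obtain ⟨hNN', -, hN', ⟨j', k', hs⟩ | h0⟩ := h
  · rw [compCoeff_shiftedSimple hirr hdistinct j k hNN' hN' hs]
    by_cases hjk : j' = j ∧ k' = k
    · obtain ⟨rfl, rfl⟩ := hjk
      rw [if_pos ⟨rfl, rfl⟩, if_pos hs]
      exact ⟨by omega, le_rfl⟩
    · rw [if_neg hjk]
      refine ⟨by omega, ?_⟩
      split_ifs <;> omega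
  · rw [compCoeff_congr j h0]
    refine ⟨le_rfl, ?_⟩
    split_ifs <;> omega

omit [Fintype ι] [DecidableEq ι] [∀ i, FiniteDimensional ℂ (W i)] hirr hdistinct in
theorem le_of_reflTransGen_step {i : ι} {k : ℕ} {N N' : Submodule (RCA D) (Verma D (τ i))}
    (h : Relation.ReflTransGen (Step τ k) N N') : N ≤ N' := by
  induction h with
  | refl => exact le_rfl
  | tail _ h ih => exact ih.trans h.1

-- Between two graded submodules there is a chain of refined steps, and each adds $0$ or $1$.
-- Nonnegativity is not visible from the power series alone.
include hall in
theorem compCoeff_mono {i : ι} (j : ι) (k : ℕ) {N N' : Submodule (RCA D) (Verma D (τ i))}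
    (hN : IsGraded D (τ i) N) (hN' : IsGraded D (τ i) N') (hNN' : N ≤ N') :
    compCoeff j k N ≤ compCoeff j k N' := by
  have h := exists_refinement hirr hall k hN hN' hNN'
  induction h with
  | refl => exact le_rfl
  | tail h1 h2 ih =>
    exact (ih h2.2.1 (le_of_reflTransGen_step h1)).trans
      (compCoeff_step hirr hdistinct j k h2).1

open Classical in
include hall in
theorem compCoeff_le {i : ι} (j : ι) (k : ℕ) {N N' : Submodule (RCA D) (Verma D (τ i))}
    (hN : IsGraded D (τ i) N) (hN' : IsGraded D (τ i) N') (hNN' : N ≤ N') :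
    (compCoeff j k N + if IsShiftedSimple D (τ i) (τ j) k N N' then 1 else 0) ≤
      compCoeff j k N' := by
  split_ifs with h
  · rw [compCoeff_shiftedSimple hirr hdistinct j k hNN' hN' h, if_pos ⟨rfl, rfl⟩]
  · rw [add_zero]
    exact compCoeff_mono hirr hdistinct hall j k hN hN' hNN'

end

theorem compCoeff_bot {i : ι} (j : ι) (k : ℕ) :
    compCoeff j k (⊥ : Submodule (RCA D) (Verma D (τ i))) = 0 := by
  have h : (fun j => multSeries (subGrading (⊥ : Submodule (RCA D) (Verma D (τ i)))) (τ j)) = 0 := by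
    ext j n
    rw [multSeries, PowerSeries.coeff_mk, mult_of_part_eq_bot]
    · simp
    · exact bot_inf_eq _
  rw [compCoeff, h, Matrix.zero_vecMul]
  simp

theorem sum_fin_sub (p : ℕ) (a : Fin (p + 1) → ℤ) :
    ∑ i : Fin p, (a i.succ - a i.castSucc) = a (Fin.last p) - a 0 := by
  induction p with
  | zero => simp
  | succ p ih =>
    rw [Fin.sum_univ_castSucc]
    have := ih fun i => a i.castSucc
    simp only [Fin.succ_castSucc] at this ⊢
    rw [this, Fin.succ_last, Fin.castSucc_zero]
    ring

theorem exists_chain {α : Type*} {r : α → α → Prop} {a b : α} (h : Relation.ReflTransGen r a b) :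
    ∃ (p : ℕ) (F : ℕ → α), F 0 = a ∧ F p = b ∧ ∀ i < p, r (F i) (F (i + 1)) := by
  induction h with
  | refl => exact ⟨0, fun _ => a, rfl, rfl, fun i hi => absurd hi (Nat.not_lt_zero i)⟩
  | @tail b c _ hbc ih =>
    obtain ⟨p, F, h0, hp, hF⟩ := ih
    refine ⟨p + 1, fun i => if i ≤ p then F i else c, by simpa using h0, by simp, fun i hi => ?_⟩
    rcases Nat.lt_succ_iff_lt_or_eq.1 hi with hi | rfl
    · simpa [hi.le, Nat.succ_le_of_lt hi] using hF i hi
    · simpa [hp] using hbc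

section

include hirr hdistinct hall

/-- The functional `compCoeff` telescopes along a filtration. Any filtration contains at most as
many subquotients of the given type as the total increase; a filtration refined up to degree $k$ has
no other source of increase, so the supremum is attained. -/
theorem compMult_eq (i j : ι) (k : ℕ) :
    ∃ a : ℕ, compMult D (τ i) (τ j) k = a ∧
      (a : ℤ) = compCoeff j k (⊤ : Submodule (RCA D) (Verma D (τ i))) := by
  classical
  have hcard : ∀ (p : ℕ) (F : Fin (p + 1) → Submodule (RCA D) (Verma D (τ i))),
      {l : Fin p | IsShiftedSimple D (τ i) (τ j) k (F l.castSucc) (F l.succ)}.encard =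
        ((Finset.univ.filter fun l : Fin p =>
          IsShiftedSimple D (τ i) (τ j) k (F l.castSucc) (F l.succ)).card : ℕ∞) := by
    intro p F
    rw [← Set.encard_coe_eq_coe_finsetCard]
    simp
  have h0 := compCoeff_mono hirr hdistinct hall j k (isGraded_bot (D := D) (τ := τ i)) isGraded_top
    bot_le
  rw [compCoeff_bot] at h0
  obtain ⟨a, ha⟩ := Int.eq_ofNat_of_zero_le h0
  refine ⟨a, le_antisymm ?_ ?_, ha.symm⟩
  · refine iSup_le fun p => iSup₂_le fun F ⟨hmono, hF0, hFp, hgr⟩ => ?_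
    rw [hcard]
    have h1 : (((Finset.univ.filter fun l : Fin p =>
        IsShiftedSimple D (τ i) (τ j) k (F l.castSucc) (F l.succ)).card : ℕ) : ℤ) ≤ a := by
      rw [Finset.card_filter, ← ha]
      push_cast
      calc _ ≤ ∑ l : Fin p, (compCoeff j k (F l.succ) - compCoeff j k (F l.castSucc)) :=
            Finset.sum_le_sum fun l _ => by
              have := compCoeff_le hirr hdistinct hall j k (hgr l.castSucc) (hgr l.succ)
                (hmono (Fin.castSucc_le_succ l))
              linarith
        _ = _ := by rw [sum_fin_sub p fun l => compCoeff j k (F l), hF0, hFp, compCoeff_bot,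
                      sub_zero]
    exact_mod_cast h1
  · obtain ⟨p, F, hF0, hFp, hF⟩ := exists_chain
      (exists_refinement hirr hall k (isGraded_bot (D := D) (τ := τ i)) isGraded_top bot_le)
    let F' : Fin (p + 1) → Submodule (RCA D) (Verma D (τ i)) := fun l => F l
    have hst : ∀ l : Fin p, Step τ k (F' l.castSucc) (F' l.succ) := fun l => hF l l.2
    refine le_trans ?_ (le_iSup_of_le p (le_iSup₂_of_le F'
      ⟨Fin.monotone_iff_le_succ.2 fun l => (hst l).1, hF0, hFp, fun l => ?_⟩ le_rfl))
    · rw [hcard]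
      have h1 : (a : ℤ) ≤ (((Finset.univ.filter fun l : Fin p =>
          IsShiftedSimple D (τ i) (τ j) k (F' l.castSucc) (F' l.succ)).card : ℕ) : ℤ) := by
        rw [Finset.card_filter, ← ha]
        push_cast
        have hF0' : F' 0 = ⊥ := hF0
        have hFp' : F' (Fin.last p) = ⊤ := hFp
        calc _ = ∑ l : Fin p, (compCoeff j k (F' l.succ) - compCoeff j k (F' l.castSucc)) := by
              rw [sum_fin_sub p fun l => compCoeff j k (F' l), hF0', hFp', compCoeff_bot, sub_zero]
          _ ≤ _ := Finset.sum_le_sum fun l _ => by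
              have := (compCoeff_step hirr hdistinct j k (hst l)).2
              linarith
      exact_mod_cast h1
    · refine Fin.cases ?_ (fun l => (hst l).2.2.1) l
      change IsGraded D (τ i) (F 0)
      rw [hF0]
      exact isGraded_bot

end

end Multiplicities

section

variable {V : Type u} [AddCommGroup V] [Module ℂ V] [FiniteDimensional ℂ V] {D : Datum V}
  {W W' : Type w} [AddCommGroup W] [Module ℂ W] [AddCommGroup W'] [Module ℂ W']
  {τ : Representation ℂ D.G W} {σ : Representation ℂ D.G W'}

theorem exists_isShiftedSimple_of_compMult_ne_zero {k : ℤ} (h : compMult D τ σ k ≠ 0) :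
    ∃ N N' : Submodule (RCA D) (Verma D τ),
      IsGraded D τ N' ∧ IsShiftedSimple D τ σ k N N' := by
  by_contra! hno
  refine h (le_antisymm (iSup_le fun p => iSup₂_le fun F ⟨_, _, _, hgr⟩ => ?_) bot_le)
  rw [nonpos_iff_eq_zero, Set.encard_eq_zero, Set.eq_empty_iff_forall_notMem]
  exact fun l hl => hno _ _ (hgr l.succ) hl

theorem compMult_neg (hσ : σ.IsIrreducible)
    {k : ℤ} (hk : k < 0) : compMult D τ σ k = 0 := by
  by_contra h
  obtain ⟨N, N', hN', h⟩ := exists_isShiftedSimple_of_compMult_ne_zero h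
  exact absurd (h.nonneg hσ hN') (by omega)

end

/-! ### The inverse matrices. -/

section InverseMatrices

variable {V : Type u} [AddCommGroup V] [Module ℂ V] [FiniteDimensional ℂ V] {D : Datum V}
  {ι : Type v} [Fintype ι] [DecidableEq ι] {W : ι → Type w} [∀ i, AddCommGroup (W i)]
  [∀ i, Module ℂ (W i)] [∀ i, FiniteDimensional ℂ (W i)] (τ : ∀ i, Representation ℂ D.G (W i))

/-- The graded multiplicities of the `τ j` in the virtual modules `τ i ⊗ (S^{*,+} - S^{*,-})`. -/
def eulerMat : Matrix ι ι ℂ⟦X⟧ :=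
  Matrix.of fun i j => PowerSeries.mk fun l => pairing (τ j) fun g =>
    (τ i).character g * ((-1) ^ l * tr (spinRep D g) (⋀[ℂ]^l (Module.Dual ℂ V)))

variable {τ} (hirr : ∀ i, (τ i).IsIrreducible)
  (hdistinct : ∀ i j, Nonempty ((τ i).Equiv (τ j)) → i = j) (hall : IsExhaustive τ)

include hirr hdistinct

section

include hall

-- Expanding the characters of the graded pieces in irreducible characters turns the alternating sum
-- over form degrees into a product of matrices of power series.
omit [DecidableEq ι] in
theorem pairing_sum_tr {X : Type*} [AddCommGroup X] [Module ℂ X] {ρ : Representation ℂ D.G X}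
    (𝓧 : RepGrading ρ) (hfin : ∀ n, FiniteDimensional ℂ (𝓧.part n)) (j : ι) (n : ℕ) :
    pairing (τ j) (fun g => ∑ l ∈ Finset.range (n + 1), (-1) ^ l *
      (tr (ρ g) (𝓧.part (n - l)) * tr (spinRep D g) (⋀[ℂ]^l (Module.Dual ℂ V)))) =
    PowerSeries.coeff n (∑ i, PowerSeries.map (Int.castRingHom ℂ) (multSeries 𝓧 (τ i)) *
      eulerMat τ i j) := by
  have h1 : ∀ (k : ℤ) (g : D.G), tr (ρ g) (𝓧.part k) =
      ∑ i, (𝓧.mult (τ i) k : ℂ) * (τ i).character g := by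
    intro k g
    have := hfin k
    have h2 := congrFun (character_eq_sum hirr hdistinct hall (𝓧.rep k)) g
    rw [subrep_character, Finset.sum_apply] at h2
    rw [h2]
    refine Finset.sum_congr rfl fun i _ => ?_
    rw [𝓧.mult_eq_pairing, Pi.smul_apply, smul_eq_mul]
    congr 2
    ext g
    exact subrep_character _ _ _ g
  have h3 : (fun g => ∑ l ∈ Finset.range (n + 1), (-1) ^ l *
      (tr (ρ g) (𝓧.part (n - l)) * tr (spinRep D g) (⋀[ℂ]^l (Module.Dual ℂ V)))) =
      ∑ l ∈ Finset.range (n + 1), ∑ i, (𝓧.mult (τ i) (n - l) : ℂ) • fun g => (τ i).character g *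
        ((-1) ^ l * tr (spinRep D g) (⋀[ℂ]^l (Module.Dual ℂ V))) := by
    ext g
    simp only [Finset.sum_apply, Pi.smul_apply, smul_eq_mul]
    refine Finset.sum_congr rfl fun l _ => ?_
    rw [h1, Finset.sum_mul, Finset.mul_sum]
    exact Finset.sum_congr rfl fun i _ => by ring
  rw [h3, map_sum, map_sum]
  simp only [map_sum, map_smul]
  rw [Finset.sum_comm]
  refine Finset.sum_congr rfl fun i _ => ?_
  rw [mul_comm, PowerSeries.coeff_mul, Finset.Nat.sum_antidiagonal_eq_sum_range_succ_mk]
  refine Finset.sum_congr rfl fun l hl => ?_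
  rw [PowerSeries.coeff_map, multSeries, PowerSeries.coeff_mk, eulerMat, Matrix.of_apply,
    PowerSeries.coeff_mk, Nat.cast_sub (by rw [Finset.mem_range] at hl; omega), smul_eq_mul,
    mul_comm]
  simp

/-- The matrices of graded multiplicities in the standard modules and of the Koszul resolutions are
inverse to each other. -/
theorem vermaMat_mul_eulerMat :
    (Matrix.of fun i j => PowerSeries.map (Int.castRingHom ℂ)
      (multSeries (vermaRepGrading D (τ i)) (τ j))) * eulerMat τ = 1 := by
  ext i j n
  rw [Matrix.mul_apply]
  refine (pairing_sum_tr hirr hdistinct hall (vermaRepGrading D (τ i))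
    (fun n => finite_vermaPart D (τ i) n) j n).symm.trans ?_
  change pairing (τ j) (fun g => ∑ l ∈ Finset.range (n + 1), (-1) ^ l *
    (tr (gRep D (Verma D (τ i)) g) (vermaPart D (τ i) (n - l)) *
      tr (spinRep D g) (⋀[ℂ]^l (Module.Dual ℂ V)))) = _
  simp only [sum_tr_vermaPart]
  rcases eq_or_ne n 0 with rfl | hn
  · simp only [if_true]
    refine (pairing_irreducible hirr hdistinct j i).trans ?_
    rw [Matrix.one_apply]
    by_cases hij : i = j
    · simp [hij]
    · simp [hij, Ne.symm hij]
  · simp only [if_neg hn]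
    refine (map_zero (pairing (τ j))).trans ?_
    rw [Matrix.one_apply]
    split_ifs <;> simp [PowerSeries.coeff_one, hn]

end

omit [Fintype ι] [DecidableEq ι] hdistinct in
theorem indexMult_eq_pairing (i j : ι) (n : ℤ) :
    (indexMult D (simpleGrading D (τ i)) (τ j) n : ℂ) =
      pairing (τ j) fun g => indexCharCoeff D (simpleGrading D (τ i)) g n := by
  obtain ⟨r, hr⟩ := exists_classOp_scalar D (τ i) (hirr i)
  obtain ⟨N, hN⟩ := exists_simple_bound (hirr i)
  have h1 : ∀ ε, ((diracCohGrading D (simpleGrading D (τ i)) ε).mult (τ j) n : ℂ) =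
      pairing (τ j) ((diracCohGrading D (simpleGrading D (τ i)) ε).rep n).character := by
    intro ε
    have := (simpleEuler (hirr i) hr).finite_diracCoh hN ε
    have : FiniteDimensional ℂ ((diracCohGrading D (simpleGrading D (τ i)) ε).part n) :=
      FiniteDimensional.finiteDimensional_submodule _
    exact (pairing_character (τ j) _).symm
  rw [indexMult, Int.cast_sub, Int.cast_natCast, Int.cast_natCast, h1, h1, ← map_sub]
  rfl

omit [Fintype ι] [DecidableEq ι] hdistinct in
theorem exists_indexMult_polynomial (i j : ι) : ∃ p : ℤ[X],
    ∀ n : ℤ, ((p : ℤ⟦X⟧) : LaurentSeries ℤ).coeff n =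
      indexMult D (simpleGrading D (τ i)) (τ j) n := by
  obtain ⟨r, hr⟩ := exists_classOp_scalar D (τ i) (hirr i)
  obtain ⟨N, hN⟩ := exists_simple_bound (hirr i)
  have h0 : ∀ n : ℤ, (∀ g, indexCharCoeff D (simpleGrading D (τ i)) g n = 0) →
      indexMult D (simpleGrading D (τ i)) (τ j) n = 0 := by
    intro n h
    have h1 := indexMult_eq_pairing hirr i j n
    rw [show (fun g => indexCharCoeff D (simpleGrading D (τ i)) g n) = 0 from funext h,
      map_zero] at h1
    exact_mod_cast h1
  obtain ⟨p, hp⟩ := exists_polynomial_coeff (c := indexMult D (simpleGrading D (τ i)) (τ j))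
    fun n hn => h0 n fun g => (simpleEuler (hirr i) hr).indexCharCoeff_eq_zero (hN n hn) g
  exact ⟨p, coe_powerSeries_coeff (fun n => by rw [Polynomial.coeff_coe, hp])
    fun n hn => h0 n fun g => (simpleEuler (hirr i) hr).indexCharCoeff_neg g hn⟩

-- The index theorem $I_D(L)=L\otimes(S^{*,+}-S^{*,-})$ read in graded multiplicities.
omit [DecidableEq ι] in
include hall in
theorem index_eq_simpleMat_mul_eulerMat {d : Matrix ι ι ℤ[X]}
    (hd : ∀ i j, ∀ n : ℤ, ((d i j : ℤ⟦X⟧) : LaurentSeries ℤ).coeff n =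
      indexMult D (simpleGrading D (τ i)) (τ j) n) :
    (d.map fun p => (p : ℤ⟦X⟧)).map (PowerSeries.map (Int.castRingHom ℂ)) =
      (simpleMat τ).map (PowerSeries.map (Int.castRingHom ℂ)) * eulerMat τ := by
  ext i j n
  obtain ⟨r, hr⟩ := exists_classOp_scalar D (τ i) (hirr i)
  have h1 := hd i j n
  rw [PowerSeries.coeff_coe, if_neg (by omega), Int.natAbs_natCast, Polynomial.coeff_coe] at h1
  rw [Matrix.map_apply, Matrix.map_apply, PowerSeries.coeff_map, Polynomial.coeff_coe, h1,
    Matrix.mul_apply]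
  refine (indexMult_eq_pairing hirr i j n).trans ?_
  simp only [(simpleEuler (hirr i) hr).indexCharCoeff_eq, Int.toNat_natCast]
  exact pairing_sum_tr hirr hdistinct hall (simpleGrading D (τ i)) (simpleEuler (hirr i) hr).fin j n

variable (τ) in
/-- The graded composition multiplicities of the standard modules. -/
def compMat : Matrix ι ι ℤ⟦X⟧ :=
  (Matrix.of fun i j => multSeries (vermaRepGrading D (τ i)) (τ j)) * (simpleMat τ)⁻¹

-- If $P$, $S$, $E$ are the matrices of the standard modules, of the simple modules and of the
-- virtual spin modules, then $d=SE$ and $PE=1$, whence $PS^{-1}d=PE=1$. As $E$ has complex entries,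
-- the computation takes place over $\mathbb C$ and is pulled back along the injection of $\mathbb
-- Z$.
include hall in
theorem compMat_mul_index {d : Matrix ι ι ℤ[X]}
    (hd : ∀ i j, ∀ n : ℤ, ((d i j : ℤ⟦X⟧) : LaurentSeries ℤ).coeff n =
      indexMult D (simpleGrading D (τ i)) (τ j) n) :
    compMat τ * (d.map fun p => (p : ℤ⟦X⟧)) = 1 := by
  have hinj : Function.Injective (PowerSeries.map (Int.castRingHom ℂ)) :=
    PowerSeries.map_injective _ (RingHom.injective_int _)
  refine Matrix.map_injective hinj ?_
  have h1 : compMat τ * simpleMat τ =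
      Matrix.of fun i j => multSeries (vermaRepGrading D (τ i)) (τ j) := by
    rw [compMat, Matrix.mul_assoc,
      Matrix.nonsing_inv_mul _ (isUnit_det_simpleMat hirr hdistinct), Matrix.mul_one]
  change (compMat τ * (d.map fun p => (p : ℤ⟦X⟧))).map _ = (1 : Matrix ι ι ℤ⟦X⟧).map _
  rw [Matrix.map_mul, index_eq_simpleMat_mul_eulerMat hirr hdistinct hall hd, ← Matrix.mul_assoc,
    ← Matrix.map_mul, h1]
  refine (vermaMat_mul_eulerMat hirr hdistinct hall).trans ?_
  rw [Matrix.map_one _ (map_zero _) (map_one _)]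

include hall in
theorem compMat_coeff (i j : ι) (k : ℤ) : ∃ a : ℕ, compMult D (τ i) (τ j) k = a ∧
    (compMat τ i j : LaurentSeries ℤ).coeff k = a := by
  rw [PowerSeries.coeff_coe]
  split_ifs with hk
  · exact ⟨0, compMult_neg (hirr j) hk, rfl⟩
  · lift k to ℕ using not_lt.1 hk
    obtain ⟨a, h1, h2⟩ := compMult_eq hirr hdistinct hall i j k
    refine ⟨a, h1, ?_⟩
    rw [Int.natAbs_natCast, h2, compCoeff]
    have h3 : (fun j => multSeries (subGrading (⊤ : Submodule (RCA D) (Verma D (τ i)))) (τ j)) =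
        fun j => multSeries (vermaRepGrading D (τ i)) (τ j) := by
      have : subGrading (⊤ : Submodule (RCA D) (Verma D (τ i))) = vermaRepGrading D (τ i) := by
        simp only [subGrading, vermaRepGrading, RepGrading.mk.injEq]
        exact funext fun n => top_inf_eq _
      rw [this]
    rw [h3]
    rfl

-- A nonzero coefficient in degree $k$ yields an actual subquotient, hence $tk+r=r'$. For $t\ne0$
-- this determines $k$, so each entry has at most one nonzero coefficient.
include hall in
theorem exists_compMat_polynomial (ht : D.t ≠ 0) (i j : ι) :
    ∃ p : ℤ[X], compMat τ i j = p := by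
  obtain ⟨r, hr⟩ := exists_classOp_scalar D (τ i) (hirr i)
  obtain ⟨r', hr'⟩ := exists_classOp_scalar D (τ j) (hirr j)
  have h1 : ∀ k : ℕ, PowerSeries.coeff k (compMat τ i j) ≠ 0 → D.t * k + r = r' := by
    intro k hk
    obtain ⟨a, h2, h3⟩ := compMat_coeff hirr hdistinct hall i j k
    rw [PowerSeries.coeff_coe, if_neg (by omega), Int.natAbs_natCast] at h3
    obtain ⟨N, N', hN', h⟩ := exists_isShiftedSimple_of_compMult_ne_zero (D := D) (τ := τ i)
      (σ := τ j) (k := k) (by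
        rw [h2]
        rw [h3] at hk
        exact_mod_cast hk)
    exact_mod_cast h.euler_eq (hirr j) hN' hr hr'
  have h2 : ∃ K : ℕ, ∀ k : ℕ, K ≤ k → PowerSeries.coeff k (compMat τ i j) = 0 := by
    by_cases h0 : ∃ k : ℕ, PowerSeries.coeff k (compMat τ i j) ≠ 0
    · obtain ⟨k, hk⟩ := h0
      refine ⟨k + 1, fun l hl => ?_⟩
      by_contra hl0
      have h3 : D.t * k = D.t * l := add_right_cancel ((h1 k hk).trans (h1 l hl0).symm)
      have h4 : (k : ℂ) = l := mul_left_cancel₀ ht h3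
      have h5 : k = l := by exact_mod_cast h4
      omega
    · push Not at h0
      exact ⟨0, fun k _ => h0 k⟩
  obtain ⟨K, hK⟩ := h2
  refine ⟨PowerSeries.trunc K (compMat τ i j), ?_⟩
  ext k
  rw [Polynomial.coeff_coe, PowerSeries.coeff_trunc]
  split_ifs with hk
  · rfl
  · exact hK k (not_lt.1 hk)

end InverseMatrices

end Cherednik

end

/-! ### Assembly of the main theorem. -/

theorem theoremA {V : Type u} [AddCommGroup V] [Module ℂ V] [FiniteDimensional ℂ V]
    (D : Cherednik.Datum V)
    {ι : Type v} [Fintype ι] [DecidableEq ι]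
    (W : ι → Type w) [∀ i, AddCommGroup (W i)] [∀ i, Module ℂ (W i)]
    [∀ i, FiniteDimensional ℂ (W i)]
    (τ : ∀ i, Representation ℂ D.G (W i))
    (hirr : ∀ i, (τ i).IsIrreducible)
    (hdistinct : ∀ i j, Nonempty ((τ i).Equiv (τ j)) → i = j)
    (hall : ∀ (n : ℕ) (π : Representation ℂ D.G (Fin n → ℂ)), π.IsIrreducible →
      ∃ i, Nonempty (π.Equiv (τ i))) :
    (∀ i,
      IsSimpleModule (Cherednik.RCA D) (Cherednik.Simple D (τ i)) ∧
      (∀ n, FiniteDimensional ℂ ((Cherednik.simpleGrading D (τ i)).part n)) ∧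
      (∀ ε, FiniteDimensional ℂ (Cherednik.DiracCoh D (Cherednik.Simple D (τ i)) ε)) ∧
      ∀ g : D.G, ∃ (chL : ℂ⟦X⟧) (chI : ℂ[X]),
        (∀ n : ℤ, (chL : LaurentSeries ℂ).coeff n =
          Cherednik.charCoeff D (Cherednik.simpleGrading D (τ i)) g n) ∧
        (∀ n : ℤ, ((chI : ℂ⟦X⟧) : LaurentSeries ℂ).coeff n =
          Cherednik.indexCharCoeff D (Cherednik.simpleGrading D (τ i)) g n) ∧
        (chL : LaurentSeries ℂ) =
          ((chI : ℂ⟦X⟧) : LaurentSeries ℂ) /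
            ((Cherednik.detDual D g : ℂ⟦X⟧) : LaurentSeries ℂ)) ∧
    ∃ (d : Matrix ι ι ℤ[X]) (m : Matrix ι ι ℤ⟦X⟧),
      (∀ i j, ∀ k : ℤ, ((d i j : ℤ⟦X⟧) : LaurentSeries ℤ).coeff k =
        Cherednik.indexMult D (Cherednik.simpleGrading D (τ i)) (τ j) k) ∧
      (∀ i j, ∀ k : ℤ, ∃ a : ℕ, Cherednik.compMult D (τ i) (τ j) k = a ∧
        (m i j : LaurentSeries ℤ).coeff k = a) ∧
      (D.t ≠ 0 → ∀ i j, ∃ p : ℤ[X], m i j = p) ∧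
      d.map (fun p => (p : ℤ⟦X⟧)) * m = 1 ∧
      m * d.map (fun p => (p : ℤ⟦X⟧)) = 1 := by
  have hd := fun i => Classical.axiom_of_choice
    (Cherednik.exists_indexMult_polynomial (D := D) hirr i)
  obtain ⟨d, hd⟩ := Classical.axiom_of_choice hd
  have hmul := Cherednik.compMat_mul_index hirr hdistinct hall (d := Matrix.of d) hd
  refine ⟨fun i => ?_, Matrix.of d, Cherednik.compMat τ, hd,
    Cherednik.compMat_coeff hirr hdistinct hall,
    Cherednik.exists_compMat_polynomial hirr hdistinct hall,
    -- A one-sided inverse of a square matrix over a commutative ring is two-sided.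
    mul_eq_one_comm.1 hmul, hmul⟩
  obtain ⟨r, hr⟩ := Cherednik.exists_classOp_scalar D (τ i) (hirr i)
  obtain ⟨N, hN⟩ := Cherednik.exists_simple_bound (hirr i)
  have 𝓖 := Cherednik.simpleEuler (hirr i) hr
  exact ⟨Cherednik.isSimpleModule_simple (hirr i), 𝓖.fin, 𝓖.finite_diracCoh hN,
    𝓖.character_formula hN⟩
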